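/- **Setting.** Let $\mathcal H$ be a complex Hilbert space (inner product $\alpha^*\beta$, antilinear in $\alpha$) with an isometric antilinear involution $\phi\mapsto\bar\phi$ (the conjugation; $\phi$ is real if $\bar\phi=\phi$), and let $o\ge 0$ be a self-adjoint operator in $\mathcal H$ commuting with the conjugation, with discrete spectrum and with $\operatorname{tr}(1+o)^{-q}<\infty$ for some $q>0$; let $(e_i)_{i\in I}$ be an orthonormal basis of real eigenvectors, $oe_i=\lambda_ie_i$, and $\mathcal H^\infty=\bigcap_s D((1+o)^s)$. (For example $\mathcal H=L^2(X)$ with $o$ the Laplacian of a compact Riemannian manifold $X$, or the harmonic oscillator for $X=\mathbb R^d$.) Let $\gamma$ be the product of standard Gaussian measures on $\mathbb R^I$ and $\mathcal G=L^2(\mathbb R^I,\gamma;\mathbb C)$ (the Gauss Fock space), with annihilators $F_i^-=\partial_{\xi_i}$, creators $F_i^+=\xi_i-\partial_{\xi_i}$, vacuum $F_0=1$ and coherent functionals $F_\alpha=\sum_{m\ge0}\frac1{m!}F^+(\alpha)^mF_0$, $\alpha\in\mathcal H$, where $F^+(\alpha)=\sum_i(e_i^*\alpha)F_i^+$. Let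 $\mathcal G^\infty=\bigcap_s D(d\Gamma(1+o)^s)$, where $d\Gamma(1+o)$ has the eigenvalue $\sum_i n_i(1+\lambda_i)$ on the Hermite polynomial $\prod_i \mathrm{He}_{n_i}(\xi_i)$. For $f\in\mathcal H$ in $\mathcal H^\infty$ real, put $\xi(f)=\sum_i (e_i^*f)\,\xi_i$, which converges absolutely for $\gamma$-almost every $\xi$. A *cutoff symbol* of order $m$ is a finite family of kernels $W_{k,l}$, $k+l\le m$, in $(\mathcal H^\infty)^{\otimes(k+l)}$, i.e. with coefficients $W_{k,l}(i,j)$, $i\in I^k$, $j\in I^l$, such that $|W_{k,l}(i,j)|\,\bigl(\prod_a(1+\lambda_{i_a})\prod_c(1+\lambda_{j_c})\bigr)^s$ is bounded for every $s\in\mathbb N$. Put $$H(\alpha^*,\beta)=\sum_{k,l}\sum_{i,j}W_{k,l}(i,j)\prod_a\overline{e_{i_a}^*\alpha}\prod_c e_{j_c}^*\beta,$$ and let $\hat H=\sum_{k,l}\sum_{i,j}W_{k,l}(i,j)\prod_aF^+_{i_a}\prod_cF^-_{j_c}$, with domain $\mathcal G^\infty$: $\hat HF=G$ means that $Q^*G=\sum_{k,l}\sum_{i,j}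 W_{k,l}(i,j)\,\bigl(\prod_cF^+_{j_c}\prod_aF^-_{i_a}Q\bigr)^*F$ for all polynomials $Q$ in the coordinates. It is a *Hamiltonian operator* if $H(\alpha^*,\alpha)$ is real for every $\alpha\in\mathcal H^\infty$. Let $(p_n)$ be an increasing sequence of orthogonal projectors in $\mathcal H$, commuting with the conjugation, with finite-dimensional ranges contained in $\mathcal H^\infty$, and with $\bigcup_n p_n\mathcal H$ dense in $\mathcal H$; let $P_n$ be the orthogonal projector of $\mathcal G$ onto the closed linear span of $\{F_\alpha:\alpha\in p_n\mathcal H\}$. Let $\hat H$ be a cutoff Hamiltonian operator such that $P_n\hat HP_n$ (with domain $\{F: P_nF\in\mathcal G^\infty\}$) is bounded from below, and let the *reduced Hamiltonian operator* $\hat H_n$ be the Friedrichs extension of $P_n\hat HP_n$ in $\mathcal G$. **Proposition 3.1.** Under these assumptions, for every $n$, $\hat H_n$ is a polynomial partial differential operator in $P_n\mathcal G$ with the normal symbol $H(p_n\alpha^*,p_n\alpha)$. Precisely: 1. $P_n$ is the second quantization of $p_n$: $P_nF_\alpha=F_{p_n\alpha}$ for all $\alpha\in\mathcal H$. 2. $\hat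 H_n$ is an operator in $P_n\mathcal G$: if $u\in D(\hat H_n)$ then $P_nu\in D(\hat H_n)$ and $\hat H_nP_nu=\hat H_nu=P_n\hat H_nu$. 3. For all $\alpha,\beta\in\mathcal H$: $F_\beta\in D(\hat H_n)$ and $F_\alpha^*\hat H_nF_\beta=H(p_n\alpha^*,p_n\beta)\,e^{(p_n\alpha)^*p_n\beta}$. 4. $p_n\mathcal H$ has an orthonormal basis of real vectors. For every such basis $b_1,\dots,b_r$, with $\pi(\xi)=(\xi(b_1),\dots,\xi(b_r))\in\mathbb R^r$, the space $P_n\mathcal G$ consists of the $F\in\mathcal G$ of the form $F=f\circ\pi$ almost everywhere with $f:\mathbb R^r\to\mathbb C$ measurable, and there is a polynomial $w(\bar z,z)=\sum_{I,J}w_{IJ}\bar z^Iz^J$ ($I,J\in\mathbb N^r$) such that $$w\bigl((\overline{b_j^*\alpha})_j,(b_j^*\beta)_j\bigr)=H(p_n\alpha^*,p_n\beta)\qquad(\alpha,\beta\in\mathcal H)$$ and $\hat H_n$ acts as the polynomial partial differential operator $D=\sum_{I,J}w_{IJ}\prod_j(x_j-\partial_j)^{I_j}\prod_j\partial_j^{J_j}$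 on $\mathbb R^r$: (a) if $f(x)=e^{|x|^2/4}g(x)$ with $g$ in the Schwartz space $\mathcal S(\mathbb R^r)$, then $f\circ\pi\in D(\hat H_n)$ and $\hat H_n(f\circ\pi)=(Df)\circ\pi$; (b) on the whole of its domain, $\hat H_n$ acts as $D$ in the sense of distributions: for $u\in D(\hat H_n)$ and $\varphi\in C_c^\infty(\mathbb R^r)$, $\int\overline{(D\varphi)(\pi(\xi))}\,u(\xi)\,d\gamma(\xi)=\int\overline{\varphi(\pi(\xi))}\,(\hat H_nu)(\xi)\,d\gamma(\xi)$. -/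

import Mathlib

open MeasureTheory ProbabilityTheory Filter Topology
open scoped InnerProductSpace ComplexConjugate ContDiff

/-! ### The Friedrichs extension of a semibounded operator -/

section Friedrichs

variable {E : Type*} [NormedAddCommGroup E] [InnerProductSpace ℂ E]

/-- The operator `T` is bounded from below (semibounded): `⟪x, T x⟫ ≥ c ‖x‖²` on its domain. -/
def IsLowerBounded (T : E →ₗ.[ℂ] E) : Prop :=
  ∃ c : ℝ, ∀ x : T.domain, c * ‖(x : E)‖ ^ 2 ≤ (⟪(x : E), T x⟫_ℂ).re

/-- The form domain of a semibounded operator: limits in `E` of sequences in the domain of `T` that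
are Cauchy for the quadratic form `x ↦ ⟪x, T x⟫`. -/
def formDomain (T : E →ₗ.[ℂ] E) (hT : IsLowerBounded T) : Submodule ℂ E where
  carrier := {u | ∃ x : ℕ → T.domain, Tendsto (fun n => (x n : E)) atTop (𝓝 u) ∧
    Tendsto (fun q : ℕ × ℕ => (⟪((x q.1 - x q.2 : T.domain) : E), T (x q.1 - x q.2)⟫_ℂ).re)
      atTop (𝓝 0)}
  zero_mem' := ⟨fun _ => 0, by simp, by simp⟩
  add_mem' := by
    rintro u v ⟨x, hx, hqx⟩ ⟨y, hy, hqy⟩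
    refine ⟨fun n => x n + y n, by simpa using hx.add hy, ?_⟩
    obtain ⟨c, hc⟩ := hT
    have key : ∀ {w : E} {z : ℕ → T.domain}, Tendsto (fun n => (z n : E)) atTop (𝓝 w) →
        Tendsto (fun q : ℕ × ℕ => ((z q.1 - z q.2 : T.domain) : E)) atTop (𝓝 0) := by
      intro w z hz
      rw [← prod_atTop_atTop_eq]
      simpa using (hz.comp tendsto_fst).sub (hz.comp tendsto_snd)
    have hs : Tendsto (fun q : ℕ × ℕ =>
        c * ‖((x q.1 - x q.2 : T.domain) : E) + ((y q.1 - y q.2 : T.domain) : E)‖ ^ 2)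
        atTop (𝓝 0) := by
      simpa using ((((key hx).add (key hy)).norm).pow 2).const_mul c
    have hd : Tendsto (fun q : ℕ × ℕ =>
        c * ‖((x q.1 - x q.2 : T.domain) : E) - ((y q.1 - y q.2 : T.domain) : E)‖ ^ 2)
        atTop (𝓝 0) := by
      simpa using ((((key hx).sub (key hy)).norm).pow 2).const_mul c
    have hu := ((hqx.const_mul 2).add (hqy.const_mul 2)).sub hd
    simp only [mul_zero, add_zero, sub_zero] at hu
    refine tendsto_of_tendsto_of_tendsto_of_le_of_le hs hu ?_ ?_
    · intro q
      have := hc ((x q.1 - x q.2) + (y q.1 - y q.2))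
      have e : x q.1 + y q.1 - (x q.2 + y q.2) = (x q.1 - x q.2) + (y q.1 - y q.2) := by abel
      simp only [e]
      simpa using this
    · intro q
      have h := hc ((x q.1 - x q.2) - (y q.1 - y q.2))
      have e : x q.1 + y q.1 - (x q.2 + y q.2) = (x q.1 - x q.2) + (y q.1 - y q.2) := by abel
      simp only [e]
      generalize x q.1 - x q.2 = a at *
      generalize y q.1 - y q.2 = b at *
      have h1 : T (a + b) = T a + T b := T.map_add a b
      have h2 : T (a - b) = T a - T b := T.map_sub a b
      rw [h2] at h
      rw [h1]
      simp only [Submodule.coe_add, Submodule.coe_sub, inner_add_left, inner_add_right,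
        inner_sub_left, inner_sub_right, Complex.add_re, Complex.sub_re] at h ⊢
      linarith
  smul_mem' := by
    rintro a u ⟨x, hx, hqx⟩
    refine ⟨fun n => a • x n, by simpa using hx.const_smul a, ?_⟩
    have := hqx.const_mul (‖a‖ ^ 2)
    rw [mul_zero] at this
    refine this.congr fun q => ?_
    have h : T (a • (x q.1 - x q.2)) = a • T (x q.1 - x q.2) := T.map_smul a _
    rw [← smul_sub, h, Submodule.coe_smul, inner_smul_left, inner_smul_right, ← mul_assoc,
      ← Complex.normSq_eq_conj_mul_self, Complex.re_ofReal_mul, Complex.normSq_eq_norm_sq]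

/-- The Friedrichs extension of a densely defined symmetric semibounded operator: the restriction
of the adjoint to the form domain. -/
noncomputable def friedrichs [CompleteSpace E] (T : E →ₗ.[ℂ] E) (hT : IsLowerBounded T) :
    E →ₗ.[ℂ] E :=
  (LinearPMap.adjoint T).domRestrict (formDomain T hT)

/-- The operator `P T P`, defined on all `x` with `P x` in the domain of `T`. -/
noncomputable def compress (P : E →L[ℂ] E) (T : E →ₗ.[ℂ] E) : E →ₗ.[ℂ] E where
  domain := T.domain.comap P.toLinearMap
  toFun := P.toLinearMap ∘ₗ T.toFun ∘ₗ
    (P.toLinearMap.restrict (p := T.domain.comap P.toLinearMap) (q := T.domain) fun _ h => h)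

end Friedrichs

/-! ### The Gauss space and polynomial functionals -/

section Gauss

/-- The standard Gauss measure on `ℝ^ι`: the coordinates are independent standard normal. -/
noncomputable def gaussMeasure (ι : Type*) : Measure (ι → ℝ) :=
  Measure.infinitePi fun _ => gaussianReal 0 1

instance (ι : Type*) : IsProbabilityMeasure (gaussMeasure ι) := by
  unfold gaussMeasure; infer_instance

/-- The Gauss Fock space. -/
noncomputable abbrev GaussSpace (ι : Type*) := Lp ℂ 2 (gaussMeasure ι)

variable {ι : Type*}

/-- A polynomial in the coordinates, as a functional on `ℝ^ι`. -/
noncomputable def polyFun (Q : MvPolynomial ι ℂ) (ξ : ι → ℝ) : ℂ :=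
  MvPolynomial.eval (fun i => (ξ i : ℂ)) Q

theorem polyFun_memLp (Q : MvPolynomial ι ℂ) :
    ∀ p : NNReal, MemLp (polyFun Q) p (gaussMeasure ι) := by
  induction Q using MvPolynomial.induction_on with
  | C a =>
    intro p
    have h : polyFun (MvPolynomial.C a : MvPolynomial ι ℂ) = fun _ => a := by
      ext ξ; simp [polyFun]
    rw [h]
    exact memLp_const a
  | add f g hf hg =>
    intro p
    have h : polyFun (f + g) = polyFun f + polyFun g := by
      ext ξ; simp [polyFun]
    rw [h]
    exact (hf p).add (hg p)
  | mul_X f i hf =>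
    intro p
    have hX : MemLp (fun ξ : ι → ℝ => (ξ i : ℂ)) (2 * p : NNReal) (gaussMeasure ι) :=
      ((memLp_id_gaussianReal (μ := 0) (v := 1) (2 * p)).comp_measurePreserving
        (measurePreserving_eval_infinitePi (fun _ : ι => gaussianReal 0 1) i)).ofReal
    have : ENNReal.HolderTriple ((2 * p : NNReal) : ENNReal) ((2 * p : NNReal) : ENNReal) p := by
      constructor
      rw [← two_mul, ENNReal.coe_mul, ENNReal.mul_inv (by simp) (by simp), ← mul_assoc]
      simp [ENNReal.mul_inv_cancel]
    have h : polyFun (f * MvPolynomial.X i) = polyFun f * fun ξ : ι → ℝ => (ξ i : ℂ) := by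
      ext ξ; simp [polyFun]
    rw [h]
    exact MemLp.mul (r := (p : ENNReal)) hX (hf (2 * p))

/-- A polynomial functional as an element of the Gauss space. -/
noncomputable def polyVec (Q : MvPolynomial ι ℂ) : GaussSpace ι :=
  (show MemLp (polyFun Q) 2 (gaussMeasure ι) from polyFun_memLp Q 2).toLp

/-- The annihilator of the `i`-th mode on polynomials: the directional derivative `∂_i`. -/
noncomputable def annih (i : ι) : Module.End ℂ (MvPolynomial ι ℂ) :=
  (MvPolynomial.pderiv i).toLinearMap

/-- The creator of the `i`-th mode on polynomials: `ξ_i - ∂_i`. -/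
noncomputable def create (i : ι) : Module.End ℂ (MvPolynomial ι ℂ) :=
  LinearMap.mulLeft ℂ (MvPolynomial.X i) - annih i

/-- The product Hermite polynomials `∏ i, He_{n i}(ξ_i)`; they form an orthogonal system with
squared norms `∏ i, (n i)!`. -/
noncomputable def hermiteVec (n : ι →₀ ℕ) : GaussSpace ι :=
  polyVec (n.prod fun i k =>
    Polynomial.aeval (MvPolynomial.X i : MvPolynomial ι ℂ) (Polynomial.hermite k))

end Gauss

/-! ### Sobolev scales, Fock scale, cutoff operators -/

/-- A complex Hilbert space with a conjugation, and a real self-adjoint nonnegative operator `o` with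
discrete spectrum such that `(1 + o)^(-p)` has finite trace for some `p > 0`. The operator is given
in diagonal form, by a real orthonormal basis `e` of eigenvectors with eigenvalues `ev`. -/
structure SobolevScale (ι H : Type*) [NormedAddCommGroup H] [InnerProductSpace ℂ H] where
  conjugation : H ≃ₗᵢ⋆[ℂ] H
  conjugation_conjugation : ∀ φ, conjugation (conjugation φ) = φ
  e : HilbertBasis ι ℂ H
  conjugation_e : ∀ i, conjugation (e i) = e i
  ev : ι → ℝ
  ev_nonneg : ∀ i, 0 ≤ ev i
  finite_trace : ∃ p : ℝ, 0 < p ∧ Summable fun i => (1 + ev i) ^ (-p)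

/-- The terms of a symbol: `k` creator indices and `l` annihilator indices, for all `k`, `l`. -/
abbrev WickIndex (ι : Type*) := Σ kl : ℕ × ℕ, (Fin kl.1 → ι) × (Fin kl.2 → ι)

section Fock

variable {ι H : Type*} [NormedAddCommGroup H] [InnerProductSpace ℂ H]

namespace SobolevScale

/-- The space `H^∞`, the intersection of the domains of all powers of `1 + o`. -/
def smooth (S : SobolevScale ι H) : Set H :=
  {φ | ∀ s : ℕ, Summable fun i => (1 + S.ev i) ^ s * ‖⟪S.e i, φ⟫_ℂ‖ ^ 2}

/-- The coherent functional `F_α = ∑ₘ (1/m!) F⁺(α)^m F₀`, in its Hermite expansion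
`∑ₙ ∏ᵢ (α_i^{n_i} / n_i!) He_{n_i}(ξ_i)`. -/
noncomputable def coherent (S : SobolevScale ι H) (α : H) : GaussSpace ι :=
  ∑' n : ι →₀ ℕ, (n.prod fun i k => ⟪S.e i, α⟫_ℂ ^ k / (k.factorial : ℂ)) • hermiteVec n

/-- The eigenvalue of the tangential quantization `dΓ(1 + o)` on the Hermite polynomial of
multi-index `n`. -/
noncomputable def weight (S : SobolevScale ι H) (n : ι →₀ ℕ) : ℝ :=
  n.sum fun i k => (k : ℝ) * (1 + S.ev i)

/-- The space `𝒢^∞` of the tangential Fock scale: the intersection of the domains of all powers of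
the self-adjoint operator `dΓ(1 + o)`. -/
noncomputable def smoothFock (S : SobolevScale ι H) : Submodule ℂ (GaussSpace ι) where
  carrier := {F | ∀ s : ℕ, Summable fun n : ι →₀ ℕ =>
    S.weight n ^ (2 * s) * (‖⟪hermiteVec n, F⟫_ℂ‖ ^ 2 / n.prod fun _ k => (k.factorial : ℝ))}
  zero_mem' := fun s => by simp
  add_mem' := by
    intro F G hF hG s
    refine Summable.of_nonneg_of_le (fun n => ?_) (fun n => ?_)
      (((hF s).mul_left 2).add ((hG s).mul_left 2))
    · have : 0 ≤ n.prod fun _ k => (k.factorial : ℝ) := Finset.prod_nonneg fun _ _ => by positivity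
      rw [pow_mul]; positivity
    · have : 0 ≤ n.prod fun _ k => (k.factorial : ℝ) := Finset.prod_nonneg fun _ _ => by positivity
      have hw : 0 ≤ S.weight n ^ (2 * s) := by rw [pow_mul]; positivity
      have h := norm_add_le (⟪hermiteVec n, F⟫_ℂ) (⟪hermiteVec n, G⟫_ℂ)
      have h2 : ‖⟪hermiteVec n, F + G⟫_ℂ‖ ^ 2 ≤
          2 * ‖⟪hermiteVec n, F⟫_ℂ‖ ^ 2 + 2 * ‖⟪hermiteVec n, G⟫_ℂ‖ ^ 2 := by
        rw [inner_add_right]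
        nlinarith [norm_nonneg (⟪hermiteVec n, F⟫_ℂ + ⟪hermiteVec n, G⟫_ℂ),
          sq_nonneg (‖⟪hermiteVec n, F⟫_ℂ‖ - ‖⟪hermiteVec n, G⟫_ℂ‖)]
      calc _ ≤ S.weight n ^ (2 * s) * ((2 * ‖⟪hermiteVec n, F⟫_ℂ‖ ^ 2
              + 2 * ‖⟪hermiteVec n, G⟫_ℂ‖ ^ 2) / n.prod fun _ k => (k.factorial : ℝ)) := by
            gcongr
        _ = _ := by ring
  smul_mem' := by
    intro a F hF s
    refine ((hF s).mul_left (‖a‖ ^ 2)).congr fun n => ?_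
    rw [inner_smul_right, norm_mul]; ring

/-- The quantized projector `Γ(p)` for the orthogonal projector `p` onto `K`: the orthogonal
projector of the Gauss space onto the closed span of the coherent functionals `F_α`, `α ∈ K`. -/
noncomputable def quantizedProj (S : SobolevScale ι H) (K : Submodule ℂ H) :
    GaussSpace ι →L[ℂ] GaussSpace ι :=
  (Submodule.span ℂ (S.coherent '' (K : Set H))).topologicalClosure.starProjection

/-- The coordinates `ξ(b_1), …, ξ(b_r)` of a point `ξ` of the Gauss space along the vectors `b_j`
of the real part of `H^∞` (the series converge absolutely for almost every `ξ`). -/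
noncomputable def coords (S : SobolevScale ι H) {r : ℕ} (b : Fin r → H) (ξ : ι → ℝ) :
    Fin r → ℝ :=
  fun j => ∑' i, (⟪S.e i, b j⟫_ℂ).re * ξ i

/-- `b` is an orthonormal basis of `K` consisting of real vectors. -/
def IsRealBasis (S : SobolevScale ι H) (K : Submodule ℂ H) {r : ℕ} (b : Fin r → H) : Prop :=
  Orthonormal ℂ b ∧ Submodule.span ℂ (Set.range b) = K ∧ ∀ j, S.conjugation (b j) = b j

end SobolevScale

/-- A cutoff Wick symbol of finite order: kernels `W_{k,l}` in `(H^∞)^{⊗(k+l)}`, i.e. with rapidly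
decreasing coefficients in the product eigenbasis. -/
structure CutoffSymbol (S : SobolevScale ι H) where
  order : ℕ
  coeff : WickIndex ι → ℂ
  coeff_eq_zero : ∀ t : WickIndex ι, order < t.1.1 + t.1.2 → coeff t = 0
  decay : ∀ (kl : ℕ × ℕ) (s : ℕ), ∃ C : ℝ, ∀ (i : Fin kl.1 → ι) (j : Fin kl.2 → ι),
    ‖coeff ⟨kl, i, j⟩‖ * ((∏ a, (1 + S.ev (i a))) * ∏ c, (1 + S.ev (j c))) ^ s ≤ C

namespace CutoffSymbol

variable {S : SobolevScale ι H}

/-- The value `W(α*, β)` of the Wick symbol. -/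
noncomputable def eval (W : CutoffSymbol S) (α β : H) : ℂ :=
  ∑' t : WickIndex ι, W.coeff t * ((∏ a, conj ⟪S.e (t.2.1 a), α⟫_ℂ) * ∏ c, ⟪S.e (t.2.2 c), β⟫_ℂ)

/-- `W` is a Hamiltonian functional: the restricted symbol `W(α*, α)` is real-valued on `H^∞`. -/
def IsHamiltonian (W : CutoffSymbol S) : Prop :=
  ∀ α ∈ S.smooth, (W.eval α α).im = 0

/-- The graph of the cutoff operator `∑ W_{k,l} (F⁺)^k (F⁻)^l` on `𝒢^∞`: its value at `F` is the `G`
with `⟪Q, G⟫ = ∑ W_{k,l}(i, j) ⟪F⁻_i Q, F⁻_j F⟫ = ∑ W_{k,l}(i, j) ⟪F⁺_j F⁻_i Q, F⟫` for all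
polynomials `Q`. -/
noncomputable def graph (W : CutoffSymbol S) : Submodule ℂ (GaussSpace ι × GaussSpace ι) where
  carrier := {x | x.1 ∈ S.smoothFock ∧ ∀ Q : MvPolynomial ι ℂ,
    HasSum (fun t : WickIndex ι => W.coeff t * ⟪polyVec
      ((List.ofFn fun c => create (t.2.2 c)).prod ((List.ofFn fun a => annih (t.2.1 a)).prod Q)),
      x.1⟫_ℂ) ⟪polyVec Q, x.2⟫_ℂ}
  zero_mem' := ⟨zero_mem _, fun Q => by simp⟩
  add_mem' := by
    rintro x y ⟨hx, hx'⟩ ⟨hy, hy'⟩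
    refine ⟨add_mem hx hy, fun Q => ?_⟩
    simpa [inner_add_right, mul_add] using (hx' Q).add (hy' Q)
  smul_mem' := by
    rintro a x ⟨hx, hx'⟩
    refine ⟨Submodule.smul_mem _ a hx, fun Q => ?_⟩
    simpa [inner_smul_right, mul_left_comm] using (hx' Q).mul_left a

/-- The cutoff operator with Wick symbol `W`, as an unbounded operator in the Gauss space with
domain `𝒢^∞`. -/
noncomputable def operator (W : CutoffSymbol S) : GaussSpace ι →ₗ.[ℂ] GaussSpace ι :=
  W.graph.toLinearPMap

end CutoffSymbol

/-- A flag of finite dimensional orthogonal projectors `p_n` in `H^∞` that commute with the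
conjugation, given by their ranges. -/
structure ProjectorFlag (S : SobolevScale ι H) where
  space : ℕ → Submodule ℂ H
  finite : ∀ n, FiniteDimensional ℂ (space n)
  real : ∀ n, ∀ φ ∈ space n, S.conjugation φ ∈ space n
  smooth : ∀ n, ∀ φ ∈ space n, φ ∈ S.smooth
  mono : Monotone space
  dense : Dense (⋃ n, (space n : Set H))

/-- The orthogonal projector `p_n` of a flag. -/
noncomputable def ProjectorFlag.proj {S : SobolevScale ι H} (p : ProjectorFlag S) (n : ℕ) :
    H →L[ℂ] H :=
  haveI := p.finite n
  (p.space n).starProjection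

/-- The operator `P_n Ĥ P_n`, where `P_n = Γ(p_n)`. -/
noncomputable def CutoffSymbol.compressed {S : SobolevScale ι H} (W : CutoffSymbol S)
    (p : ProjectorFlag S) (n : ℕ) : GaussSpace ι →ₗ.[ℂ] GaussSpace ι :=
  compress (S.quantizedProj (p.space n)) W.operator

/-- The reduced operator `Ĥ_n`: the Friedrichs extension of `P_n Ĥ P_n`. -/
noncomputable def CutoffSymbol.reduced {S : SobolevScale ι H} (W : CutoffSymbol S)
    (p : ProjectorFlag S) (n : ℕ) (hb : IsLowerBounded (W.compressed p n)) :
    GaussSpace ι →ₗ.[ℂ] GaussSpace ι :=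
  friedrichs (W.compressed p n) hb

end Fock

/-! ### Polynomial partial differential operators in normal form -/

section PDO

variable {r : ℕ}

/-- The partial derivative `∂_j`. -/
noncomputable def partialD (j : Fin r) (f : (Fin r → ℝ) → ℂ) : (Fin r → ℝ) → ℂ :=
  fun x => fderiv ℝ f x (Pi.single j 1)

/-- The adjoint of `∂_j` with respect to the Gauss measure: `x_j - ∂_j`. -/
noncomputable def partialDAdj (j : Fin r) (f : (Fin r → ℝ) → ℂ) : (Fin r → ℝ) → ℂ :=
  fun x => (x j : ℂ) * f x - partialD j f x

/-- The normally ordered monomial `∏ⱼ (x_j - ∂_j)^{I_j} ∏ⱼ ∂_j^{J_j}`, where `I` and `J` are the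
left and the right half of the multi-index `m`. -/
noncomputable def normalMonomial (m : Fin r ⊕ Fin r →₀ ℕ) (f : (Fin r → ℝ) → ℂ) :
    (Fin r → ℝ) → ℂ :=
  (List.finRange r).foldr (fun j g => (partialDAdj j)^[m (Sum.inl j)] g)
    ((List.finRange r).foldr (fun j g => (partialD j)^[m (Sum.inr j)] g) f)

/-- The polynomial partial differential operator on `ℝ^r` with normal symbol `w(z̄, z)`: the left
variables are replaced by `x_j - ∂_j`, the right ones by `∂_j`, the former written first. -/
noncomputable def normalOp (w : MvPolynomial (Fin r ⊕ Fin r) ℂ) (f : (Fin r → ℝ) → ℂ) :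
    (Fin r → ℝ) → ℂ :=
  fun x => ∑ m ∈ w.support, w.coeff m * normalMonomial m f x

/-- The operator `T` in the Gauss space acts, in the coordinates `x = π(ξ)`, as the polynomial
partial differential operator with normal symbol `w`. -/
structure ActsAsNormalOp {ι : Type*} (T : GaussSpace ι →ₗ.[ℂ] GaussSpace ι)
    (π : (ι → ℝ) → (Fin r → ℝ)) (w : MvPolynomial (Fin r ⊕ Fin r) ℂ) : Prop where
  /-- On the functions `f(x) = exp(|x|²/4) g(x)` with `g` in the Schwartz space (they include the
  compactly supported smooth functions, the polynomials and the exponentials of linear functions),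
  the operator is defined and acts classically. -/
  classical : ∀ (g : SchwartzMap (Fin r → ℝ) ℂ) (f : (Fin r → ℝ) → ℂ),
    (∀ x, f x = Real.exp ((∑ j, x j ^ 2) / 4) * g x) →
    ∃ F : T.domain, ((F : GaussSpace ι) =ᵐ[gaussMeasure ι] fun ξ => f (π ξ)) ∧
      (T F =ᵐ[gaussMeasure ι] fun ξ => normalOp w f (π ξ))
  /-- On its whole domain, the operator acts in the sense of distributions. -/
  weak : ∀ (u : T.domain) (φ : (Fin r → ℝ) → ℂ), ContDiff ℝ ∞ φ → HasCompactSupport φ →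
    ∫ ξ, conj (normalOp w φ (π ξ)) * (u : GaussSpace ι) ξ ∂gaussMeasure ι =
      ∫ ξ, conj (φ (π ξ)) * T u ξ ∂gaussMeasure ι

end PDO

/-! ### Gaussian integration by parts on polynomials -/

section GaussianIntegration

variable {κ : Type*}

/-! Every vector of the Gauss space is read through its unnormalised Hermite coefficients `hcoef x
n`, with weights 1/n! in Parseval's identity. In these terms annihilators shift the multi-index,
creators shift it back with a falling factorial (`IsLadder`), and a coherent vector has the
coefficients zⁿ. The kernels of the symbol are absolutely summable, and ladder monomials of bounded
order have uniformly bounded norm on a fixed vector of 𝒢^∞ (`IsLadder.norm_sq_le`). Hence Ĥ is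
defined on all of 𝒢^∞ by a norm convergent series, and its matrix elements are kernel-weighted sums
of ladder forms.

The coefficients B of a real orthonormal basis b of p_nℋ are absolutely summable with orthonormal
rows, so π carries γ to the standard Gauss measure on ℝ^r and f ↦ f ∘ π is an isometry,
`IsRealFrame.pull`. The central tool is the chain rule ∂_i(f ∘ π) = ∑_c B_{ci} (∂_c f) ∘ π, in the
form `IsRealFrame.hcoef_pull_add_single`. It has three consequences. Coherent vectors over ℝ^r
become coherent functionals, so the range of P_n is the range of the isometry. Vectors on which all
iterated annihilators are defined are carried into 𝒢^∞, because the b_c are smooth. The matrix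
elements of Ĥ between pulled back vectors are those of the normally ordered operator whose
coefficients are the kernels contracted with B (`symbolPoly`). Values of the symbol and matrix
elements are the linear functional `pairing` of this one polynomial, for two choices of its argument
Φ. On the functions exp(|x|²/4) g, Gaussian integration by parts identifies ∂_j and x_j - ∂_j with
the ladder operators, so P_n Ĥ P_n acts there as D.

Symmetry comes from polarization: a polynomial in (z̄, z) is determined by its values at conjugate
arguments, so a real symbol and its formal adjoint have the same `symbolPoly`. Therefore Ĥ and its
formal adjoint have the same compression on regular functions of the coordinates, and such functions
satisfy the symmetry relation against the whole domain of P_n Ĥ P_n. This puts them into the domain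
of the Friedrichs extension, with the same value. Since the Friedrichs extension is a restriction of
the adjoint, its distributional form is the adjoint relation tested on φ ∘ π, and its reduction by
P_n follows because P_n Ĥ P_n vanishes on the kernel of P_n. -/

theorem integrable_pow_gaussianReal (k : ℕ) :
    Integrable (fun x : ℝ => x ^ k) (gaussianReal 0 1) := by
  have h : MemLp (fun x : ℝ => x) k (gaussianReal 0 1) := by
    have := memLp_id_gaussianReal (μ := 0) (v := 1) (k : NNReal)
    rwa [ENNReal.coe_natCast] at this
  refine (h.integrable_norm_pow' ).mono' (by fun_prop) (Eventually.of_forall fun x => ?_)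
  simp

/-- The moment recursion of the standard normal distribution. -/
theorem integral_pow_succ_gaussianReal (k : ℕ) :
    ∫ x : ℝ, x ^ (k + 1) ∂gaussianReal 0 1 = k * ∫ x : ℝ, x ^ (k - 1) ∂gaussianReal 0 1 := by
  have hint : ∀ m : ℕ, Integrable fun x : ℝ => gaussianPDFReal 0 1 x * x ^ m := by
    intro m
    have := integrable_pow_gaussianReal m
    rw [gaussianReal_of_var_ne_zero _ one_ne_zero,
      integrable_withDensity_iff_integrable_smul' (by fun_prop) (by simp [gaussianPDF])] at this
    simpa [gaussianPDF, ENNReal.toReal_ofReal, gaussianPDFReal_nonneg] using this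
  have hder : ∀ x : ℝ, HasDerivAt (gaussianPDFReal 0 1) (-(x * gaussianPDFReal 0 1 x)) x := by
    intro x
    have h1 : HasDerivAt (fun x : ℝ => -(x - 0) ^ 2 / (2 * ((1 : NNReal) : ℝ))) (-x) x := by
      have := ((((hasDerivAt_id x).sub_const 0).pow 2).neg).div_const (2 * ((1 : NNReal) : ℝ))
      refine this.congr_deriv ?_
      simp
      ring
    have := (h1.exp).const_mul ((√(2 * Real.pi * ((1 : NNReal) : ℝ)))⁻¹)
    refine this.congr_deriv ?_
    simp [gaussianPDFReal]; ring
  -- The density ρ satisfies ρ' = -xρ, and the integral of (ρ x^k)' is zero. For k = 0 the truncated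
  -- exponent k - 1 is harmless, since its coefficient is 0.
  have hd : ∀ x : ℝ, HasDerivAt (fun x => gaussianPDFReal 0 1 x * x ^ k)
      (k * (gaussianPDFReal 0 1 x * x ^ (k - 1)) - gaussianPDFReal 0 1 x * x ^ (k + 1)) x := by
    intro x
    refine ((hder x).mul (hasDerivAt_pow k x)).congr_deriv ?_
    ring
  have h0 := integral_eq_zero_of_hasDerivAt_of_integrable hd
    (((hint (k - 1)).const_mul _).sub (hint (k + 1))) (hint k)
  rw [integral_sub ((hint (k - 1)).const_mul _) (hint (k + 1)), integral_const_mul] at h0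
  rw [integral_gaussianReal_eq_integral_smul one_ne_zero,
    integral_gaussianReal_eq_integral_smul one_ne_zero]
  simp only [smul_eq_mul]
  linarith

/-- The expectation of a polynomial functional. -/
noncomputable def gaussExp (Q : MvPolynomial κ ℂ) : ℂ := ∫ ξ, polyFun Q ξ ∂gaussMeasure κ

theorem integrable_polyFun (Q : MvPolynomial κ ℂ) : Integrable (polyFun Q) (gaussMeasure κ) :=
  memLp_one_iff_integrable.1 (by simpa using polyFun_memLp Q 1)

theorem polyFun_add (Q R : MvPolynomial κ ℂ) (ξ : κ → ℝ) :
    polyFun (Q + R) ξ = polyFun Q ξ + polyFun R ξ := by simp [polyFun]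

theorem polyFun_mul (Q R : MvPolynomial κ ℂ) (ξ : κ → ℝ) :
    polyFun (Q * R) ξ = polyFun Q ξ * polyFun R ξ := by simp [polyFun]

theorem polyFun_smul (a : ℂ) (Q : MvPolynomial κ ℂ) (ξ : κ → ℝ) :
    polyFun (a • Q) ξ = a * polyFun Q ξ := by simp [polyFun, MvPolynomial.smul_eval]

theorem polyFun_X (i : κ) (ξ : κ → ℝ) : polyFun (MvPolynomial.X i) ξ = ξ i := by simp [polyFun]

theorem polyFun_star (Q : MvPolynomial κ ℂ) (ξ : κ → ℝ) :
    polyFun (MvPolynomial.map (starRingEnd ℂ) Q) ξ = conj (polyFun Q ξ) := by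
  unfold polyFun
  induction Q using MvPolynomial.induction_on with
  | C a => simp
  | add f g hf hg => simp [hf, hg]
  | mul_X f i hf => simp [hf]

theorem gaussExp_add (Q R : MvPolynomial κ ℂ) : gaussExp (Q + R) = gaussExp Q + gaussExp R := by
  simp only [gaussExp, polyFun_add]
  exact integral_add (integrable_polyFun Q) (integrable_polyFun R)

theorem gaussExp_smul (a : ℂ) (Q : MvPolynomial κ ℂ) : gaussExp (a • Q) = a * gaussExp Q := by
  simp only [gaussExp, polyFun_smul]
  exact integral_const_mul _ _

/-- Independence of the coordinates. The index set may exceed the support, so that two monomials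
with different supports can be compared factor by factor; the extra factors are total masses 1. -/
theorem gaussExp_monomial (s : κ →₀ ℕ) (S : Finset κ) (hS : s.support ⊆ S) :
    gaussExp (MvPolynomial.monomial s 1 : MvPolynomial κ ℂ) =
      ∏ i ∈ S, ((∫ x : ℝ, x ^ s i ∂gaussianReal 0 1 : ℝ) : ℂ) := by
  have h1 : ∀ ξ : κ → ℝ, polyFun (MvPolynomial.monomial s 1 : MvPolynomial κ ℂ) ξ =
      ∏ i : S, ((ξ i ^ s i : ℝ) : ℂ) := by
    intro ξ
    simp only [polyFun, MvPolynomial.eval_monomial, one_mul]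
    rw [Finsupp.prod_of_support_subset s hS _ (by simp), ← Finset.prod_coe_sort]
    simp
  simp only [gaussExp, h1]
  have hind : iIndepFun (fun (i : S) (ξ : κ → ℝ) => ((ξ i ^ s i : ℝ) : ℂ)) (gaussMeasure κ) := by
    have := iIndepFun_infinitePi (P := fun _ : κ => gaussianReal 0 1)
      (X := fun i (x : ℝ) => ((x ^ s i : ℝ) : ℂ)) (fun i => by fun_prop)
    exact this.precomp Subtype.val_injective
  rw [hind.integral_fun_prod_eq_prod_integral (fun i => by
      have : Measurable fun ξ : κ → ℝ => ((ξ i ^ s i : ℝ) : ℂ) :=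
        Complex.measurable_ofReal.comp (by fun_prop)
      exact this.aestronglyMeasurable),
    ← Finset.prod_coe_sort S fun i => ((∫ x : ℝ, x ^ s i ∂gaussianReal 0 1 : ℝ) : ℂ)]
  refine Finset.prod_congr rfl fun i _ => ?_
  have hm : MeasurePreserving (fun ξ : κ → ℝ => ξ i) (gaussMeasure κ) (gaussianReal 0 1) :=
    measurePreserving_eval_infinitePi (fun _ : κ => gaussianReal 0 1) i
  rw [← integral_complex_ofReal, ← hm.map_eq, integral_map hm.measurable.aemeasurable]
  fun_prop

/-- Gaussian integration by parts for polynomials. -/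
theorem gaussExp_X_mul (i : κ) (Q : MvPolynomial κ ℂ) :
    gaussExp (MvPolynomial.X i * Q) = gaussExp (MvPolynomial.pderiv i Q) := by
  classical
  induction Q using MvPolynomial.induction_on' with
  | add p q hp hq => rw [mul_add, map_add, gaussExp_add, gaussExp_add, hp, hq]
  | monomial s a =>
    have e1 : (MvPolynomial.X i * MvPolynomial.monomial s a : MvPolynomial κ ℂ) =
        a • MvPolynomial.monomial (s + Finsupp.single i 1) 1 := by
      rw [MvPolynomial.X, MvPolynomial.monomial_mul, MvPolynomial.smul_monomial, add_comm]
      simp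
    have e2 : MvPolynomial.pderiv i (MvPolynomial.monomial s a : MvPolynomial κ ℂ) =
        (a * s i) • MvPolynomial.monomial (s - Finsupp.single i 1) 1 := by
      rw [MvPolynomial.pderiv_monomial, MvPolynomial.smul_monomial]
      simp
    rw [e1, e2, gaussExp_smul, gaussExp_smul, mul_assoc]
    congr 1
    -- Both monomials are expanded over the same index set with the factor at `i` split off. That
    -- factor obeys the one-dimensional moment recursion, and the others agree.
    rw [gaussExp_monomial _ (insert i s.support) ?_, gaussExp_monomial _ (insert i s.support) ?_,
      ← Finset.mul_prod_erase _ _ (Finset.mem_insert_self i _),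
      ← Finset.mul_prod_erase _ _ (Finset.mem_insert_self i _), ← mul_assoc]
    · have h := integral_pow_succ_gaussianReal (s i)
      simp only [Finsupp.add_apply, Finsupp.tsub_apply, Finsupp.single_eq_same]
      rw [h]
      push_cast
      congr 1
      refine Finset.prod_congr rfl fun j hj => ?_
      have : j ≠ i := Finset.ne_of_mem_erase hj
      simp [Finsupp.single_eq_of_ne this]
    · intro j hj
      have := Finsupp.support_tsub hj
      simp_all
    · intro j hj
      have := Finsupp.support_add hj
      simp only [Finset.mem_union, Finset.mem_insert] at this ⊢
      rcases this with h | h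
      · exact Or.inr h
      · exact Or.inl (by simpa using Finsupp.support_single_subset h)

theorem coeFn_polyVec (Q : MvPolynomial κ ℂ) : polyVec Q =ᵐ[gaussMeasure κ] polyFun Q :=
  MemLp.coeFn_toLp _

theorem inner_polyVec (Q : MvPolynomial κ ℂ) (x : GaussSpace κ) :
    ⟪polyVec Q, x⟫_ℂ = ∫ ξ, conj (polyFun Q ξ) * x ξ ∂gaussMeasure κ := by
  rw [L2.inner_def]
  refine integral_congr_ae ?_
  filter_upwards [coeFn_polyVec Q] with ξ h
  rw [h, RCLike.inner_apply, mul_comm]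

theorem inner_polyVec_polyVec (Q R : MvPolynomial κ ℂ) :
    ⟪polyVec Q, polyVec R⟫_ℂ = gaussExp (MvPolynomial.map (starRingEnd ℂ) Q * R) := by
  rw [inner_polyVec]
  refine integral_congr_ae ?_
  filter_upwards [coeFn_polyVec R] with ξ h
  rw [h, polyFun_mul, polyFun_star]

/-- Polynomial functionals, as a linear map into the Gauss space. -/
noncomputable def polyVecₗ (κ : Type*) : MvPolynomial κ ℂ →ₗ[ℂ] GaussSpace κ where
  toFun := polyVec
  map_add' Q R := by
    refine Lp.ext ?_
    filter_upwards [coeFn_polyVec (Q + R), coeFn_polyVec Q, coeFn_polyVec R,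
      Lp.coeFn_add (polyVec Q) (polyVec R)] with ξ h1 h2 h3 h4
    rw [h1, h4, Pi.add_apply, h2, h3, polyFun_add]
  map_smul' a Q := by
    refine Lp.ext ?_
    filter_upwards [coeFn_polyVec (a • Q), coeFn_polyVec Q,
      Lp.coeFn_smul a (polyVec Q)] with ξ h1 h2 h4
    rw [h1, RingHom.id_apply, h4, Pi.smul_apply, h2, polyFun_smul, smul_eq_mul]

theorem polyVec_add (Q R : MvPolynomial κ ℂ) : polyVec (Q + R) = polyVec Q + polyVec R :=
  (polyVecₗ κ).map_add Q R

theorem polyVec_smul (a : ℂ) (Q : MvPolynomial κ ℂ) : polyVec (a • Q) = a • polyVec Q :=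
  (polyVecₗ κ).map_smul a Q

theorem annih_apply (i : κ) (Q : MvPolynomial κ ℂ) : annih i Q = MvPolynomial.pderiv i Q := rfl

theorem create_apply (i : κ) (Q : MvPolynomial κ ℂ) :
    create i Q = MvPolynomial.X i * Q - MvPolynomial.pderiv i Q := rfl

theorem pderiv_map_star (i : κ) (Q : MvPolynomial κ ℂ) :
    MvPolynomial.pderiv i (MvPolynomial.map (starRingEnd ℂ) Q) =
      MvPolynomial.map (starRingEnd ℂ) (MvPolynomial.pderiv i Q) := by
  classical
  induction Q using MvPolynomial.induction_on with
  | C a => simp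
  | add f g hf hg => simp [hf, hg]
  | mul_X f j hf =>
    simp only [map_mul, MvPolynomial.map_X, Derivation.leibniz, hf, map_add, smul_eq_mul,
      MvPolynomial.pderiv_X]
    by_cases h : i = j
    · subst h; simp
    · simp [h]

/-- The creators are the adjoints of the annihilators. -/
theorem inner_create (i : κ) (Q R : MvPolynomial κ ℂ) :
    ⟪polyVec (create i Q), polyVec R⟫_ℂ = ⟪polyVec Q, polyVec (annih i R)⟫_ℂ := by
  rw [inner_polyVec_polyVec, inner_polyVec_polyVec, create_apply, annih_apply]
  set Q' := MvPolynomial.map (starRingEnd ℂ) Q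
  have h := gaussExp_X_mul i (Q' * R)
  rw [Derivation.leibniz, smul_eq_mul, smul_eq_mul, gaussExp_add] at h
  have e : MvPolynomial.map (starRingEnd ℂ) (MvPolynomial.X i * Q - MvPolynomial.pderiv i Q) * R =
      MvPolynomial.X i * (Q' * R) + (-1 : ℂ) • (R * MvPolynomial.pderiv i Q') := by
    rw [map_sub, map_mul, MvPolynomial.map_X, pderiv_map_star, neg_one_smul]; ring
  rw [e, gaussExp_add, gaussExp_smul, h]; ring

end GaussianIntegration

/-! ### Hermite polynomials: ladder relations, orthogonality, span -/

section Hermite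

variable {κ : Type*}

theorem derivative_hermite_succ (k : ℕ) :
    Polynomial.derivative (Polynomial.hermite (k + 1)) = ((k : ℤ) + 1) • Polynomial.hermite k := by
  induction k with
  | zero => simp
  | succ k ih =>
    rw [Polynomial.hermite_succ, Polynomial.derivative_sub, Polynomial.derivative_mul, ih]
    have h : Polynomial.derivative (((k : ℤ) + 1) • Polynomial.hermite k) =
        ((k : ℤ) + 1) • Polynomial.derivative (Polynomial.hermite k) := by simp
    rw [h, Polynomial.derivative_X, Polynomial.hermite_succ k]
    simp only [zsmul_eq_mul]
    push_cast
    ring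

/-- The product Hermite polynomial of multi-index `n`. -/
noncomputable def hermitePoly (n : κ →₀ ℕ) : MvPolynomial κ ℂ :=
  n.prod fun i k => Polynomial.aeval (MvPolynomial.X i : MvPolynomial κ ℂ) (Polynomial.hermite k)

theorem polyVec_hermitePoly (n : κ →₀ ℕ) : polyVec (hermitePoly n) = hermiteVec n := rfl

/-- The factorial of a multi-index. -/
noncomputable def mfac (n : κ →₀ ℕ) : ℝ := n.prod fun _ k => (k.factorial : ℝ)

theorem mfac_pos (n : κ →₀ ℕ) : 0 < mfac n :=
  Finset.prod_pos fun _ _ => by positivity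

theorem hermitePoly_zero : hermitePoly (0 : κ →₀ ℕ) = 1 := by simp [hermitePoly]

theorem mfac_zero : mfac (0 : κ →₀ ℕ) = 1 := by simp [mfac]

theorem pderiv_aeval_X_self (i : κ) (P : Polynomial ℤ) :
    MvPolynomial.pderiv i (Polynomial.aeval (MvPolynomial.X i : MvPolynomial κ ℂ) P) =
      Polynomial.aeval (MvPolynomial.X i) (Polynomial.derivative P) := by
  change ((MvPolynomial.pderiv i : Derivation ℂ (MvPolynomial κ ℂ) _).restrictScalars ℤ) _ = _
  rw [Derivation.map_aeval]
  simp

theorem pderiv_aeval_X_ne {i j : κ} (hij : j ≠ i) (P : Polynomial ℤ) :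
    MvPolynomial.pderiv i (Polynomial.aeval (MvPolynomial.X j : MvPolynomial κ ℂ) P) = 0 := by
  change ((MvPolynomial.pderiv i : Derivation ℂ (MvPolynomial κ ℂ) _).restrictScalars ℤ) _ = _
  rw [Derivation.map_aeval]
  simp [MvPolynomial.pderiv_X_of_ne hij]

theorem hermitePoly_split (i : κ) (n : κ →₀ ℕ) :
    hermitePoly n = Polynomial.aeval (MvPolynomial.X i : MvPolynomial κ ℂ)
      (Polynomial.hermite (n i)) * hermitePoly (n.erase i) := by
  exact (Finsupp.mul_prod_erase' n i (fun i k => Polynomial.aeval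
    (MvPolynomial.X i : MvPolynomial κ ℂ) (Polynomial.hermite k)) (by simp)).symm

theorem pderiv_hermitePoly_erase (i : κ) (n : κ →₀ ℕ) :
    MvPolynomial.pderiv i (hermitePoly (n.erase i)) = 0 := by
  classical
  rw [hermitePoly, Finsupp.prod]
  have : ∀ s : Finset κ, i ∉ s → MvPolynomial.pderiv i (∏ j ∈ s, Polynomial.aeval
      (MvPolynomial.X j : MvPolynomial κ ℂ) (Polynomial.hermite (n.erase i j))) = 0 := by
    intro s
    induction s using Finset.induction_on with
    | empty => simp
    | insert a s ha ih =>
      intro hi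
      rw [Finset.prod_insert ha, Derivation.leibniz, ih (fun h => hi (Finset.mem_insert_of_mem h)),
        pderiv_aeval_X_ne (fun h => hi (by simp [h]))]
      simp
  exact this _ (by simp)

/-- The recursion He_{k+1} = x He_k - He_k' in the variable ξ_i; the remaining factors do not
involve ξ_i. -/
theorem create_hermitePoly (i : κ) (n : κ →₀ ℕ) :
    create i (hermitePoly n) = hermitePoly (n + Finsupp.single i 1) := by
  rw [create_apply, hermitePoly_split i n, hermitePoly_split i (n + _), Derivation.leibniz,
    pderiv_hermitePoly_erase, pderiv_aeval_X_self]
  have e : (n + Finsupp.single i 1).erase i = n.erase i := by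
    rw [Finsupp.erase_add, Finsupp.erase_single, add_zero]
  rw [e]
  simp only [Finsupp.add_apply, Finsupp.single_eq_same, Polynomial.hermite_succ, map_sub, map_mul,
    Polynomial.aeval_X, smul_eq_mul]
  ring

/-- The relation He_{k+1}' = (k + 1) He_k in the variable ξ_i. If n_i = 0 the factor is zero, so the
truncated subtraction does no harm. -/
theorem annih_hermitePoly (i : κ) (n : κ →₀ ℕ) :
    annih i (hermitePoly n) = (n i : ℂ) • hermitePoly (n - Finsupp.single i 1) := by
  rw [annih_apply, hermitePoly_split i n, hermitePoly_split i (n - _), Derivation.leibniz,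
    pderiv_hermitePoly_erase, pderiv_aeval_X_self]
  have e : (n - Finsupp.single i 1).erase i = n.erase i := by
    ext j
    by_cases h : j = i
    · subst h; simp
    · simp [Finsupp.erase_ne h, Finsupp.single_eq_of_ne h]
  rw [e]
  simp only [Finsupp.tsub_apply, Finsupp.single_eq_same, smul_eq_mul, mul_zero, zero_add]
  rcases h : n i with _ | k
  · simp
  · rw [derivative_hermite_succ]
    simp only [Nat.add_sub_cancel, zsmul_eq_mul, MvPolynomial.smul_eq_C_mul]
    push_cast
    simp
    ring

theorem mfac_add_single (i : κ) (n : κ →₀ ℕ) :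
    mfac (n + Finsupp.single i 1) = (n i + 1) * mfac n := by
  have split : ∀ m : κ →₀ ℕ, mfac m = ((m i).factorial : ℝ) * mfac (m.erase i) := fun m =>
    (Finsupp.mul_prod_erase' m i (fun _ k => (k.factorial : ℝ)) (by simp)).symm
  have e : (n + Finsupp.single i 1).erase i = n.erase i := by
    rw [Finsupp.erase_add, Finsupp.erase_single, add_zero]
  rw [split, split n, e]
  simp [Nat.factorial_succ]
  ring

/-- Induction on a multi-index, adding one unit at a time. -/
theorem multiIndex_induction {p : (κ →₀ ℕ) → Prop} (n : κ →₀ ℕ) (h0 : p 0)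
    (hs : ∀ i n, p n → p (n + Finsupp.single i 1)) : p n := by
  induction n using Finsupp.induction_linear with
  | zero => exact h0
  | single i k =>
    induction k with
    | zero => simpa using h0
    | succ k ih => rw [Finsupp.single_add]; exact hs i _ ih
  | add f g hf hg =>
    -- The property is not additive, so the hypotheses on the two summands are useless; both
    -- multi-indices are rebuilt unit by unit.
    clear hf hg
    induction f using Finsupp.induction with
    | zero =>
      rw [zero_add]
      induction g using Finsupp.induction with
      | zero => exact h0
      | single_add i k g _ _ ih =>
        rw [add_comm]
        clear * - hs ih
        induction k with
        | zero => simpa using ih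
        | succ k ihk => rw [Finsupp.single_add, ← add_assoc]; exact hs i _ ihk
    | single_add i k f _ _ ih =>
      rw [add_assoc, add_comm]
      clear * - hs ih
      induction k with
      | zero => simpa using ih
      | succ k ihk => rw [Finsupp.single_add, ← add_assoc]; exact hs i _ ihk

theorem inner_hermiteVec_add_single (i : κ) (n : κ →₀ ℕ) (Q : MvPolynomial κ ℂ) :
    ⟪hermiteVec (n + Finsupp.single i 1), polyVec Q⟫_ℂ = ⟪hermiteVec n, polyVec (annih i Q)⟫_ℂ := by
  rw [← polyVec_hermitePoly, ← create_hermitePoly, inner_create, polyVec_hermitePoly]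

theorem inner_hermiteVec_zero_zero :
    ⟪hermiteVec (0 : κ →₀ ℕ), hermiteVec (0 : κ →₀ ℕ)⟫_ℂ = 1 := by
  rw [← polyVec_hermitePoly, inner_polyVec_polyVec, hermitePoly_zero]
  simp [gaussExp, polyFun]

-- Creators on the left become annihilators on the right, so the units of n are stripped one at a
-- time, each lowering m and contributing the factor m_i.
open Classical in
theorem inner_hermiteVec (n m : κ →₀ ℕ) :
    ⟪hermiteVec n, hermiteVec m⟫_ℂ = if n = m then (mfac n : ℂ) else 0 := by
  have step : ∀ (i : κ) (n m : κ →₀ ℕ), ⟪hermiteVec (n + Finsupp.single i 1), hermiteVec m⟫_ℂ =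
      (m i : ℂ) * ⟪hermiteVec n, hermiteVec (m - Finsupp.single i 1)⟫_ℂ := by
    intro i n m
    rw [← polyVec_hermitePoly m, inner_hermiteVec_add_single, annih_hermitePoly, polyVec_smul,
      inner_smul_right, polyVec_hermitePoly]
  induction n using multiIndex_induction generalizing m with
  | h0 =>
    by_cases hm : m = 0
    · subst hm; rw [inner_hermiteVec_zero_zero]; simp [mfac_zero]
    · rw [if_neg (Ne.symm hm)]
      -- With the two sides exchanged, a unit is stripped from m instead; the annihilator kills the
      -- constant He_0.
      obtain ⟨i, hi⟩ := Finsupp.ne_iff.1 hm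
      have e : m = (m - Finsupp.single i 1) + Finsupp.single i 1 := by
        refine (tsub_add_cancel_of_le ?_).symm
        simpa [Nat.one_le_iff_ne_zero] using hi
      rw [← inner_conj_symm, e, step]
      simp
  | hs i n ih =>
    rw [step, ih]
    by_cases h : n + Finsupp.single i 1 = m
    · subst h
      simp [mfac_add_single]
    · rw [if_neg h]
      -- If m_i = 0 the factor vanishes. Otherwise n = m - e_i would give n + e_i = m, which is
      -- excluded.
      rcases hk : m i with _ | k
      · simp
      · rw [if_neg, mul_zero]
        intro h2
        apply h
        rw [h2]
        refine tsub_add_cancel_of_le ?_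
        simp [hk]

/-- The Hermite polynomials span the polynomials. -/
theorem span_hermitePoly : Submodule.span ℂ (Set.range (hermitePoly (κ := κ))) = ⊤ := by
  have hX : ∀ (i : κ) (Q : MvPolynomial κ ℂ),
      Q ∈ Submodule.span ℂ (Set.range (hermitePoly (κ := κ))) →
      Q * MvPolynomial.X i ∈ Submodule.span ℂ (Set.range (hermitePoly (κ := κ))) := by
    intro i Q hQ
    induction hQ using Submodule.span_induction with
    | mem Q h =>
      obtain ⟨n, rfl⟩ := h
      -- The three-term recursion ξ_i He_n = He_{n+e_i} + n_i He_{n-e_i}: the span is stable under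
      -- multiplication by coordinates.
      have h1 := create_hermitePoly i n
      rw [create_apply, ← annih_apply, annih_hermitePoly, sub_eq_iff_eq_add] at h1
      rw [mul_comm, h1]
      exact add_mem (Submodule.subset_span ⟨_, rfl⟩)
        (Submodule.smul_mem _ _ (Submodule.subset_span ⟨_, rfl⟩))
    | zero => simp
    | add x y _ _ hx hy => rw [add_mul]; exact add_mem hx hy
    | smul a x _ hx => rw [smul_mul_assoc]; exact Submodule.smul_mem _ _ hx
  rw [eq_top_iff]
  intro Q _
  induction Q using MvPolynomial.induction_on with
  | C a =>
    rw [← mul_one (MvPolynomial.C a), ← MvPolynomial.smul_eq_C_mul, ← hermitePoly_zero]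
    exact Submodule.smul_mem _ _ (Submodule.subset_span ⟨_, rfl⟩)
  | add p q hp hq => exact add_mem (hp trivial) (hq trivial)
  | mul_X p i hp => exact hX i p (hp trivial)

/-- Two additive and homogeneous predicates on polynomials: it suffices to check Hermite
polynomials. -/
theorem hermitePoly_induction {p : MvPolynomial κ ℂ → Prop} (Q : MvPolynomial κ ℂ)
    (hh : ∀ n, p (hermitePoly n)) (hadd : ∀ Q R, p Q → p R → p (Q + R))
    (hsmul : ∀ (a : ℂ) Q, p Q → p (a • Q)) : p Q := by
  have hQ : Q ∈ Submodule.span ℂ (Set.range (hermitePoly (κ := κ))) := by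
    rw [span_hermitePoly]; trivial
  induction hQ using Submodule.span_induction with
  | mem Q h => obtain ⟨n, rfl⟩ := h; exact hh n
  | zero => simpa using hsmul 0 _ (hh 0)
  | add x y _ _ hx hy => exact hadd _ _ hx hy
  | smul a x _ hx => exact hsmul a _ hx

end Hermite

/-! ### Density of the polynomials and the Hermite basis -/

section HermiteBasis

variable {κ : Type*}

theorem hasSum_complex_exp (z : ℂ) : HasSum (fun k : ℕ => z ^ k / (k.factorial : ℂ)) (Complex.exp z) := by
  rw [Complex.exp_eq_exp_ℂ]
  exact NormedSpace.expSeries_div_hasSum_exp z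

theorem hasSum_real_exp (x : ℝ) : HasSum (fun k : ℕ => x ^ k / (k.factorial : ℝ)) (Real.exp x) := by
  rw [Real.exp_eq_exp_ℝ]
  exact NormedSpace.expSeries_div_hasSum_exp x

theorem integrable_exp_linear (I : Finset κ) (c : κ → ℝ) :
    Integrable (fun ξ : κ → ℝ => Real.exp (∑ j ∈ I, c j * ξ j)) (gaussMeasure κ) := by
  have hind : iIndepFun (fun (j : κ) (ξ : κ → ℝ) => c j * ξ j) (gaussMeasure κ) :=
    iIndepFun_infinitePi (P := fun _ : κ => gaussianReal 0 1)
      (X := fun j (x : ℝ) => c j * x) (fun i => by fun_prop)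
  have := hind.integrable_exp_mul_sum (t := 1) (fun j => by fun_prop) (s := I) (fun j _ => by
    have hm : MeasurePreserving (fun ξ : κ → ℝ => ξ j) (gaussMeasure κ) (gaussianReal 0 1) :=
      measurePreserving_eval_infinitePi (fun _ : κ => gaussianReal 0 1) j
    simpa [Function.comp_def] using hm.integrable_comp_of_integrable
      (integrable_exp_mul_gaussianReal (μ := 0) (v := 1) (c j)))
  simpa [Finset.sum_apply] using this

/-- From exp(2|s|) ≤ exp(2s) + exp(-2s). It supplies the majorant when a character is expanded in
powers against a square integrable function. -/
theorem memLp_exp_abs_linear (I : Finset κ) (c : κ → ℝ) :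
    MemLp (fun ξ : κ → ℝ => Real.exp |∑ j ∈ I, c j * ξ j|) 2 (gaussMeasure κ) := by
  have hm : Measurable fun ξ : κ → ℝ => Real.exp |∑ j ∈ I, c j * ξ j| :=
    Real.measurable_exp.comp (continuous_abs.measurable.comp
      (g := fun x : ℝ => |x|) (f := fun ξ : κ → ℝ => ∑ j ∈ I, c j * ξ j) (by fun_prop))
  rw [memLp_two_iff_integrable_sq hm.aestronglyMeasurable]
  have h1 := integrable_exp_linear I (fun j => 2 * c j)
  have h2 := integrable_exp_linear I (fun j => -2 * c j)
  refine (h1.add h2).mono' (hm.pow_const 2).aestronglyMeasurable (Eventually.of_forall fun ξ => ?_)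
  have e1 : ∀ a : ℝ, ∑ j ∈ I, a * c j * ξ j = a * ∑ j ∈ I, c j * ξ j := by
    intro a; simp [Finset.mul_sum, mul_assoc]
  simp only [Pi.add_apply, e1]
  rw [Real.norm_of_nonneg (by positivity), ← Real.exp_nat_mul]
  generalize ∑ j ∈ I, c j * ξ j = s
  rcases abs_cases s with ⟨h, _⟩ | ⟨h, _⟩ <;> rw [h]
  · have := (Real.exp_pos (-2 * s)).le
    push_cast; linarith
  · have := (Real.exp_pos (2 * s)).le
    push_cast
    rw [show (2 : ℝ) * -s = -2 * s by ring]; linarith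

theorem integral_polyFun_mul_eq_zero {x : GaussSpace κ}
    (hx : ∀ Q : MvPolynomial κ ℂ, ⟪polyVec Q, x⟫_ℂ = 0) (Q : MvPolynomial κ ℂ) :
    ∫ ξ, polyFun Q ξ * x ξ ∂gaussMeasure κ = 0 := by
  have := hx (MvPolynomial.map (starRingEnd ℂ) Q)
  rw [inner_polyVec] at this
  simpa [polyFun_star] using this

/-- The exponential series may be integrated term by term, with majorant exp|s| · |x|, and each of
its terms is a polynomial. -/
theorem integral_cexp_linear_mul_eq_zero {x : GaussSpace κ}
    (hx : ∀ Q : MvPolynomial κ ℂ, ⟪polyVec Q, x⟫_ℂ = 0) (I : Finset κ) (c : κ → ℝ) :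
    ∫ ξ, Complex.exp ((∑ j ∈ I, c j * ξ j : ℝ) * Complex.I) * x ξ ∂gaussMeasure κ = 0 := by
  set s : (κ → ℝ) → ℝ := fun ξ => ∑ j ∈ I, c j * ξ j with hs
  have hsm : Measurable s := by fun_prop
  have hxm := Lp.aestronglyMeasurable x
  have hcont : AEStronglyMeasurable (fun ξ => (s ξ : ℂ) * Complex.I) (gaussMeasure κ) :=
    ((Complex.measurable_ofReal.comp hsm).mul_const _).aestronglyMeasurable
  have hsum := hasSum_integral_of_dominated_convergence (μ := gaussMeasure κ)
    (F := fun (k : ℕ) ξ => ((s ξ : ℂ) * Complex.I) ^ k / (k.factorial : ℂ) * x ξ)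
    (f := fun ξ => Complex.exp ((s ξ : ℂ) * Complex.I) * x ξ)
    (fun k ξ => |s ξ| ^ k / (k.factorial : ℝ) * ‖x ξ‖)
    (fun k => by
      have := (hcont.pow k).mul_const ((k.factorial : ℂ)⁻¹)
      simp only [div_eq_mul_inv]
      exact this.mul hxm)
    (fun k => Eventually.of_forall fun ξ => by simp)
    (Eventually.of_forall fun ξ => ((hasSum_real_exp _).mul_right _).summable)
    (by
      have e : (fun ξ => ∑' k : ℕ, |s ξ| ^ k / (k.factorial : ℝ) * ‖x ξ‖) =
          fun ξ => Real.exp |s ξ| * ‖x ξ‖ := by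
        ext ξ; exact ((hasSum_real_exp _).mul_right _).tsum_eq
      rw [e]
      exact MemLp.integrable_mul (memLp_exp_abs_linear I c) (Lp.memLp x).norm)
    (Eventually.of_forall fun ξ => (hasSum_complex_exp _).mul_right _)
  refine hsum.unique ?_
  have hz : ∀ k : ℕ, ∫ ξ, ((s ξ : ℂ) * Complex.I) ^ k / (k.factorial : ℂ) * x ξ
      ∂gaussMeasure κ = 0 := by
    intro k
    rw [← integral_polyFun_mul_eq_zero hx (MvPolynomial.C (k.factorial : ℂ)⁻¹ *
      (∑ j ∈ I, MvPolynomial.C (c j * Complex.I) * MvPolynomial.X j) ^ k)]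
    refine integral_congr_ae (Eventually.of_forall fun ξ => ?_)
    simp only [polyFun, map_mul, map_pow, map_sum, MvPolynomial.eval_C, MvPolynomial.eval_X, hs]
    push_cast
    rw [Finset.sum_mul]
    have : ∀ j ∈ I, (c j : ℂ) * ξ j * Complex.I = c j * Complex.I * ξ j := fun j _ => by ring
    rw [Finset.sum_congr rfl this]
    ring
  simp only [hz]
  exact hasSum_zero

/-- Uniqueness of Fourier transforms in infinitely many variables. The positive and negative parts
of h are densities of two finite measures; their finite-dimensional marginals have equal
characteristic functions, and a finite measure on the product is determined by these marginals. -/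
theorem ae_eq_zero_of_integral_cexp_linear {h : (κ → ℝ) → ℝ} (hi : Integrable h (gaussMeasure κ))
    (hh : ∀ (I : Finset κ) (c : κ → ℝ),
      ∫ ξ, Complex.exp ((∑ j ∈ I, c j * ξ j : ℝ) * Complex.I) * h ξ ∂gaussMeasure κ = 0) :
    h =ᵐ[gaussMeasure κ] 0 := by
  set μ₁ := (gaussMeasure κ).withDensity fun ξ => ENNReal.ofReal (h ξ) with hμ₁
  set μ₂ := (gaussMeasure κ).withDensity fun ξ => ENNReal.ofReal (-h ξ) with hμ₂
  have : IsFiniteMeasure μ₁ := isFiniteMeasure_withDensity_ofReal hi.2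
  have : IsFiniteMeasure μ₂ := isFiniteMeasure_withDensity_ofReal hi.neg.2
  have hin : Integrable (fun ξ => -h ξ) (gaussMeasure κ) := hi.neg
  classical
  have key : ∀ I : Finset κ, μ₁.map I.restrict = μ₂.map I.restrict := by
    intro I
    have hr : Measurable (I.restrict : (κ → ℝ) → I → ℝ) := by fun_prop
    refine Measure.ext_of_charFunDual (funext fun L => ?_)
    -- The functional `L` on ℝ^I is given by its values on the unit vectors, extended by zero
    -- outside `I`.
    set c : κ → ℝ := fun j => if hj : j ∈ I then L (Pi.single ⟨j, hj⟩ 1) else 0 with hc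
    have hL : ∀ ξ : κ → ℝ, L (I.restrict ξ) = ∑ j ∈ I, c j * ξ j := by
      intro ξ
      rw [← Finset.sum_coe_sort]
      conv_lhs => rw [← Finset.univ_sum_single (I.restrict ξ)]
      rw [map_sum]
      refine Finset.sum_congr rfl fun j _ => ?_
      have : (Pi.single j (I.restrict ξ j) : I → ℝ) = ξ j • Pi.single j (1 : ℝ) := by
        rw [← Pi.single_smul]; simp
      rw [this, map_smul, smul_eq_mul, mul_comm]
      simp [hc]
    have hval : ∀ g : (κ → ℝ) → ℝ, Integrable g (gaussMeasure κ) →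
        charFunDual (((gaussMeasure κ).withDensity fun ξ => ENNReal.ofReal (g ξ)).map I.restrict) L
          = ∫ ξ, (max (g ξ) 0 : ℝ) • Complex.exp ((∑ j ∈ I, c j * ξ j : ℝ) * Complex.I)
            ∂gaussMeasure κ := by
      intro g hg
      rw [charFunDual_apply, integral_map hr.aemeasurable (by fun_prop),
        integral_withDensity_eq_integral_toReal_smul₀ hg.1.aemeasurable.ennreal_ofReal (by simp)]
      refine integral_congr_ae (Eventually.of_forall fun ξ => ?_)
      simp only [hL, ENNReal.toReal_ofReal']
    rw [hμ₁, hμ₂, hval h hi, hval _ hin, ← sub_eq_zero]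
    have hint : ∀ g : (κ → ℝ) → ℝ, Integrable g (gaussMeasure κ) → Integrable (fun ξ =>
        (max (g ξ) 0 : ℝ) • Complex.exp ((∑ j ∈ I, c j * ξ j : ℝ) * Complex.I))
        (gaussMeasure κ) := by
      intro g hg
      refine (hg.pos_part).smul_bdd (C := 1) ?_ ?_
      · have : Measurable fun ξ : κ → ℝ =>
            Complex.exp ((∑ j ∈ I, c j * ξ j : ℝ) * Complex.I) := by
          refine Complex.measurable_exp.comp ((Complex.measurable_ofReal.comp ?_).mul_const _)
          fun_prop
        exact this.aestronglyMeasurable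
      · refine Eventually.of_forall fun ξ => ?_
        rw [Complex.norm_exp_ofReal_mul_I]
    rw [← integral_sub (hint h hi) (hint _ hin), ← hh I c]
    refine integral_congr_ae (Eventually.of_forall fun ξ => ?_)
    simp only
    rw [← sub_smul, Complex.real_smul, mul_comm]
    congr 2
    rcases le_total (h ξ) 0 with h0 | h0
    · rw [max_eq_right h0, max_eq_left (by linarith)]; ring
    · rw [max_eq_left h0, max_eq_right (by linarith)]; ring
  have heq : μ₁ = μ₂ := IsProjectiveLimit.unique (P := fun I => μ₁.map I.restrict)
    (fun I => rfl) (fun I => (key I).symm)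
  rw [hμ₁, hμ₂, withDensity_eq_iff hi.1.aemeasurable.ennreal_ofReal
    hin.1.aemeasurable.ennreal_ofReal] at heq
  · filter_upwards [heq] with ξ hξ
    rcases le_total (h ξ) 0 with h0 | h0
    · rw [ENNReal.ofReal_of_nonpos h0, eq_comm, ENNReal.ofReal_eq_zero] at hξ
      simp only [Pi.zero_apply]; linarith
    · have : ENNReal.ofReal (-h ξ) = 0 := ENNReal.ofReal_of_nonpos (by linarith)
      rw [this, ENNReal.ofReal_eq_zero] at hξ
      simp only [Pi.zero_apply]; linarith
  · exact hi.lintegral_lt_top.ne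

/-- The polynomials are dense in the Gauss space. -/
theorem eq_zero_of_inner_polyVec {x : GaussSpace κ}
    (hx : ∀ Q : MvPolynomial κ ℂ, ⟪polyVec Q, x⟫_ℂ = 0) : x = 0 := by
  have hxi : Integrable x (gaussMeasure κ) := (Lp.memLp x).integrable (by norm_num)
  have hz := integral_cexp_linear_mul_eq_zero hx
  have hme : ∀ (I : Finset κ) (c : κ → ℝ), Measurable fun ξ : κ → ℝ =>
      Complex.exp ((∑ j ∈ I, c j * ξ j : ℝ) * Complex.I) := fun I c => by
    refine Complex.measurable_exp.comp ((Complex.measurable_ofReal.comp ?_).mul_const _)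
    fun_prop
  have hint : ∀ (I : Finset κ) (c : κ → ℝ) (f : (κ → ℝ) → ℂ), Integrable f (gaussMeasure κ) →
      Integrable (fun ξ => Complex.exp ((∑ j ∈ I, c j * ξ j : ℝ) * Complex.I) * f ξ)
        (gaussMeasure κ) := fun I c f hf =>
    hf.bdd_mul (c := 1) (hme I c).aestronglyMeasurable (Eventually.of_forall fun ξ => by
      rw [Complex.norm_exp_ofReal_mul_I])
  -- Conjugating the identity at -c gives the same identity for the conjugate of x. Sum and
  -- difference then isolate the real and imaginary parts, to which the uniqueness result for real
  -- functions applies.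
  have hz' : ∀ (I : Finset κ) (c : κ → ℝ),
      ∫ ξ, Complex.exp ((∑ j ∈ I, c j * ξ j : ℝ) * Complex.I) * conj (x ξ)
        ∂gaussMeasure κ = 0 := by
    intro I c
    have h := congrArg conj (hz I (fun j => -c j))
    rw [← integral_conj, map_zero] at h
    rw [← h]
    refine integral_congr_ae (Eventually.of_forall fun ξ => ?_)
    simp only [map_mul, ← Complex.exp_conj, neg_mul, Finset.sum_neg_distrib, Complex.ofReal_neg,
      map_neg, Complex.conj_ofReal, Complex.conj_I, mul_neg, neg_neg]
  have hconj : Integrable (fun ξ => conj (x ξ)) (gaussMeasure κ) :=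
    (LinearIsometryEquiv.integrable_comp_iff Complex.conjLIE).2 hxi
  have hre : (fun ξ => (x ξ).re) =ᵐ[gaussMeasure κ] 0 := by
    refine ae_eq_zero_of_integral_cexp_linear hxi.re fun I c => ?_
    have h := congrArg₂ (· + ·) (hz I c) (hz' I c)
    simp only [← integral_add (hint I c _ hxi) (hint I c _ hconj), ← mul_add,
      Complex.add_conj] at h
    have h2 : ∀ ξ, Complex.exp ((∑ j ∈ I, c j * ξ j : ℝ) * Complex.I) * ((2 * (x ξ).re : ℝ) : ℂ) =
      2 * (Complex.exp ((∑ j ∈ I, c j * ξ j : ℝ) * Complex.I) * ((x ξ).re : ℂ)) := fun ξ => by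
        push_cast; ring
    simp only [h2, integral_const_mul] at h
    simpa using h
  have him : (fun ξ => (x ξ).im) =ᵐ[gaussMeasure κ] 0 := by
    refine ae_eq_zero_of_integral_cexp_linear hxi.im fun I c => ?_
    have h := congrArg₂ (· - ·) (hz I c) (hz' I c)
    simp only [← integral_sub (hint I c _ hxi) (hint I c _ hconj), ← mul_sub,
      Complex.sub_conj] at h
    have h2 : ∀ ξ, Complex.exp ((∑ j ∈ I, c j * ξ j : ℝ) * Complex.I) *
        (((2 * (x ξ).im : ℝ) : ℂ) * Complex.I) = (2 * Complex.I) *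
        (Complex.exp ((∑ j ∈ I, c j * ξ j : ℝ) * Complex.I) * ((x ξ).im : ℂ)) := fun ξ => by
        push_cast; ring
    simp only [h2, integral_const_mul] at h
    simpa using h
  refine Lp.ext ?_
  filter_upwards [hre, him, Lp.coeFn_zero ℂ 2 (gaussMeasure κ)] with ξ h1 h2 h3
  rw [h3]
  exact Complex.ext h1 h2

theorem eq_zero_of_inner_hermiteVec {x : GaussSpace κ} (hx : ∀ n, ⟪hermiteVec n, x⟫_ℂ = 0) :
    x = 0 := by
  refine eq_zero_of_inner_polyVec fun Q => ?_
  refine hermitePoly_induction (p := fun Q => ⟪polyVec Q, x⟫_ℂ = 0) Q hx (fun Q R hQ hR => ?_) (fun a Q hQ => ?_)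
  · rw [polyVec_add, inner_add_left, hQ, hR, add_zero]
  · rw [polyVec_smul, inner_smul_left, hQ, mul_zero]

theorem ext_inner_hermiteVec {x y : GaussSpace κ}
    (h : ∀ n, ⟪hermiteVec n, x⟫_ℂ = ⟪hermiteVec n, y⟫_ℂ) : x = y :=
  sub_eq_zero.1 (eq_zero_of_inner_hermiteVec fun n => by rw [inner_sub_right, h n, sub_self])

theorem orthonormal_hermite :
    Orthonormal ℂ fun n : κ →₀ ℕ => ((√(mfac n))⁻¹ : ℂ) • hermiteVec n := by
  classical
  rw [orthonormal_iff_ite]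
  intro n m
  rw [inner_smul_left, inner_smul_right, inner_hermiteVec]
  by_cases h : n = m
  · subst h
    simp only [if_true]
    have h1 : ((√(mfac n) : ℝ) : ℂ) * (√(mfac n) : ℝ) = (mfac n : ℂ) := by
      rw [← Complex.ofReal_mul, Real.mul_self_sqrt (mfac_pos n).le]
    have h2 : ((√(mfac n) : ℝ) : ℂ) ≠ 0 := by
      simp [Real.sqrt_ne_zero', mfac_pos]
    rw [← h1, map_inv₀, Complex.conj_ofReal]
    field_simp
  · simp [h]

/-- The Hilbert basis of normalized Hermite polynomials. -/
noncomputable def hermiteBasis (κ : Type*) : HilbertBasis (κ →₀ ℕ) ℂ (GaussSpace κ) :=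
  HilbertBasis.mkOfOrthogonalEqBot orthonormal_hermite (by
    rw [Submodule.eq_bot_iff]
    intro x hx
    rw [Submodule.mem_orthogonal] at hx
    refine eq_zero_of_inner_hermiteVec fun n => ?_
    have := hx _ (Submodule.subset_span ⟨n, rfl⟩)
    rw [inner_smul_left] at this
    refine (mul_eq_zero.1 this).resolve_left ?_
    have h2 : ((√(mfac n) : ℝ) : ℂ) ≠ 0 := by
      simp [Real.sqrt_ne_zero', mfac_pos]
    simpa using h2)

theorem hermiteBasis_apply (n : κ →₀ ℕ) :
    hermiteBasis κ n = ((√(mfac n))⁻¹ : ℂ) • hermiteVec n := by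
  simp [hermiteBasis]

theorem inner_hermiteVec_eq (n : κ →₀ ℕ) (x : GaussSpace κ) :
    ⟪hermiteVec n, x⟫_ℂ = (√(mfac n) : ℂ) * ⟪hermiteBasis κ n, x⟫_ℂ := by
  have h2 : ((√(mfac n) : ℝ) : ℂ) ≠ 0 := by
    simp [Real.sqrt_ne_zero', mfac_pos]
  rw [hermiteBasis_apply, inner_smul_left, map_inv₀, Complex.conj_ofReal, mul_inv_cancel_left₀ h2]

theorem sqrt_mfac_mul_self (n : κ →₀ ℕ) : (√(mfac n) : ℂ) * (√(mfac n) : ℂ) = mfac n := by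
  rw [← Complex.ofReal_mul, Real.mul_self_sqrt (mfac_pos n).le]

theorem mfac_ne_zero (n : κ →₀ ℕ) : (mfac n : ℂ) ≠ 0 := by
  simp [(mfac_pos n).ne']

/-- Parseval's identity in terms of Hermite coefficients. -/
theorem hasSum_hermite (x y : GaussSpace κ) :
    HasSum (fun n : κ →₀ ℕ => conj ⟪hermiteVec n, x⟫_ℂ * ⟪hermiteVec n, y⟫_ℂ / (mfac n : ℂ))
      ⟪x, y⟫_ℂ := by
  refine HasSum.congr_fun ((hermiteBasis κ).hasSum_inner_mul_inner x y) fun n => ?_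
  rw [inner_hermiteVec_eq, inner_hermiteVec_eq, map_mul, Complex.conj_ofReal, inner_conj_symm,
    ← sqrt_mfac_mul_self]
  have h2 : ((√(mfac n) : ℝ) : ℂ) ≠ 0 := by
    simp [Real.sqrt_ne_zero', mfac_pos]
  field_simp

theorem hasSum_norm_sq_hermite (x : GaussSpace κ) :
    HasSum (fun n : κ →₀ ℕ => ‖⟪hermiteVec n, x⟫_ℂ‖ ^ 2 / mfac n) (‖x‖ ^ 2) := by
  have h := hasSum_hermite x x
  rw [inner_self_eq_norm_sq_to_K] at h
  have e : (fun n : κ →₀ ℕ => conj ⟪hermiteVec n, x⟫_ℂ * ⟪hermiteVec n, x⟫_ℂ / (mfac n : ℂ)) =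
      fun n => ((‖⟪hermiteVec n, x⟫_ℂ‖ ^ 2 / mfac n : ℝ) : ℂ) := by
    ext n
    rw [← Complex.normSq_eq_conj_mul_self, Complex.normSq_eq_norm_sq]
    push_cast; rfl
  rw [e] at h
  refine Complex.hasSum_ofReal.1 ?_
  convert h
  simp

/-- A vector with prescribed Hermite coefficients. -/
theorem exists_hermite_coeff (d : (κ →₀ ℕ) → ℂ)
    (hd : Summable fun n => ‖d n‖ ^ 2 / mfac n) :
    ∃ x : GaussSpace κ, ∀ n, ⟪hermiteVec n, x⟫_ℂ = d n := by
  have hm : Memℓp (fun n => d n / (√(mfac n) : ℂ)) 2 := by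
    refine memℓp_gen ?_
    refine hd.congr fun n => ?_
    rw [norm_div, Complex.norm_real, Real.norm_of_nonneg (Real.sqrt_nonneg _)]
    simp [div_pow, Real.sq_sqrt (mfac_pos n).le]
  refine ⟨(hermiteBasis κ).repr.symm ⟨_, hm⟩, fun n => ?_⟩
  rw [inner_hermiteVec_eq, ← HilbertBasis.repr_apply_apply, LinearIsometryEquiv.apply_symm_apply]
  have h2 : ((√(mfac n) : ℝ) : ℂ) ≠ 0 := by
    simp [Real.sqrt_ne_zero', mfac_pos]
  simp only
  rw [mul_div_cancel₀ _ h2]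

end HermiteBasis

/-! ### Hermite coefficients and coherent vectors -/

section Coherent

variable {κ : Type*}

/-- The Hermite coefficients `⟪He_n, x⟫` of a vector of the Gauss space. -/
noncomputable def hcoef (x : GaussSpace κ) (n : κ →₀ ℕ) : ℂ := ⟪hermiteVec n, x⟫_ℂ

theorem hcoef_smul (a : ℂ) (x : GaussSpace κ) (n : κ →₀ ℕ) : hcoef (a • x) n = a * hcoef x n :=
  inner_smul_right _ _ _

theorem hcoef_ext {x y : GaussSpace κ} (h : ∀ n, hcoef x n = hcoef y n) : x = y :=
  ext_inner_hermiteVec h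

theorem hasSum_hcoef (x y : GaussSpace κ) :
    HasSum (fun n => conj (hcoef x n) * hcoef y n / (mfac n : ℂ)) ⟪x, y⟫_ℂ :=
  hasSum_hermite x y

theorem hasSum_norm_sq_hcoef (x : GaussSpace κ) :
    HasSum (fun n => ‖hcoef x n‖ ^ 2 / mfac n) (‖x‖ ^ 2) :=
  hasSum_norm_sq_hermite x

theorem exists_hcoef_eq (d : (κ →₀ ℕ) → ℂ) (hd : Summable fun n => ‖d n‖ ^ 2 / mfac n) :
    ∃ x : GaussSpace κ, ∀ n, hcoef x n = d n :=
  exists_hermite_coeff d hd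

open Classical in
theorem hcoef_hermiteVec (m n : κ →₀ ℕ) :
    hcoef (hermiteVec m) n = if n = m then (mfac n : ℂ) else 0 := inner_hermiteVec n m

theorem hasSum_hermite_expansion (x : GaussSpace κ) :
    HasSum (fun n => (hcoef x n / (mfac n : ℂ)) • hermiteVec n) x := by
  refine HasSum.congr_fun ((hermiteBasis κ).hasSum_repr x) fun n => ?_
  have h2 : ((√(mfac n) : ℝ) : ℂ) ≠ 0 := by
    simp [Real.sqrt_ne_zero', mfac_pos]
  rw [HilbertBasis.repr_apply_apply, hcoef, inner_hermiteVec_eq, hermiteBasis_apply, smul_smul,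
    ← sqrt_mfac_mul_self]
  congr 1
  field_simp

/-- The monomial `z ^ n`. -/
noncomputable def mpow {R : Type*} [CommMonoid R] (z : κ → R) (n : κ →₀ ℕ) : R :=
  n.prod fun i k => z i ^ k

theorem mpow_add {R : Type*} [CommMonoid R] (z : κ → R) (n m : κ →₀ ℕ) :
    mpow z (n + m) = mpow z n * mpow z m := by
  classical
  exact Finsupp.prod_add_index' (by simp) (fun _ _ _ => pow_add _ _ _)

theorem mpow_single {R : Type*} [CommMonoid R] (z : κ → R) (i : κ) :
    mpow z (Finsupp.single i 1) = z i := by simp [mpow]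

theorem mpow_zero {R : Type*} [CommMonoid R] (z : κ → R) : mpow z 0 = 1 := by simp [mpow]

theorem norm_mpow (z : κ → ℂ) (n : κ →₀ ℕ) : ‖mpow z n‖ = mpow (fun i => ‖z i‖) n := by
  simp [mpow, Finsupp.prod, norm_prod]

theorem mpow_pow {R : Type*} [CommMonoid R] (z : κ → R) (n : κ →₀ ℕ) (k : ℕ) :
    mpow z n ^ k = mpow (fun i => z i ^ k) n := by
  simp only [mpow, Finsupp.prod, ← Finset.prod_pow]
  exact Finset.prod_congr rfl fun i _ => pow_right_comm _ _ _

/-- Adjoining a variable multiplies the series by one exponential series: a multi-index supported in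
`insert a s` is a pair of an exponent of `a` and a multi-index supported in `s`. The indicator keeps
all stages as sums over the same type. -/
theorem hasSum_mpow_support_subset (x : κ → ℂ) (s : Finset κ) :
    HasSum (Set.indicator {n : κ →₀ ℕ | n.support ⊆ s} fun n => mpow x n / (mfac n : ℂ))
      (∏ i ∈ s, Complex.exp (x i)) := by
  classical
  have hmul : ∀ (a : κ) (k : ℕ) (n : κ →₀ ℕ), a ∉ n.support →
      mpow x (n + Finsupp.single a k) / (mfac (n + Finsupp.single a k) : ℂ) =
        x a ^ k / (k.factorial : ℂ) * (mpow x n / (mfac n : ℂ)) := by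
    intro a k n ha
    have hd : Disjoint n.support (Finsupp.single a k).support :=
      Finset.disjoint_of_subset_right Finsupp.support_single_subset (by simpa using ha)
    rw [mpow, mfac, Finsupp.prod_add_index_of_disjoint hd,
      Finsupp.prod_add_index_of_disjoint hd, Finsupp.prod_single_index (by simp),
      Finsupp.prod_single_index (by simp)]
    simp only [mpow, mfac]
    rw [Complex.ofReal_mul, mul_comm, mul_comm (Complex.ofReal (n.prod _)), mul_div_mul_comm]
    simp
  -- Absolute summability is carried through the induction, because the product of two series
  -- requires it.
  suffices h : Summable (fun n => ‖Set.indicator {n : κ →₀ ℕ | n.support ⊆ s}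
      (fun n => mpow x n / (mfac n : ℂ)) n‖) ∧
      HasSum (Set.indicator {n : κ →₀ ℕ | n.support ⊆ s} fun n => mpow x n / (mfac n : ℂ))
      (∏ i ∈ s, Complex.exp (x i)) from h.2
  induction s using Finset.induction_on with
  | empty =>
    have e : ∀ n : κ →₀ ℕ, n ≠ 0 → Set.indicator {n : κ →₀ ℕ | n.support ⊆ ∅}
        (fun n => mpow x n / (mfac n : ℂ)) n = 0 := by
      intro n hn
      simp [hn]
    refine ⟨summable_of_ne_finset_zero (s := {0}) fun n hn => by
      rw [e n (by simpa using hn), norm_zero], ?_⟩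
    convert hasSum_single (0 : κ →₀ ℕ) e using 1
    simp [mpow_zero, mfac_zero]
  | insert a s ha ih =>
    obtain ⟨ih1, ih2⟩ := ih
    have hk : Summable fun k : ℕ => ‖x a ^ k / (k.factorial : ℂ)‖ := by
      simpa using (hasSum_real_exp ‖x a‖).summable
    set f := Set.indicator {n : κ →₀ ℕ | n.support ⊆ s} fun n => mpow x n / (mfac n : ℂ) with hf
    have hp : HasSum (fun q : ℕ × (κ →₀ ℕ) => x a ^ q.1 / (q.1.factorial : ℂ) * f q.2)
        (Complex.exp (x a) * ∏ i ∈ s, Complex.exp (x i)) :=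
      HasSum.mul (f := fun k : ℕ => x a ^ k / (k.factorial : ℂ)) (g := f)
        (hasSum_complex_exp (x a)) ih2
        (summable_mul_of_summable_norm (f := fun k : ℕ => x a ^ k / (k.factorial : ℂ)) (g := f)
          hk ih1)
    have hpn : Summable fun q : ℕ × (κ →₀ ℕ) => ‖x a ^ q.1 / (q.1.factorial : ℂ) * f q.2‖ := by
      refine (hk.mul_of_nonneg ih1 (fun _ => norm_nonneg _) (fun _ => norm_nonneg _)).congr ?_
      intro q; rw [norm_mul]
    have hsup : ∀ q : ℕ × (κ →₀ ℕ), x a ^ q.1 / (q.1.factorial : ℂ) * f q.2 ≠ 0 →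
        q.2.support ⊆ s := by
      intro q hq
      by_contra hcon
      exact hq (by rw [hf, Set.indicator_of_notMem (by simpa using hcon), mul_zero])
    have hsa : ∀ n : κ →₀ ℕ, n.support ⊆ s → n a = 0 := fun n hn => by
      by_contra h
      exact ha (hn (by simpa using h))
    let F : (κ →₀ ℕ) → ℂ := Set.indicator {n : κ →₀ ℕ | n.support ⊆ insert a s}
      fun n => mpow x n / (mfac n : ℂ)
    -- The map (k, n) ↦ n + k e_a is injective because `a` is not in the support of n.
    have hinj : Function.Injective (fun q : {q : ℕ × (κ →₀ ℕ) // q.2.support ⊆ s} =>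
        q.1.2 + Finsupp.single a q.1.1) := by
      rintro ⟨⟨k, n⟩, h1⟩ ⟨⟨k', n'⟩, h2⟩ h
      simp only at h h1 h2
      have hk : k = k' := by
        have := DFunLike.congr_fun h a
        simpa [hsa n h1, hsa n' h2] using this
      subst hk
      simpa using h
    have hFv : ∀ q : {q : ℕ × (κ →₀ ℕ) // q.2.support ⊆ s},
        F (q.1.2 + Finsupp.single a q.1.1) = x a ^ q.1.1 / (q.1.1.factorial : ℂ) * f q.1.2 := by
      rintro ⟨⟨k, n⟩, h1⟩
      simp only at h1 ⊢
      have hmem : n + Finsupp.single a k ∈ {n : κ →₀ ℕ | n.support ⊆ insert a s} := by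
        refine (Finsupp.support_add).trans (Finset.union_subset ?_ ?_)
        · exact h1.trans (Finset.subset_insert _ _)
        · exact (Finsupp.support_single_subset).trans (by simp)
      simp only [F, hf]
      rw [Set.indicator_of_mem hmem, Set.indicator_of_mem (by exact h1),
        hmul a k n (by simpa using hsa n h1)]
    have hFr : ∀ n, n ∉ Set.range (fun q : {q : ℕ × (κ →₀ ℕ) // q.2.support ⊆ s} =>
        q.1.2 + Finsupp.single a q.1.1) → F n = 0 := by
      intro n hn
      refine Set.indicator_of_notMem (fun hmem => hn ?_) _
      refine ⟨⟨(n a, n.erase a), ?_⟩, ?_⟩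
      · rw [Finsupp.support_erase]
        exact (Finset.erase_subset_erase a hmem).trans (by simp [Finset.erase_insert ha])
      · exact Finsupp.erase_add_single a n
    have hsub : ∀ q : ℕ × (κ →₀ ℕ), q ∉ Set.range
        (Subtype.val : {q : ℕ × (κ →₀ ℕ) // q.2.support ⊆ s} → _) →
        x a ^ q.1 / (q.1.factorial : ℂ) * f q.2 = 0 := by
      intro q hq
      by_contra h
      exact hq ⟨⟨q, hsup q h⟩, rfl⟩
    constructor
    · refine (hinj.summable_iff (f := fun n => ‖F n‖) fun n hn => by
        rw [hFr n hn, norm_zero]).1 ?_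
      have := (Subtype.val_injective.summable_iff (fun q hq => by
        rw [hsub q hq, norm_zero])).2 hpn
      refine this.congr fun q => ?_
      simp only [Function.comp_apply]
      rw [hFv]
    · rw [Finset.prod_insert ha]
      refine (hinj.hasSum_iff (f := F) hFr).1 ?_
      have := (Subtype.val_injective.hasSum_iff hsub).2 hp
      refine this.congr_fun fun q => ?_
      simp only [Function.comp_apply]
      rw [hFv]

/-- A finite set of multi-indices involves finitely many variables, so its partial sum is at most a
finite product of exponentials, hence at most exp(∑ ‖x_i‖). -/
theorem summable_norm_mpow (x : κ → ℂ) (hx : Summable fun i => ‖x i‖) :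
    Summable fun n : κ →₀ ℕ => ‖mpow x n / (mfac n : ℂ)‖ := by
  classical
  have hnorm : ∀ n : κ →₀ ℕ, mpow (fun i => (‖x i‖ : ℂ)) n / (mfac n : ℂ) =
      ((‖mpow x n / (mfac n : ℂ)‖ : ℝ) : ℂ) := by
    intro n
    rw [norm_div, norm_mpow, Complex.norm_real, Real.norm_of_nonneg (mfac_pos n).le]
    simp [mpow, Finsupp.prod]
  refine summable_of_sum_le (c := Real.exp (∑' i, ‖x i‖)) (fun _ => norm_nonneg _) fun T => ?_
  set s := T.biUnion fun n => n.support
  have h := hasSum_mpow_support_subset (fun i => (‖x i‖ : ℂ)) s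
  have e : Set.indicator {n : κ →₀ ℕ | n.support ⊆ s}
      (fun n => mpow (fun i => (‖x i‖ : ℂ)) n / (mfac n : ℂ)) = fun n =>
      ((Set.indicator {n : κ →₀ ℕ | n.support ⊆ s} (fun n => ‖mpow x n / (mfac n : ℂ)‖) n : ℝ)
        : ℂ) := by
    ext n
    by_cases hn : n ∈ {n : κ →₀ ℕ | n.support ⊆ s}
    · rw [Set.indicator_of_mem hn, Set.indicator_of_mem hn, hnorm]
    · rw [Set.indicator_of_notMem hn, Set.indicator_of_notMem hn]; simp
  have e2 : ∏ i ∈ s, Complex.exp (‖x i‖ : ℂ) = ((∏ i ∈ s, Real.exp ‖x i‖ : ℝ) : ℂ) := by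
    push_cast; rfl
  rw [e, e2, Complex.hasSum_ofReal] at h
  calc ∑ n ∈ T, ‖mpow x n / (mfac n : ℂ)‖
      = ∑ n ∈ T, Set.indicator {n : κ →₀ ℕ | n.support ⊆ s}
          (fun n => ‖mpow x n / (mfac n : ℂ)‖) n := by
        refine Finset.sum_congr rfl fun n hn => ?_
        rw [Set.indicator_of_mem]
        exact Finset.subset_biUnion_of_mem (fun n : κ →₀ ℕ => n.support) hn
    _ ≤ ∏ i ∈ s, Real.exp ‖x i‖ :=
        sum_le_hasSum T (fun n _ => Set.indicator_nonneg (fun _ _ => norm_nonneg _) n) h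
    _ = Real.exp (∑ i ∈ s, ‖x i‖) := (Real.exp_sum _ _).symm
    _ ≤ _ := Real.exp_le_exp.2 (hx.sum_le_tsum s fun _ _ => norm_nonneg _)

/-- The multinomial expansion of the exponential of a sum. -/
theorem hasSum_mpow (x : κ → ℂ) (hx : Summable fun i => ‖x i‖) :
    HasSum (fun n : κ →₀ ℕ => mpow x n / (mfac n : ℂ)) (Complex.exp (∑' i, x i)) := by
  have hs := summable_norm_mpow x hx
  -- The sums over multi-indices supported in s are followed as s exhausts the index set: by
  -- dominated convergence they tend to the full series, and by the finite product formula to the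
  -- exponential.
  have h1 : Tendsto (fun s : Finset κ => ∑' n, Set.indicator {n : κ →₀ ℕ | n.support ⊆ s}
      (fun n => mpow x n / (mfac n : ℂ)) n) atTop (𝓝 (∑' n, mpow x n / (mfac n : ℂ))) := by
    refine tendsto_tsum_of_dominated_convergence hs (fun n => ?_)
      (Eventually.of_forall fun s n => norm_indicator_le_norm_self _ _)
    refine tendsto_const_nhds.congr' ?_
    filter_upwards [eventually_ge_atTop n.support] with s hs
    rw [Set.indicator_of_mem (by exact hs)]
  have h2 : Tendsto (fun s : Finset κ => ∑' n, Set.indicator {n : κ →₀ ℕ | n.support ⊆ s}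
      (fun n => mpow x n / (mfac n : ℂ)) n) atTop (𝓝 (Complex.exp (∑' i, x i))) := by
    have := (Complex.continuous_exp.tendsto _).comp hx.of_norm.hasSum
    refine this.congr fun s => ?_
    rw [(hasSum_mpow_support_subset x s).tsum_eq, Function.comp_apply, Complex.exp_sum]
  rw [← tendsto_nhds_unique h1 h2]
  exact hs.of_norm.hasSum

theorem exists_coherent (z : κ → ℂ) (hz : Summable fun i => ‖z i‖ ^ 2) :
    ∃ x : GaussSpace κ, ∀ n, hcoef x n = mpow z n := by
  refine exists_hcoef_eq _ ?_
  have := summable_norm_mpow (fun i => ((‖z i‖ ^ 2 : ℝ) : ℂ)) (by simpa using hz)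
  refine this.congr fun n => ?_
  rw [norm_div, norm_mpow, norm_mpow, mpow_pow, Complex.norm_real,
    Real.norm_of_nonneg (mfac_pos n).le]
  simp

/-- The coherent vector with parameters `z`, in its Hermite expansion. -/
noncomputable def coherentVec (z : κ → ℂ) : GaussSpace κ :=
  ∑' n : κ →₀ ℕ, (n.prod fun i k => z i ^ k / (k.factorial : ℂ)) • hermiteVec n

theorem hcoef_coherentVec (z : κ → ℂ) (hz : Summable fun i => ‖z i‖ ^ 2) (n : κ →₀ ℕ) :
    hcoef (coherentVec z) n = mpow z n := by
  obtain ⟨x, hx⟩ := exists_coherent z hz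
  have : coherentVec z = x := by
    rw [coherentVec, ← (hasSum_hermite_expansion x).tsum_eq]
    refine tsum_congr fun m => ?_
    rw [hx, mpow, mfac]
    simp only [Finsupp.prod, Finset.prod_div_distrib]
    push_cast
    rfl
  rw [this, hx]

/-- With the coefficients zⁿ and wⁿ, Parseval's identity is the multinomial series of exp(∑ z̄_i
w_i). -/
theorem inner_coherentVec (z w : κ → ℂ) (hz : Summable fun i => ‖z i‖ ^ 2)
    (hw : Summable fun i => ‖w i‖ ^ 2) :
    ⟪coherentVec z, coherentVec w⟫_ℂ = Complex.exp (∑' i, conj (z i) * w i) := by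
  refine (hasSum_hcoef _ _).unique ?_
  have hsum : Summable fun i => ‖conj (z i) * w i‖ := by
    refine Summable.of_nonneg_of_le (fun _ => norm_nonneg _) (fun i => ?_) (hz.add hw)
    rw [norm_mul, RCLike.norm_conj]
    nlinarith [sq_nonneg (‖z i‖ - ‖w i‖), sq_nonneg ‖z i‖, sq_nonneg ‖w i‖]
  refine (hasSum_mpow _ hsum).congr_fun fun n => ?_
  rw [hcoef_coherentVec z hz, hcoef_coherentVec w hw]
  congr 1
  simp [mpow, Finsupp.prod, Finset.prod_mul_distrib, mul_pow]

end Coherent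

/-! ### Ladder operators on Hermite coefficients -/

section Ladder

variable {κ : Type*}

/-- The falling factorial `n! / (n - I)!` of multi-indices, zero unless `I ≤ n`. -/
noncomputable def dfac (n I : κ →₀ ℕ) : ℝ := I.prod fun i k => ((n i).descFactorial k : ℝ)

theorem dfac_zero (n : κ →₀ ℕ) : dfac n 0 = 1 := by simp [dfac]

theorem dfac_add_single (n I : κ →₀ ℕ) (i : κ) :
    dfac n (I + Finsupp.single i 1) = ((n - I) i : ℕ) * dfac n I := by
  have split : ∀ m : κ →₀ ℕ, dfac n m = ((n i).descFactorial (m i) : ℝ) * dfac n (m.erase i) :=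
    fun m => (Finsupp.mul_prod_erase' m i (fun i k => ((n i).descFactorial k : ℝ)) (by simp)).symm
  have e : (I + Finsupp.single i 1).erase i = I.erase i := by
    rw [Finsupp.erase_add, Finsupp.erase_single, add_zero]
  rw [split, split I, e]
  simp [Nat.descFactorial_succ]
  ring

theorem dfac_add_mul_mfac (n I : κ →₀ ℕ) : dfac (n + I) I * mfac n = mfac (n + I) := by
  induction I using multiIndex_induction generalizing n with
  | h0 => simp [dfac_zero]
  | hs i I ih =>
    have h := ih (n + Finsupp.single i 1)
    rw [add_right_comm, mfac_add_single] at h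
    rw [← add_assoc, ← h, dfac_add_single]
    have : ((n + I + Finsupp.single i 1 - I : κ →₀ ℕ) i : ℕ) = n i + 1 := by
      simp; omega
    rw [this]
    push_cast
    ring

theorem dfac_eq_zero {n I : κ →₀ ℕ} (h : ¬ I ≤ n) : dfac n I = 0 := by
  rw [Finsupp.le_def] at h
  push Not at h
  obtain ⟨i, hi⟩ := h
  refine Finset.prod_eq_zero (i := i) ?_ ?_
  · simp; omega
  · simp [Nat.descFactorial_eq_zero_iff_lt.2 hi]

theorem dfac_le (n I : κ →₀ ℕ) : dfac n I ≤ (n.degree : ℝ) ^ I.degree := by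
  have : (n.degree : ℝ) ^ I.degree = ∏ i ∈ I.support, (n.degree : ℝ) ^ I i := by
    rw [Finset.prod_pow_eq_pow_sum]; rfl
  rw [this]
  refine Finset.prod_le_prod (fun _ _ => by positivity) fun i _ => ?_
  have h1 : ((n i).descFactorial (I i) : ℝ) ≤ (n i : ℝ) ^ I i := by
    exact_mod_cast Nat.descFactorial_le_pow _ _
  refine h1.trans ?_
  gcongr
  exact Finsupp.le_degree i n

/-- The multi-index counting the values of a finite sequence. -/
noncomputable def fidx {k : ℕ} (i : Fin k → κ) : κ →₀ ℕ := ∑ a, Finsupp.single (i a) 1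

theorem degree_fidx {k : ℕ} (i : Fin k → κ) : (fidx i).degree = k := by
  simp [fidx]

theorem mpow_fidx {R : Type*} [CommMonoid R] (z : κ → R) {k : ℕ} (i : Fin k → κ) :
    mpow z (fidx i) = ∏ a, z (i a) := by
  induction k with
  | zero => simp [fidx, mpow_zero]
  | succ k ih =>
    have := ih (fun a => i a.succ)
    simp only [fidx] at this ⊢
    rw [Fin.sum_univ_succ, Fin.prod_univ_succ, mpow_add, mpow_single, this]

theorem prod_create_hermitePoly {k : ℕ} (j : Fin k → κ) (n : κ →₀ ℕ) :
    (List.ofFn fun c => create (j c)).prod (hermitePoly n) = hermitePoly (n + fidx j) := by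
  induction k with
  | zero => simp [fidx]
  | succ k ih =>
    have := ih (fun a => j a.succ)
    simp only [fidx] at this ⊢
    rw [List.ofFn_succ, List.prod_cons, Module.End.mul_apply, this, create_hermitePoly,
      Fin.sum_univ_succ, add_assoc, add_comm (Finsupp.single _ _)]

theorem prod_annih_hermitePoly {k : ℕ} (i : Fin k → κ) (n : κ →₀ ℕ) :
    (List.ofFn fun c => annih (i c)).prod (hermitePoly n) =
      (dfac n (fidx i) : ℂ) • hermitePoly (n - fidx i) := by
  induction k with
  | zero => simp [fidx, dfac_zero]
  | succ k ih =>
    have := ih (fun a => i a.succ)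
    simp only [fidx] at this ⊢
    rw [List.ofFn_succ, List.prod_cons, Module.End.mul_apply, this, map_smul, annih_hermitePoly,
      Fin.sum_univ_succ, smul_smul, add_comm (Finsupp.single _ _), dfac_add_single,
      tsub_add_eq_tsub_tsub, mul_comm]
    push_cast
    rfl

/-- `G` is the vector `(F⁺)^I (F⁻)^J x`. -/
def IsLadder (I J : κ →₀ ℕ) (x G : GaussSpace κ) : Prop :=
  ∀ n, hcoef G n = dfac n I * hcoef x (n - I + J)

/-- In Parseval's identity the terms without I ≤ n vanish with `dfac n I`, which also disarms the
truncated subtraction. After the shift n ↦ n + I the falling factorial cancels against the norm of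
He_{n+I}, and the form becomes symmetric in the two vectors. -/
theorem IsLadder.hasSum_inner {I J : κ →₀ ℕ} {x G : GaussSpace κ} (h : IsLadder I J x G)
    (y : GaussSpace κ) :
    HasSum (fun n => conj (hcoef y (n + I)) * hcoef x (n + J) / (mfac n : ℂ)) ⟪y, G⟫_ℂ := by
  have h1 := hasSum_hcoef y G
  have hinj : Function.Injective fun n : κ →₀ ℕ => n + I := add_left_injective I
  rw [← hinj.hasSum_iff] at h1
  · refine h1.congr_fun fun n => ?_
    simp only [Function.comp_apply]
    rw [h, add_tsub_cancel_right, ← dfac_add_mul_mfac]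
    have h2 : (dfac (n + I) I : ℂ) ≠ 0 := by
      intro h0
      have := dfac_add_mul_mfac n I
      rw [Complex.ofReal_eq_zero.1 h0, zero_mul] at this
      exact (mfac_pos _).ne this
    have h3 := mfac_ne_zero n
    push_cast
    field_simp
  · intro n hn
    have : ¬ I ≤ n := fun hle => hn ⟨n - I, tsub_add_cancel_of_le hle⟩
    rw [h, dfac_eq_zero this]
    simp

/-- Identifies the weak prescription in `CutoffSymbol.graph`, where the operators act on the test
polynomial, with the action on coefficients. It suffices to test Hermite polynomials. -/
theorem IsLadder.inner_polyVec {k l : ℕ} {i : Fin k → κ} {j : Fin l → κ} {x G : GaussSpace κ}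
    (h : IsLadder (fidx i) (fidx j) x G) (Q : MvPolynomial κ ℂ) :
    ⟪polyVec ((List.ofFn fun c => create (j c)).prod
      ((List.ofFn fun a => annih (i a)).prod Q)), x⟫_ℂ = ⟪polyVec Q, G⟫_ℂ := by
  refine hermitePoly_induction (p := fun Q => ⟪polyVec ((List.ofFn fun c => create (j c)).prod
      ((List.ofFn fun a => annih (i a)).prod Q)), x⟫_ℂ = ⟪polyVec Q, G⟫_ℂ) Q (fun n => ?_)
      (fun Q R hQ hR => ?_) (fun a Q hQ => ?_)
  · rw [prod_annih_hermitePoly, map_smul, prod_create_hermitePoly, polyVec_smul, inner_smul_left,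
      Complex.conj_ofReal]
    exact (h n).symm
  · simp only [map_add, polyVec_add, inner_add_left, hQ, hR]
  · simp only [map_smul, polyVec_smul, inner_smul_left, hQ]

/-- The vectors of all finite degrees of regularity with respect to the number operator. -/
def NumberSmooth (x : GaussSpace κ) : Prop :=
  ∀ s : ℕ, Summable fun n => (1 + (n.degree : ℝ)) ^ s * (‖hcoef x n‖ ^ 2 / mfac n)

theorem NumberSmooth.summable_shift {x : GaussSpace κ} (hx : NumberSmooth x) (N s : ℕ) :
    Summable fun n => (1 + N + (n.degree : ℝ)) ^ s * (‖hcoef x n‖ ^ 2 / mfac n) := by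
  refine Summable.of_nonneg_of_le (fun n => ?_) (fun n => ?_) ((hx s).mul_left ((1 + N : ℝ) ^ s))
  · have := mfac_pos n; positivity
  · have := mfac_pos n
    rw [← mul_assoc, ← mul_pow]
    gcongr
    nlinarith [mul_nonneg (Nat.cast_nonneg (α := ℝ) N) (Nat.cast_nonneg (α := ℝ) n.degree)]

/-- Both factorials mfac (n + I) and mfac (n + J) are mfac n times a falling factorial. Hence the
left side is the term of d at n + J times two falling factorials, each bounded by a power of 1 + N +
|n + J|. -/
theorem ladder_term_le {d : (κ →₀ ℕ) → ℂ} {I J : κ →₀ ℕ} {N : ℕ} (hN : I.degree + J.degree ≤ N)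
    (n : κ →₀ ℕ) :
    ‖(dfac (n + I) I : ℂ) * d (n + I - I + J)‖ ^ 2 / mfac (n + I) ≤
      (1 + N + ((n + J).degree : ℝ)) ^ N * (‖d (n + J)‖ ^ 2 / mfac (n + J)) := by
  have hn := mfac_pos n
  have hI := dfac_add_mul_mfac n I
  have hJ := dfac_add_mul_mfac n J
  have pI := mfac_pos (n + I)
  have pJ := mfac_pos (n + J)
  have qI : 0 < dfac (n + I) I := by
    rw [← hI] at pI; exact pos_of_mul_pos_left pI hn.le
  have qJ : 0 < dfac (n + J) J := by
    rw [← hJ] at pJ; exact pos_of_mul_pos_left pJ hn.le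
  have e : ‖(dfac (n + I) I : ℂ) * d (n + I - I + J)‖ ^ 2 / mfac (n + I) =
      dfac (n + I) I * dfac (n + J) J * (‖d (n + J)‖ ^ 2 / mfac (n + J)) := by
    rw [add_tsub_cancel_right, norm_mul, Complex.norm_real, Real.norm_of_nonneg qI.le, ← hI, ← hJ]
    field_simp
  rw [e]
  gcongr
  have hd : ∀ K : κ →₀ ℕ, K.degree ≤ N → K.degree + J.degree ≤ N ∨ K = J →
      dfac (n + K) K ≤ (1 + N + ((n + J).degree : ℝ)) ^ K.degree := by
    intro K hK _
    refine (dfac_le _ _).trans ?_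
    gcongr
    rw [map_add, map_add]
    push_cast
    have : (K.degree : ℝ) ≤ N := by exact_mod_cast hK
    have : (0 : ℝ) ≤ J.degree := by positivity
    linarith
  calc dfac (n + I) I * dfac (n + J) J
      ≤ (1 + N + ((n + J).degree : ℝ)) ^ I.degree * (1 + N + ((n + J).degree : ℝ)) ^ J.degree := by
        gcongr
        · exact hd I (by omega) (Or.inl hN)
        · exact hd J (by omega) (Or.inr rfl)
    _ = (1 + N + ((n + J).degree : ℝ)) ^ (I.degree + J.degree) := (pow_add _ _ _).symm
    _ ≤ _ := by
        refine pow_le_pow_right₀ ?_ hN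
        have : (0 : ℝ) ≤ (n + J).degree := by positivity
        have : (0 : ℝ) ≤ N := by positivity
        linarith

theorem hasSum_ladder_iff (d : (κ →₀ ℕ) → ℂ) (I J : κ →₀ ℕ) (a : ℝ) :
    HasSum (fun n => ‖(dfac (n + I) I : ℂ) * d (n + I - I + J)‖ ^ 2 / mfac (n + I)) a ↔
      HasSum (fun n => ‖(dfac n I : ℂ) * d (n - I + J)‖ ^ 2 / mfac n) a := by
  refine (add_left_injective I).hasSum_iff
    (f := fun n => ‖(dfac n I : ℂ) * d (n - I + J)‖ ^ 2 / mfac n) fun n hn => ?_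
  have : ¬ I ≤ n := fun hle => hn ⟨n - I, tsub_add_cancel_of_le hle⟩
  simp [dfac_eq_zero this]

theorem NumberSmooth.exists_ladder {x : GaussSpace κ} (hx : NumberSmooth x) (I J : κ →₀ ℕ) :
    ∃ G, IsLadder I J x G := by
  refine exists_hcoef_eq _ ?_
  have h := (hx.summable_shift (I.degree + J.degree) (I.degree + J.degree)).comp_injective
    (add_left_injective J)
  have h2 := Summable.of_nonneg_of_le (fun n => by have := mfac_pos (n + I); positivity)
    (fun n => ladder_term_le (d := hcoef x) le_rfl n) h
  exact ((hasSum_ladder_iff (hcoef x) I J _).1 h2.hasSum).summable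

/-- The bound depends on I and J only through N, so it serves all terms of a symbol of given order
at once. -/
theorem IsLadder.norm_sq_le {x G : GaussSpace κ} (hx : NumberSmooth x) {I J : κ →₀ ℕ}
    (h : IsLadder I J x G) {N : ℕ} (hN : I.degree + J.degree ≤ N) :
    ‖G‖ ^ 2 ≤ ∑' n, (1 + N + (n.degree : ℝ)) ^ N * (‖hcoef x n‖ ^ 2 / mfac n) := by
  have h1 := hasSum_norm_sq_hcoef G
  simp only [h _] at h1
  rw [← hasSum_ladder_iff (hcoef x)] at h1
  have hs := hx.summable_shift N N
  refine h1.tsum_eq.symm.le.trans ?_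
  refine (h1.summable.tsum_le_tsum (fun n => ladder_term_le (d := hcoef x) hN n)
    (hs.comp_injective (add_left_injective J))).trans ?_
  exact Summable.tsum_le_tsum_of_inj (fun n => n + J) (add_left_injective J)
    (fun n _ => by have := mfac_pos n; positivity) (fun n => le_rfl)
    (hs.comp_injective (add_left_injective J)) hs

end Ladder

/-! ### The cutoff operator on 𝒢^∞ -/

section Operator

variable {ι H : Type*} [NormedAddCommGroup H] [InnerProductSpace ℂ H]

namespace SobolevScale

variable (S : SobolevScale ι H)

theorem one_le_one_add_ev (i : ι) : 1 ≤ 1 + S.ev i := by linarith [S.ev_nonneg i]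

theorem summable_inv_pow : ∃ s : ℕ, Summable fun i => ((1 + S.ev i) ^ s)⁻¹ := by
  obtain ⟨p, hp, hs⟩ := S.finite_trace
  obtain ⟨s, hps⟩ := exists_nat_ge p
  refine ⟨s, Summable.of_nonneg_of_le (fun i => ?_) (fun i => ?_) hs⟩
  · have := S.one_le_one_add_ev i
    positivity
  · have := S.one_le_one_add_ev i
    rw [← Real.rpow_natCast, ← Real.rpow_neg (by linarith)]
    exact Real.rpow_le_rpow_of_exponent_le this (by linarith)

/-- The trace condition sums strictly positive numbers over all indices. Countability is needed for
measurability of the coordinate series and for limits along finite index sets. -/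
theorem countable_index {ι H : Type*} [NormedAddCommGroup H] [InnerProductSpace ℂ H]
    (S : SobolevScale ι H) : Countable ι := by
  obtain ⟨s, hs⟩ := S.summable_inv_pow
  have h := hs.countable_support
  have e : Function.support (fun i => ((1 + S.ev i) ^ s)⁻¹) = Set.univ := by
    ext i
    have := S.one_le_one_add_ev i
    simp only [Function.mem_support, Set.mem_univ, iff_true]
    positivity
  rw [e] at h
  exact Set.countable_univ_iff.1 h

theorem degree_le_weight (n : ι →₀ ℕ) : (n.degree : ℝ) ≤ S.weight n := by
  rw [weight, Finsupp.sum, Finsupp.degree_apply]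
  push_cast
  refine Finset.sum_le_sum fun i _ => ?_
  exact le_mul_of_one_le_right (by positivity) (S.one_le_one_add_ev i)

theorem mem_smoothFock {F : GaussSpace ι} : F ∈ S.smoothFock ↔ ∀ s : ℕ,
    Summable fun n => S.weight n ^ (2 * s) * (‖hcoef F n‖ ^ 2 / mfac n) := Iff.rfl

theorem numberSmooth {F : GaussSpace ι} (hF : F ∈ S.smoothFock) : NumberSmooth F := by
  intro s
  rw [mem_smoothFock] at hF
  refine Summable.of_nonneg_of_le (fun n => ?_) (fun n => ?_)
    (((hF 0).add (hF s)).mul_left (2 ^ (2 * s - 1)))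
  · have := mfac_pos n; positivity
  · have h0 := mfac_pos n
    have hd : (0 : ℝ) ≤ n.degree := by positivity
    have hw := S.degree_le_weight n
    have h1 : (1 + (n.degree : ℝ)) ^ s ≤ (1 + S.weight n) ^ (2 * s) :=
      (pow_le_pow_right₀ (by linarith) (by omega)).trans (pow_le_pow_left₀ (by linarith) (by linarith) _)
    -- Convexity gives (1 + w)^{2s} ≤ 2^{2s-1}(1 + w^{2s}), the source of the constant in the
    -- majorant.
    have h2 := add_pow_le (zero_le_one' ℝ) (hd.trans hw) (2 * s)
    rw [one_pow] at h2
    rw [← add_mul, ← mul_assoc, mul_zero, pow_zero]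
    gcongr
    exact h1.trans h2

end SobolevScale

theorem summable_prod_fin {ι : Type*} {g : ι → ℝ} (hg : Summable g) (h0 : ∀ i, 0 ≤ g i) (k : ℕ) :
    Summable fun i : Fin k → ι => ∏ a, g (i a) := by
  induction k with
  | zero => exact Summable.of_finite
  | succ k ih =>
    have h := hg.mul_of_nonneg ih h0 (fun i => Finset.prod_nonneg fun a _ => h0 _)
    rw [← (Fin.consEquiv fun _ : Fin (k + 1) => ι).summable_iff]
    refine h.congr fun q => ?_
    simp [Fin.prod_univ_succ, Fin.consEquiv]

namespace CutoffSymbol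

variable {S : SobolevScale ι H} (W : CutoffSymbol S)

/-- In each sector (k, l) the decay of order s beats a product of k + l copies of the convergent
series ∑ (1 + λ_i)^{-s}; only finitely many sectors are nonzero. -/
theorem summable_coeff : Summable fun t : WickIndex ι => ‖W.coeff t‖ := by
  obtain ⟨s, hs⟩ := S.summable_inv_pow
  have hpos : ∀ i, 0 < 1 + S.ev i := fun i => by linarith [S.one_le_one_add_ev i]
  refine (summable_sigma_of_nonneg fun t => norm_nonneg _).2 ⟨fun kl => ?_, ?_⟩
  · obtain ⟨C, hC⟩ := W.decay kl s
    have h0 : ∀ i, 0 ≤ ((1 + S.ev i) ^ s)⁻¹ := fun i => by have := hpos i; positivity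
    have h := ((summable_prod_fin hs h0 kl.1).mul_of_nonneg (summable_prod_fin hs h0 kl.2)
      (fun i => Finset.prod_nonneg fun a _ => h0 _)
      (fun i => Finset.prod_nonneg fun a _ => h0 _)).mul_left C
    refine Summable.of_nonneg_of_le (fun _ => norm_nonneg _) (fun ij => ?_) h
    have h1 := hC ij.1 ij.2
    have hp : 0 < ((∏ a, (1 + S.ev (ij.1 a))) * ∏ c, (1 + S.ev (ij.2 c))) ^ s :=
      pow_pos (mul_pos (Finset.prod_pos fun _ _ => hpos _) (Finset.prod_pos fun _ _ => hpos _)) _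
    rw [← le_div_iff₀ hp] at h1
    refine h1.trans (le_of_eq ?_)
    rw [div_eq_mul_inv, mul_pow, mul_inv, ← Finset.prod_pow, ← Finset.prod_pow,
      ← Finset.prod_inv_distrib, ← Finset.prod_inv_distrib]
  · refine summable_of_ne_finset_zero
      (s := Finset.range (W.order + 1) ×ˢ Finset.range (W.order + 1)) fun kl hkl => ?_
    have : ∀ y : (Fin kl.1 → ι) × (Fin kl.2 → ι), ‖W.coeff ⟨kl, y⟩‖ = 0 := by
      intro y
      rw [norm_eq_zero]
      refine W.coeff_eq_zero _ ?_
      simp only [Finset.mem_product, Finset.mem_range, not_and_or, not_lt] at hkl ⊢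
      omega
    simp [this]

theorem summable_coeff_mul {v : WickIndex ι → ℂ} {C : ℝ} (hv : ∀ t, ‖v t‖ ≤ C) :
    Summable fun t => W.coeff t * v t := by
  refine Summable.of_norm_bounded (W.summable_coeff.mul_right C) fun t => ?_
  rw [norm_mul]
  exact mul_le_mul_of_nonneg_left (hv t) (norm_nonneg _)

/-- The graph is single-valued because the polynomials are total; this makes `operator` a genuine
operator with that graph. -/
theorem graph_snd_eq_zero (x : GaussSpace ι × GaussSpace ι) (hx : x ∈ W.graph) (h0 : x.1 = 0) :
    x.2 = 0 := by
  refine eq_zero_of_inner_polyVec fun Q => ?_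
  have h := hx.2 Q
  simp only [h0, inner_zero_right, mul_zero] at h
  exact h.unique hasSum_zero

/-- The cutoff operator is defined on all of `𝒢^∞`, by a norm convergent series. -/
theorem exists_graph {x : GaussSpace ι} (hx : x ∈ S.smoothFock) :
    ∃ G, (x, G) ∈ W.graph ∧ ∀ (y : GaussSpace ι) (B : WickIndex ι → ℂ),
      (∀ t, HasSum (fun n => conj (hcoef y (n + fidx t.2.1)) * hcoef x (n + fidx t.2.2) /
        (mfac n : ℂ)) (B t)) → HasSum (fun t => W.coeff t * B t) ⟪y, G⟫_ℂ := by
  have hs := S.numberSmooth hx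
  choose G hG using fun t : WickIndex ι => hs.exists_ladder (fidx t.2.1) (fidx t.2.2)
  set C := ∑' n, (1 + W.order + (n.degree : ℝ)) ^ W.order * (‖hcoef x n‖ ^ 2 / mfac n)
  have hsum : Summable fun t => W.coeff t • G t := by
    refine Summable.of_norm_bounded (W.summable_coeff.mul_right √C) fun t => ?_
    rw [norm_smul]
    -- Above the order the coefficient vanishes; up to the order every ladder vector has norm at
    -- most √C.
    by_cases ht : W.order < t.1.1 + t.1.2
    · simp [W.coeff_eq_zero t ht]
    · gcongr
      refine Real.le_sqrt_of_sq_le ((hG t).norm_sq_le hs (N := W.order) ?_)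
      rw [degree_fidx, degree_fidx]; omega
  have hin : ∀ y : GaussSpace ι, HasSum (fun t => W.coeff t * ⟪y, G t⟫_ℂ)
      ⟪y, ∑' t, W.coeff t • G t⟫_ℂ := by
    intro y
    have := (innerSL ℂ y).hasSum hsum.hasSum
    simpa [inner_smul_right] using this
  refine ⟨∑' t, W.coeff t • G t, ⟨hx, fun Q => ?_⟩, fun y B hB => ?_⟩
  · refine (hin (polyVec Q)).congr_fun fun t => ?_
    rw [(hG t).inner_polyVec Q]
  · refine (hin y).congr_fun fun t => ?_
    rw [((hG t).hasSum_inner y).unique (hB t)]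

theorem mem_domain_operator {x : GaussSpace ι} :
    x ∈ W.operator.domain ↔ x ∈ S.smoothFock := by
  constructor
  · intro hx
    obtain ⟨y, hy, rfl⟩ := Submodule.mem_map.1 hx
    exact hy.1
  · intro hx
    obtain ⟨G, hG, -⟩ := W.exists_graph hx
    exact Submodule.mem_map.2 ⟨_, hG, rfl⟩

theorem operator_apply_eq {x : W.operator.domain} {G : GaussSpace ι}
    (hG : ((x : GaussSpace ι), G) ∈ W.graph) : W.operator x = G := by
  have h := Submodule.mem_graph_toLinearPMap W.graph_snd_eq_zero x
  have h2 := W.graph_snd_eq_zero _ (W.graph.sub_mem h hG) (sub_self _)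
  exact sub_eq_zero.1 h2

/-- The matrix elements of the cutoff operator. -/
theorem hasSum_inner_operator (x : W.operator.domain) (y : GaussSpace ι) (B : WickIndex ι → ℂ)
    (hB : ∀ t, HasSum (fun n => conj (hcoef y (n + fidx t.2.1)) *
      hcoef (x : GaussSpace ι) (n + fidx t.2.2) / (mfac n : ℂ)) (B t)) :
    HasSum (fun t => W.coeff t * B t) ⟪y, W.operator x⟫_ℂ := by
  obtain ⟨G, hG, h⟩ := W.exists_graph (W.mem_domain_operator.1 x.2)
  rw [W.operator_apply_eq hG]
  exact h y B hB

end CutoffSymbol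

end Operator

/-! ### Linear coordinates on the Gauss space -/

section GaussianCoordinates

variable {κ : Type*}

theorem measurePreserving_coord (i : κ) :
    MeasurePreserving (fun ξ : κ → ℝ => ξ i) (gaussMeasure κ) (gaussianReal 0 1) :=
  measurePreserving_eval_infinitePi (fun _ : κ => gaussianReal 0 1) i

theorem lintegral_coord_lt_top :
    ∫⁻ x : ℝ, ‖x‖ₑ ∂gaussianReal 0 1 < ⊤ := by
  have := (integrable_pow_gaussianReal 1).2
  simpa [HasFiniteIntegral] using this

/-- The expectation of ∑ |a_i ξ_i| is ∑ |a_i| times the first absolute moment of a standard normal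
variable, hence finite. -/
theorem ae_summable_linear [Countable κ] {a : κ → ℝ} (ha : Summable fun i => |a i|) :
    ∀ᵐ ξ ∂gaussMeasure κ, Summable fun i => a i * ξ i := by
  have hm : ∀ i : κ, Measurable fun ξ : κ → ℝ => ‖a i * ξ i‖ₑ := fun i => by fun_prop
  have h1 : ∫⁻ ξ, ∑' i, ‖a i * ξ i‖ₑ ∂gaussMeasure κ < ⊤ := by
    rw [lintegral_tsum fun i => (hm i).aemeasurable]
    have h2 : ∀ i, ∫⁻ ξ, ‖a i * ξ i‖ₑ ∂gaussMeasure κ =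
        ‖a i‖ₑ * ∫⁻ x : ℝ, ‖x‖ₑ ∂gaussianReal 0 1 := by
      intro i
      simp only [enorm_mul]
      rw [lintegral_const_mul _ (by fun_prop)]
      rw [(measurePreserving_coord i).lintegral_comp (f := fun x : ℝ => ‖x‖ₑ) (by fun_prop)]
    simp only [h2]
    rw [ENNReal.tsum_mul_right]
    refine ENNReal.mul_lt_top ?_ lintegral_coord_lt_top
    have : Summable fun i => ‖a i‖₊ := by
      rw [← NNReal.summable_coe]; simpa using ha
    exact (ENNReal.tsum_coe_ne_top_iff_summable.2 this).lt_top
  filter_upwards [ae_lt_top (Measurable.tsum hm) h1.ne] with ξ hξ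
  have := ENNReal.tsum_coe_ne_top_iff_summable.1 hξ.ne
  rw [← NNReal.summable_coe] at this
  exact Summable.of_norm (by simpa using this)

theorem integral_cexp_finset (s : Finset κ) (a : κ → ℝ) :
    ∫ ξ, Complex.exp ((∑ j ∈ s, a j * ξ j : ℝ) * Complex.I) ∂gaussMeasure κ =
      Complex.exp (-((∑ j ∈ s, a j ^ 2 : ℝ) : ℂ) / 2) := by
  have h1 : ∀ ξ : κ → ℝ, Complex.exp ((∑ j ∈ s, a j * ξ j : ℝ) * Complex.I) =
      ∏ j : s, Complex.exp (a j * ξ j * Complex.I) := by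
    intro ξ
    rw [← Complex.exp_sum, Finset.sum_coe_sort s fun j => (a j * ξ j * Complex.I : ℂ),
      Complex.ofReal_sum, Finset.sum_mul]
    simp
  simp only [h1]
  have hme : ∀ j, Measurable fun x : ℝ => Complex.exp (a j * x * Complex.I) := fun j => by
    refine Complex.measurable_exp.comp (((Complex.measurable_ofReal).const_mul _).mul_const _)
  have hind : iIndepFun (fun (j : s) (ξ : κ → ℝ) => Complex.exp (a j * ξ j * Complex.I))
      (gaussMeasure κ) :=
    (iIndepFun_infinitePi (P := fun _ : κ => gaussianReal 0 1)
      (X := fun j (x : ℝ) => Complex.exp (a j * x * Complex.I)) hme).precomp Subtype.val_injective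
  rw [hind.integral_fun_prod_eq_prod_integral (fun j =>
    ((hme j).comp (measurable_pi_apply (j : κ))).aestronglyMeasurable)]
  have h2 : ∀ j : κ, ∫ ξ : κ → ℝ, Complex.exp (a j * ξ j * Complex.I) ∂gaussMeasure κ =
      Complex.exp (-(a j ^ 2 : ℝ) / 2) := by
    intro j
    have h3 : ∫ x : ℝ, Complex.exp (a j * x * Complex.I) ∂gaussianReal 0 1 =
        Complex.exp (-(a j ^ 2 : ℝ) / 2) := by
      have := charFun_gaussianReal (μ := 0) (v := 1) (a j)
      rw [charFun_apply_real] at this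
      rw [this]
      simp; ring_nf
    rw [← h3, ← (measurePreserving_coord j).map_eq,
      integral_map (measurePreserving_coord j).measurable.aemeasurable
        (hme j).aestronglyMeasurable]
  simp only [h2]
  rw [Finset.prod_coe_sort s fun j => Complex.exp (-(a j ^ 2 : ℝ) / 2), ← Complex.exp_sum]
  congr 1
  rw [← Finset.sum_div]
  push_cast
  rw [Finset.sum_neg_distrib]

/-- Dominated convergence along the finite subsets of the index set; countability makes this filter
countably generated. -/
theorem integral_cexp_tsum [Countable κ] {a : κ → ℝ} (ha : Summable fun i => |a i|) {σ : ℝ}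
    (hσ : HasSum (fun i => a i ^ 2) σ) :
    ∫ ξ, Complex.exp ((∑' j, a j * ξ j : ℝ) * Complex.I) ∂gaussMeasure κ =
      Complex.exp (-(σ : ℂ) / 2) := by
  have h1 : Tendsto (fun s : Finset κ =>
      ∫ ξ, Complex.exp ((∑ j ∈ s, a j * ξ j : ℝ) * Complex.I) ∂gaussMeasure κ) atTop
      (𝓝 (∫ ξ, Complex.exp ((∑' j, a j * ξ j : ℝ) * Complex.I) ∂gaussMeasure κ)) := by
    refine tendsto_integral_filter_of_dominated_convergence (fun _ => 1)
      (Eventually.of_forall fun s => ?_) (Eventually.of_forall fun s =>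
        Eventually.of_forall fun ξ => ?_) (integrable_const _) ?_
    · have : Measurable fun ξ : κ → ℝ => Complex.exp ((∑ j ∈ s, a j * ξ j : ℝ) * Complex.I) := by
        refine Complex.measurable_exp.comp ((Complex.measurable_ofReal.comp ?_).mul_const _)
        fun_prop
      exact this.aestronglyMeasurable
    · rw [Complex.norm_exp_ofReal_mul_I]
    · filter_upwards [ae_summable_linear ha] with ξ hξ
      have hc : Continuous fun x : ℝ => Complex.exp (x * Complex.I) := by fun_prop
      exact (hc.tendsto _).comp hξ.hasSum
  refine tendsto_nhds_unique h1 ?_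
  simp only [integral_cexp_finset]
  have hc : Continuous fun x : ℝ => Complex.exp (-(x : ℂ) / 2) := by fun_prop
  exact (hc.tendsto σ).comp hσ

variable {r : ℕ}

/-- The coordinates `∑ᵢ B_{ci} ξ_i` of a point of the Gauss space. -/
noncomputable def linCoord (B : Fin r → κ → ℝ) (ξ : κ → ℝ) : Fin r → ℝ :=
  fun c => ∑' i, B c i * ξ i

theorem measurable_linCoord [Countable κ] (B : Fin r → κ → ℝ) : Measurable (linCoord B) :=
  measurable_pi_lambda _ fun c =>
    Measurable.tsum (f := fun i (ξ : κ → ℝ) => B c i * ξ i) fun i => by fun_prop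

/-- Orthonormal systems of absolutely summable coefficients give independent standard normal
coordinates. -/
theorem measurePreserving_linCoord [Countable κ] {B : Fin r → κ → ℝ}
    (h1 : ∀ c, Summable fun i => |B c i|)
    (h2 : ∀ c c', HasSum (fun i => B c i * B c' i) (if c = c' then 1 else 0)) :
    MeasurePreserving (linCoord B) (gaussMeasure κ) (gaussMeasure (Fin r)) := by
  refine ⟨measurable_linCoord B, ?_⟩
  have : IsProbabilityMeasure ((gaussMeasure κ).map (linCoord B)) :=
    Measure.isProbabilityMeasure_map (measurable_linCoord B).aemeasurable
  refine Measure.ext_of_charFunDual (funext fun L => ?_)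
  set t : Fin r → ℝ := fun c => L (Pi.single c 1) with ht
  have hL : ∀ x : Fin r → ℝ, L x = ∑ c, t c * x c := by
    intro x
    conv_lhs => rw [← Finset.univ_sum_single x]
    rw [map_sum]
    refine Finset.sum_congr rfl fun c _ => ?_
    have : (Pi.single c (x c) : Fin r → ℝ) = x c • Pi.single c (1 : ℝ) := by
      rw [← Pi.single_smul]; simp
    rw [this, map_smul, smul_eq_mul, mul_comm]
  rw [charFunDual_apply, charFunDual_apply,
    integral_map (measurable_linCoord B).aemeasurable (by fun_prop)]
  simp only [hL]
  rw [integral_cexp_finset Finset.univ t]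
  -- The form t · π(ξ) has the coefficients a = Bᵀt, and orthonormality of the rows gives ∑ a_i² =
  -- |t|². The characteristic function is therefore that of the standard Gauss measure.
  set a : κ → ℝ := fun i => ∑ c, t c * B c i with ha
  have hsum : Summable fun i => |a i| := by
    refine Summable.of_nonneg_of_le (fun _ => abs_nonneg _) (fun i => Finset.abs_sum_le_sum_abs _ _)
      (summable_sum fun c _ => ?_)
    simp only [abs_mul]
    exact (h1 c).mul_left _
  have hsq : HasSum (fun i => a i ^ 2) (∑ c, t c ^ 2) := by
    have : HasSum (fun i => ∑ c, ∑ c', t c * t c' * (B c i * B c' i))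
        (∑ c, ∑ c', t c * t c' * (if c = c' then 1 else 0)) :=
      hasSum_sum fun c _ => hasSum_sum fun c' _ => (h2 c c').mul_left _
    convert this using 1
    · ext i
      rw [ha, sq, Finset.sum_mul_sum]
      exact Finset.sum_congr rfl fun c _ => Finset.sum_congr rfl fun c' _ => by ring
    · simp [sq]
  rw [← integral_cexp_tsum hsum hsq]
  have hall : ∀ᵐ ξ ∂gaussMeasure κ, ∀ c, Summable fun i => B c i * ξ i :=
    ae_all_iff.2 fun c => ae_summable_linear (h1 c)
  refine integral_congr_ae ?_
  filter_upwards [hall] with ξ hξ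
  have e : ∑ c, t c * linCoord B ξ c = ∑' i, a i * ξ i := by
    have : HasSum (fun i => ∑ c, t c * (B c i * ξ i)) (∑ c, t c * linCoord B ξ c) :=
      hasSum_sum fun c _ => (hξ c).hasSum.mul_left _
    rw [← this.tsum_eq]
    refine tsum_congr fun i => ?_
    rw [ha, Finset.sum_mul]
    exact Finset.sum_congr rfl fun c _ => by ring
  rw [e]

end GaussianCoordinates

/-! ### Pullback along the coordinates and the chain rule -/

section Pullback

variable {κ : Type*} {r : ℕ}

theorem integrable_coord_mul {h : (κ → ℝ) → ℂ} (hh : MemLp h 2 (gaussMeasure κ)) (j : κ) :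
    Integrable (fun ξ => (ξ j : ℂ) * h ξ) (gaussMeasure κ) := by
  have hX : MemLp (fun ξ : κ → ℝ => (ξ j : ℂ)) 2 (gaussMeasure κ) := by
    have := polyFun_memLp (MvPolynomial.X j : MvPolynomial κ ℂ) 2
    exact (memLp_congr_ae (Eventually.of_forall fun ξ => polyFun_X j ξ)).1 this
  exact MemLp.integrable_mul hX hh

/-- The bound is independent of `j`, so that summability of |B_{cj}| over j suffices to integrate a
coordinate series termwise. -/
theorem integral_norm_coord_mul_le {h : (κ → ℝ) → ℂ} (hh : MemLp h 2 (gaussMeasure κ)) (j : κ) :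
    ∫ ξ, ‖(ξ j : ℂ) * h ξ‖ ∂gaussMeasure κ ≤
      (∫ x : ℝ, x ^ 2 ∂gaussianReal 0 1) + ∫ ξ, ‖h ξ‖ ^ 2 ∂gaussMeasure κ := by
  have hm := measurePreserving_coord j
  have e : ∫ x : ℝ, x ^ 2 ∂gaussianReal 0 1 = ∫ ξ, (ξ j) ^ 2 ∂gaussMeasure κ := by
    rw [← hm.map_eq, integral_map hm.measurable.aemeasurable (by fun_prop)]
  have hi : Integrable (fun ξ : κ → ℝ => (ξ j) ^ 2) (gaussMeasure κ) :=
    hm.integrable_comp_of_integrable (integrable_pow_gaussianReal 2)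
  have hi2 : Integrable (fun ξ => ‖h ξ‖ ^ 2) (gaussMeasure κ) := hh.integrable_norm_pow (by simp)
  rw [e, ← integral_add hi hi2]
  refine integral_mono (integrable_coord_mul hh j).norm (hi.add hi2) fun ξ => ?_
  simp only [norm_mul, Complex.norm_real, Real.norm_eq_abs]
  have := sq_abs (ξ j)
  nlinarith [sq_nonneg (|ξ j| - ‖h ξ‖), sq_nonneg (ξ j), sq_nonneg ‖h ξ‖]

/-- The rows of `B` are absolutely summable and orthonormal. -/
structure IsRealFrame (B : Fin r → κ → ℝ) : Prop where
  summable : ∀ c, Summable fun i => |B c i|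
  orthonormal : ∀ c c', HasSum (fun i => B c i * B c' i) (if c = c' then 1 else 0)

variable [Countable κ] {B : Fin r → κ → ℝ}

theorem IsRealFrame.measurePreserving (hB : IsRealFrame B) :
    MeasurePreserving (linCoord B) (gaussMeasure κ) (gaussMeasure (Fin r)) :=
  measurePreserving_linCoord hB.summable hB.orthonormal

/-- The isometry `f ↦ f ∘ π` from the Gauss space on `ℝ^r`. -/
noncomputable def IsRealFrame.pull (hB : IsRealFrame B) :
    GaussSpace (Fin r) →ₗᵢ[ℂ] GaussSpace κ :=
  Lp.compMeasurePreservingₗᵢ ℂ (linCoord B) hB.measurePreserving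

theorem IsRealFrame.coeFn_pull (hB : IsRealFrame B) (f : GaussSpace (Fin r)) :
    hB.pull f =ᵐ[gaussMeasure κ] fun ξ => f (linCoord B ξ) :=
  Lp.coeFn_compMeasurePreserving f hB.measurePreserving

theorem IsRealFrame.coeFn_pull_of_ae (hB : IsRealFrame B) {f : GaussSpace (Fin r)}
    {g : (Fin r → ℝ) → ℂ} (h : f =ᵐ[gaussMeasure (Fin r)] g) :
    hB.pull f =ᵐ[gaussMeasure κ] fun ξ => g (linCoord B ξ) :=
  (hB.coeFn_pull f).trans (hB.measurePreserving.quasiMeasurePreserving.ae_eq_comp h)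

theorem IsRealFrame.coeFn_pull_polyVec (hB : IsRealFrame B) (q : MvPolynomial (Fin r) ℂ) :
    hB.pull (polyVec q) =ᵐ[gaussMeasure κ] fun ξ => polyFun q (linCoord B ξ) :=
  hB.coeFn_pull_of_ae (coeFn_polyVec q)

/-- Multiplication by the coordinate x_c ∘ π is the series ∑_j B_{cj} ξ_j, taken out of the integral
by absolute summability. -/
theorem IsRealFrame.hasSum_inner_pull_X_mul (hB : IsRealFrame B) (c : Fin r)
    (Q : MvPolynomial κ ℂ) (q : MvPolynomial (Fin r) ℂ) :
    HasSum (fun j => (B c j : ℂ) * ⟪polyVec (MvPolynomial.X j * Q), hB.pull (polyVec q)⟫_ℂ)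
      ⟪polyVec Q, hB.pull (polyVec (q * MvPolynomial.X c))⟫_ℂ := by
  set h : (κ → ℝ) → ℂ := fun ξ => conj (polyFun Q ξ) * polyFun q (linCoord B ξ) with hh
  have hmem : MemLp h 2 (gaussMeasure κ) := by
    -- Both factors are in L⁴, so their product is in L².
    have h1 := polyFun_memLp (MvPolynomial.map (starRingEnd ℂ) Q) 4
    have h2 := (polyFun_memLp q 4).comp_measurePreserving hB.measurePreserving
    have : ENNReal.HolderTriple ((4 : NNReal) : ENNReal) ((4 : NNReal) : ENNReal) 2 := by
      constructor
      rw [← two_mul, show ((4 : NNReal) : ENNReal) = 2 * 2 by norm_num,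
        ENNReal.mul_inv (by simp) (by simp), ← mul_assoc]
      simp [ENNReal.mul_inv_cancel]
    refine (memLp_congr_ae (Eventually.of_forall fun ξ => ?_)).1 (MemLp.mul (r := 2) h2 h1)
    simp [hh, polyFun_star]
  have hF : ∀ j, Integrable (fun ξ : κ → ℝ => (B c j : ℂ) * ((ξ j : ℂ) * h ξ)) (gaussMeasure κ) :=
    fun j => (integrable_coord_mul hmem j).const_mul _
  have hs : Summable fun j => ∫ ξ, ‖(B c j : ℂ) * ((ξ j : ℂ) * h ξ)‖ ∂gaussMeasure κ := by
    refine Summable.of_nonneg_of_le (fun j => integral_nonneg fun _ => norm_nonneg _) (fun j => ?_)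
      ((hB.summable c).mul_right ((∫ x : ℝ, x ^ 2 ∂gaussianReal 0 1) +
        ∫ ξ, ‖h ξ‖ ^ 2 ∂gaussMeasure κ))
    simp only [norm_mul (B c j : ℂ), Complex.norm_real, Real.norm_eq_abs]
    rw [integral_const_mul]
    exact mul_le_mul_of_nonneg_left (integral_norm_coord_mul_le hmem j) (abs_nonneg _)
  have key := hasSum_integral_of_summable_integral_norm hF hs
  have e1 : ∫ ξ, ∑' j, (B c j : ℂ) * ((ξ j : ℂ) * h ξ) ∂gaussMeasure κ =
      ⟪polyVec Q, hB.pull (polyVec (q * MvPolynomial.X c))⟫_ℂ := by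
    rw [inner_polyVec]
    refine integral_congr_ae ?_
    filter_upwards [hB.coeFn_pull_polyVec (q * MvPolynomial.X c),
      ae_summable_linear (hB.summable c)] with ξ h1 h2
    rw [h1, polyFun_mul, polyFun_X]
    have : HasSum (fun j => (B c j : ℂ) * ((ξ j : ℂ) * h ξ)) ((linCoord B ξ c : ℂ) * h ξ) := by
      have := (Complex.hasSum_ofReal.2 h2.hasSum).mul_right (h ξ)
      refine this.congr_fun fun j => ?_
      push_cast; ring
    rw [this.tsum_eq, hh]
    ring
  rw [e1] at key
  refine key.congr_fun fun j => ?_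
  rw [inner_polyVec, ← integral_const_mul]
  refine integral_congr_ae ?_
  filter_upwards [hB.coeFn_pull_polyVec q] with ξ h1
  rw [h1, polyFun_mul, polyFun_X, map_mul, Complex.conj_ofReal, hh]
  ring

theorem IsRealFrame.pull_polyVec_C (hB : IsRealFrame B) (a : ℂ) :
    hB.pull (polyVec (MvPolynomial.C a)) = polyVec (MvPolynomial.C a) := by
  refine Lp.ext ?_
  filter_upwards [hB.coeFn_pull_polyVec (MvPolynomial.C a),
    coeFn_polyVec (MvPolynomial.C a : MvPolynomial κ ℂ)] with ξ h1 h2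
  rw [h1, h2]
  simp [polyFun]

/-- The chain rule `∂_i (q ∘ π) = ∑_c B_{ci} (∂_c q) ∘ π`, in weak form. -/
theorem IsRealFrame.inner_create_pull_polyVec (hB : IsRealFrame B) (i : κ)
    (q : MvPolynomial (Fin r) ℂ) (Q : MvPolynomial κ ℂ) :
    ⟪polyVec (create i Q), hB.pull (polyVec q)⟫_ℂ =
      ∑ c, (B c i : ℂ) * ⟪polyVec Q, hB.pull (polyVec (annih c q))⟫_ℂ := by
  classical
  induction q using MvPolynomial.induction_on generalizing Q with
  | C a =>
    rw [hB.pull_polyVec_C, inner_create]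
    simp [annih_apply, show polyVec (0 : MvPolynomial κ ℂ) = 0 from (polyVecₗ κ).map_zero,
      show polyVec (0 : MvPolynomial (Fin r) ℂ) = 0 from (polyVecₗ (Fin r)).map_zero]
  | add p q hp hq =>
    simp only [polyVec_add, map_add, inner_add_right, hp, hq, mul_add, Finset.sum_add_distrib]
  | mul_X q c ih =>
    -- The commutator of ξ_j with F⁺_i is δ_{ij}. Summed against B_{cj} it produces B_{ci}, the
    -- derivative of x_c ∘ π along ξ_i.
    have e1 : ∀ j, MvPolynomial.X j * create i Q = create i (MvPolynomial.X j * Q) +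
        (if j = i then (1 : ℂ) else 0) • Q := by
      intro j
      rw [create_apply, create_apply, Derivation.leibniz, MvPolynomial.pderiv_X]
      by_cases h : j = i
      · subst h; simp; ring
      · simp [h]; ring
    have hL := hB.hasSum_inner_pull_X_mul c (create i Q) q
    have hR : HasSum (fun j => ∑ c', (B c' i : ℂ) * ((B c j : ℂ) *
        ⟪polyVec (MvPolynomial.X j * Q), hB.pull (polyVec (annih c' q))⟫_ℂ))
        (∑ c', (B c' i : ℂ) * ⟪polyVec Q, hB.pull (polyVec (annih c' q * MvPolynomial.X c))⟫_ℂ) :=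
      hasSum_sum fun c' _ => (hB.hasSum_inner_pull_X_mul c Q (annih c' q)).mul_left _
    have hR2 : HasSum (fun j => (B c j : ℂ) * (if j = i then ⟪polyVec Q, hB.pull (polyVec q)⟫_ℂ
        else 0)) ((B c i : ℂ) * ⟪polyVec Q, hB.pull (polyVec q)⟫_ℂ) := by
      convert hasSum_ite_eq i ((B c i : ℂ) * ⟪polyVec Q, hB.pull (polyVec q)⟫_ℂ) using 2 with j
      by_cases h : j = i
      · subst h; simp
      · simp [h]
    have e2 := hL.unique ((hR.add hR2).congr_fun fun j => by
      rw [e1, polyVec_add, polyVec_smul, inner_add_left, ih, inner_smul_left, mul_add,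
        Finset.mul_sum]
      congr 1
      · exact Finset.sum_congr rfl fun c' _ => by ring
      · by_cases h : j = i <;> simp [h])
    rw [e2]
    have e3 : ∀ c', annih c' (q * MvPolynomial.X c) = annih c' q * MvPolynomial.X c +
        (if c' = c then (1 : ℂ) else 0) • q := by
      intro c'
      rw [annih_apply, annih_apply, Derivation.leibniz, MvPolynomial.pderiv_X]
      by_cases h : c' = c
      · subst h; simp; ring
      · simp [h]; ring
    simp only [e3, polyVec_add, polyVec_smul, map_add, map_smul, inner_add_right, inner_smul_right,
      mul_add, Finset.sum_add_distrib]
    congr 1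
    simp

/-- The chain rule on Hermite coefficients. -/
theorem IsRealFrame.hcoef_pull_add_single (hB : IsRealFrame B) {g : GaussSpace (Fin r)}
    {g' : Fin r → GaussSpace (Fin r)}
    (hg : ∀ c m, hcoef (g' c) m = hcoef g (m + Finsupp.single c 1)) (i : κ) (n : κ →₀ ℕ) :
    hcoef (hB.pull g) (n + Finsupp.single i 1) = ∑ c, (B c i : ℂ) * hcoef (hB.pull (g' c)) n := by
  have hexp : ∀ (f : GaussSpace (Fin r)) (n : κ →₀ ℕ), HasSum (fun m =>
      hcoef f m / (mfac m : ℂ) * hcoef (hB.pull (hermiteVec m)) n) (hcoef (hB.pull f) n) := by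
    intro f n
    have h := ((innerSL ℂ (hermiteVec n)).comp hB.pull.toContinuousLinearMap).hasSum
      (hasSum_hermite_expansion f)
    refine h.congr_fun fun m => ?_
    simp [hcoef]
  have h1 := hexp g (n + Finsupp.single i 1)
  refine h1.unique ?_
  -- Both vectors are expanded in Hermite polynomials of ℝ^r; the shift m ↦ m + e_c turns the
  -- coefficients of `g' c` into those of `g`, and the terms with m_c = 0 drop out.
  have h2 : HasSum (fun m => ∑ c, (B c i : ℂ) * (hcoef g m / (mfac m : ℂ) *
      ((m c : ℂ) * hcoef (hB.pull (hermiteVec (m - Finsupp.single c 1))) n)))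
      (∑ c, (B c i : ℂ) * hcoef (hB.pull (g' c)) n) := by
    refine hasSum_sum fun c _ => HasSum.mul_left _ ?_
    rw [← (add_left_injective (Finsupp.single c 1)).hasSum_iff]
    · refine (hexp (g' c) n).congr_fun fun m => ?_
      simp only [Function.comp_apply, add_tsub_cancel_right, mfac_add_single, hg]
      have h2 := mfac_ne_zero m
      have h3 : (m c : ℂ) + 1 ≠ 0 := by exact_mod_cast Nat.succ_ne_zero (m c)
      simp
      field_simp
    · intro m hm
      have : m c = 0 := by
        by_contra h
        exact hm ⟨m - Finsupp.single c 1, tsub_add_cancel_of_le (by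
          simpa [Nat.one_le_iff_ne_zero] using h)⟩
      simp [this]
  refine h2.congr_fun fun m => ?_
  have e : hcoef (hB.pull (hermiteVec m)) (n + Finsupp.single i 1) = ∑ c, (B c i : ℂ) *
      ((m c : ℂ) * hcoef (hB.pull (hermiteVec (m - Finsupp.single c 1))) n) := by
    have := hB.inner_create_pull_polyVec i (hermitePoly m) (hermitePoly n)
    rw [create_hermitePoly] at this
    simp only [annih_hermitePoly, polyVec_smul, map_smul, inner_smul_right] at this
    exact this
  rw [e, Finset.mul_sum]
  exact Finset.sum_congr rfl fun c _ => by ring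

end Pullback

/-! ### Iterated annihilators and forms of pulled back vectors -/

section AnnihSmooth

variable {κ : Type*} {r : ℕ}

/-- All iterated annihilators are defined on `f`. -/
def AnnihSmooth (f : GaussSpace κ) : Prop := ∀ J, ∃ G, IsLadder 0 J f G

theorem isLadder_zero_left {J : κ →₀ ℕ} {x G : GaussSpace κ} :
    IsLadder 0 J x G ↔ ∀ n, hcoef G n = hcoef x (n + J) := by
  simp [IsLadder, dfac_zero]

/-- The iterated annihilator `(F⁻)^J f`. -/
noncomputable def AnnihSmooth.lower {f : GaussSpace κ} (hf : AnnihSmooth f) (J : κ →₀ ℕ) :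
    GaussSpace κ := (hf J).choose

theorem AnnihSmooth.hcoef_lower {f : GaussSpace κ} (hf : AnnihSmooth f) (J n : κ →₀ ℕ) :
    hcoef (hf.lower J) n = hcoef f (n + J) :=
  isLadder_zero_left.1 (hf J).choose_spec n

theorem AnnihSmooth.annihSmooth_lower {f : GaussSpace κ} (hf : AnnihSmooth f) (J : κ →₀ ℕ) :
    AnnihSmooth (hf.lower J) := fun K =>
  ⟨hf.lower (K + J), isLadder_zero_left.2 fun n => by
    rw [hf.hcoef_lower, hf.hcoef_lower, add_assoc]⟩

/-- Coherent vectors are eigenvectors of the annihilators: shifting the multi-index by J multiplies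
the coefficient by z^J. -/
theorem annihSmooth_coherentVec (z : κ → ℂ) (hz : Summable fun i => ‖z i‖ ^ 2) :
    AnnihSmooth (coherentVec z) := fun J =>
  ⟨mpow z J • coherentVec z, isLadder_zero_left.2 fun n => by
    rw [hcoef_smul, hcoef_coherentVec z hz, hcoef_coherentVec z hz, mpow_add, mul_comm]⟩

theorem annihSmooth_hermiteVec (m : κ →₀ ℕ) : AnnihSmooth (hermiteVec m) := by
  classical
  intro J
  by_cases h : J ≤ m
  · refine ⟨((mfac m / mfac (m - J) : ℝ) : ℂ) • hermiteVec (m - J), isLadder_zero_left.2 fun n => ?_⟩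
    have h3 := mfac_ne_zero (m - J)
    rw [hcoef_smul, hcoef_hermiteVec, hcoef_hermiteVec]
    by_cases hn : n + J = m
    · subst hn
      have h3 := mfac_ne_zero n
      simp
      field_simp
    · rw [if_neg hn, if_neg, mul_zero]
      rintro rfl
      exact hn (tsub_add_cancel_of_le h)
  · refine ⟨0, isLadder_zero_left.2 fun n => ?_⟩
    rw [hcoef_hermiteVec, if_neg]
    · simp [hcoef]
    · rintro rfl
      exact h le_add_self

/-- The form `⟪(F⁻)^I g, (F⁻)^J f⟫`. -/
noncomputable def ladderForm (g f : GaussSpace κ) (I J : κ →₀ ℕ) : ℂ :=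
  ∑' n, conj (hcoef g (n + I)) * hcoef f (n + J) / (mfac n : ℂ)

theorem AnnihSmooth.inner_lower {g f : GaussSpace κ} (hg : AnnihSmooth g) (hf : AnnihSmooth f)
    (I J : κ →₀ ℕ) : ⟪hg.lower I, hf.lower J⟫_ℂ = ladderForm g f I J := by
  rw [← (hasSum_hcoef _ _).tsum_eq]
  simp only [hg.hcoef_lower, hf.hcoef_lower]
  rfl

theorem IsLadder.inner_eq {I J : κ →₀ ℕ} {x G : GaussSpace κ} (h : IsLadder I J x G)
    (y : GaussSpace κ) : ⟪y, G⟫_ℂ = ladderForm y x I J :=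
  (h.hasSum_inner y).tsum_eq.symm

variable [Countable κ] {B : Fin r → κ → ℝ}

theorem sum_fin_succ_fun {σ M : Type*} [Fintype σ] [AddCommMonoid M] {k : ℕ}
    (F : (Fin (k + 1) → σ) → M) :
    ∑ c, F c = ∑ c : Fin k → σ, ∑ c0, F (Fin.cons c0 c) := by
  rw [← (Fin.consEquiv fun _ : Fin (k + 1) => σ).sum_comp, Fintype.sum_prod_type_right]
  rfl

/-- The chain rule iterated: each annihilator index on κ is contracted with B into an index on ℝ^r.
-/
theorem IsRealFrame.hcoef_pull_add_fidx (hB : IsRealFrame B) {f : GaussSpace (Fin r)}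
    (hf : AnnihSmooth f) {k : ℕ} (i : Fin k → κ) (n : κ →₀ ℕ) :
    hcoef (hB.pull f) (n + fidx i) =
      ∑ c : Fin k → Fin r, (∏ a, (B (c a) (i a) : ℂ)) * hcoef (hB.pull (hf.lower (fidx c))) n := by
  induction k generalizing n with
  | zero =>
    have e : hf.lower 0 = f := hcoef_ext fun n => by rw [hf.hcoef_lower, add_zero]
    simp [fidx, e]
  | succ k ih =>
    have e1 : n + fidx i = n + Finsupp.single (i 0) 1 + fidx (fun a => i a.succ) := by
      rw [fidx, Fin.sum_univ_succ, ← add_assoc, fidx]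
    rw [e1, ih, sum_fin_succ_fun]
    refine Finset.sum_congr rfl fun c _ => ?_
    rw [hB.hcoef_pull_add_single (g' := fun c0 => hf.lower (fidx (Fin.cons c0 c : Fin (k + 1) → Fin r)))
      (fun c0 m => ?_), Finset.mul_sum]
    · refine Finset.sum_congr rfl fun c0 _ => ?_
      rw [Fin.prod_univ_succ]
      simp only [Fin.cons_zero, Fin.cons_succ]
      ring
    · rw [hf.hcoef_lower, hf.hcoef_lower, fidx, Fin.sum_univ_succ, fidx, add_assoc]
      simp

/-- The forms of the ladder operators on `κ` between pulled back vectors. -/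
theorem IsRealFrame.hasSum_ladderForm_pull (hB : IsRealFrame B) {g f : GaussSpace (Fin r)}
    (hg : AnnihSmooth g) (hf : AnnihSmooth f) {k l : ℕ} (i : Fin k → κ) (j : Fin l → κ) :
    HasSum (fun n => conj (hcoef (hB.pull g) (n + fidx i)) * hcoef (hB.pull f) (n + fidx j) /
      (mfac n : ℂ)) (∑ c : Fin k → Fin r, ∑ c' : Fin l → Fin r,
        ((∏ a, (B (c a) (i a) : ℂ)) * ∏ a, (B (c' a) (j a) : ℂ)) *
          ladderForm g f (fidx c) (fidx c')) := by
  have h : HasSum (fun n => ∑ c : Fin k → Fin r, ∑ c' : Fin l → Fin r,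
      ((∏ a, (B (c a) (i a) : ℂ)) * ∏ a, (B (c' a) (j a) : ℂ)) *
      (conj (hcoef (hB.pull (hg.lower (fidx c))) n) * hcoef (hB.pull (hf.lower (fidx c'))) n /
        (mfac n : ℂ))) (∑ c : Fin k → Fin r, ∑ c' : Fin l → Fin r,
        ((∏ a, (B (c a) (i a) : ℂ)) * ∏ a, (B (c' a) (j a) : ℂ)) *
          ladderForm g f (fidx c) (fidx c')) := by
    refine hasSum_sum fun c _ => hasSum_sum fun c' _ => HasSum.mul_left _ ?_
    rw [← hg.inner_lower hf, ← hB.pull.inner_map_map]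
    exact hasSum_hcoef _ _
  refine h.congr_fun fun n => ?_
  rw [hB.hcoef_pull_add_fidx hg, hB.hcoef_pull_add_fidx hf, map_sum, Finset.sum_mul_sum,
    Finset.sum_div]
  refine Finset.sum_congr rfl fun c _ => ?_
  rw [Finset.sum_div]
  refine Finset.sum_congr rfl fun c' _ => ?_
  rw [map_mul, map_prod]
  simp only [Complex.conj_ofReal]
  ring

end AnnihSmooth

/-! ### Pulled back vectors belong to 𝒢^∞ -/

section Weights

variable {ι H : Type*} [NormedAddCommGroup H] [InnerProductSpace ℂ H]

namespace SobolevScale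

variable (S : SobolevScale ι H)

theorem weight_nonneg (n : ι →₀ ℕ) : 0 ≤ S.weight n :=
  (Nat.cast_nonneg n.degree).trans (S.degree_le_weight n)

theorem weight_add_single (n : ι →₀ ℕ) (i : ι) :
    S.weight (n + Finsupp.single i 1) = S.weight n + (1 + S.ev i) := by
  classical
  rw [weight, Finsupp.sum_add_index' (by simp) (by intros; push_cast; ring),
    Finsupp.sum_single_index (by simp)]
  simp [weight]

theorem ofReal_weight (n : ι →₀ ℕ) :
    ENNReal.ofReal (S.weight n) = ∑' i, ENNReal.ofReal ((n i : ℝ) * (1 + S.ev i)) := by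
  have h : ∀ i, 0 ≤ (n i : ℝ) * (1 + S.ev i) := fun i => by
    have := S.ev_nonneg i; positivity
  rw [weight, Finsupp.sum, ENNReal.ofReal_sum_of_nonneg fun i _ => h i]
  refine (tsum_eq_sum fun i hi => ?_).symm
  rw [Finsupp.notMem_support_iff.1 hi]
  simp

variable [Countable ι] {r : ℕ} {B : Fin r → ι → ℝ}

/-- The squared Sobolev-Fock norms. -/
noncomputable def fockEnergy (s : ℕ) (x : GaussSpace ι) : ENNReal :=
  ∑' n, ENNReal.ofReal ((1 + S.weight n) ^ s * (‖hcoef x n‖ ^ 2 / mfac n))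

/-- Induction on s, for all f at once. One factor of the weight is ∑ n_i (1 + λ_i); the factor n_i
is absorbed by the shift to n + e_i, where the chain rule leaves the energies of order s of the
vectors ∂_c f. The sum over i converges because the rows of B decay rapidly. In [0, ∞] all
interchanges of sums are free. -/
theorem fockEnergy_pull_lt_top (hB : IsRealFrame B)
    (hBs : ∀ (s : ℕ) c, Summable fun i => (1 + S.ev i) ^ s * B c i ^ 2) (s : ℕ)
    {f : GaussSpace (Fin r)} (hf : AnnihSmooth f) : S.fockEnergy s (hB.pull f) < ⊤ := by
  induction s generalizing f with
  | zero =>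
    have h := hasSum_norm_sq_hcoef (hB.pull f)
    have e : S.fockEnergy 0 (hB.pull f) = ENNReal.ofReal (‖hB.pull f‖ ^ 2) := by
      rw [← h.tsum_eq, ENNReal.ofReal_tsum_of_nonneg _ h.summable]
      · simp [fockEnergy]
      · intro n; have := mfac_pos n; positivity
    rw [e]
    exact ENNReal.ofReal_lt_top
  | succ s ih =>
    set x := hB.pull f
    set D : Fin r → GaussSpace (Fin r) := fun c => hf.lower (Finsupp.single c 1)
    have hE : ∀ c, S.fockEnergy s (hB.pull (D c)) < ⊤ := fun c => ih (hf.annihSmooth_lower _)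
    have hterm : ∀ n, 0 ≤ (1 + S.weight n) ^ s * (‖hcoef x n‖ ^ 2 / mfac n) := fun n => by
      have := mfac_pos n; have := S.weight_nonneg n; positivity
    have e1 : S.fockEnergy (s + 1) x = S.fockEnergy s x + ∑' i, ∑' n : ι →₀ ℕ,
        ENNReal.ofReal ((n i : ℝ) * (1 + S.ev i)) *
          ENNReal.ofReal ((1 + S.weight n) ^ s * (‖hcoef x n‖ ^ 2 / mfac n)) := by
      rw [ENNReal.tsum_comm]
      simp only [ENNReal.tsum_mul_right, ← ofReal_weight]
      rw [fockEnergy, fockEnergy, ← ENNReal.tsum_add]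
      refine tsum_congr fun n => ?_
      rw [← ENNReal.ofReal_mul (S.weight_nonneg n), ← ENNReal.ofReal_add (hterm n)
        (mul_nonneg (S.weight_nonneg n) (hterm n))]
      congr 1
      ring
    rw [e1]
    refine ENNReal.add_lt_top.2 ⟨ih hf, ?_⟩
    have e2 : ∀ i, ∑' n : ι →₀ ℕ, ENNReal.ofReal ((n i : ℝ) * (1 + S.ev i)) *
          ENNReal.ofReal ((1 + S.weight n) ^ s * (‖hcoef x n‖ ^ 2 / mfac n)) ≤
        ENNReal.ofReal (∑ c, 2 ^ s * ((1 + S.ev i) ^ (s + 1) * B c i ^ 2)) *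
          ∑ c, S.fockEnergy s (hB.pull (D c)) := by
      intro i
      have hev := S.one_le_one_add_ev i
      rw [← (add_left_injective (Finsupp.single i 1)).tsum_eq]
      · have e3 : ∑ c, S.fockEnergy s (hB.pull (D c)) = ∑' n, ∑ c, ENNReal.ofReal
            ((1 + S.weight n) ^ s * (‖hcoef (hB.pull (D c)) n‖ ^ 2 / mfac n)) :=
          (Summable.tsum_finsetSum fun c _ => ENNReal.summable).symm
        rw [e3, ← ENNReal.tsum_mul_left]
        refine ENNReal.tsum_le_tsum fun n => ?_
        have hw := S.weight_nonneg n
        have hm := mfac_pos n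
        rw [← ENNReal.ofReal_sum_of_nonneg (fun c _ => by positivity),
          ← ENNReal.ofReal_mul (by positivity), ← ENNReal.ofReal_mul (by positivity)]
        refine ENNReal.ofReal_le_ofReal ?_
        rw [S.weight_add_single, mfac_add_single,
          hB.hcoef_pull_add_single (g' := D) (fun c m => hf.hcoef_lower _ _)]
        -- Cauchy–Schwarz over the r coordinates separates the dependence on i from that on n.
        have cs : ‖∑ c, (B c i : ℂ) * hcoef (hB.pull (D c)) n‖ ^ 2 ≤
            (∑ c, B c i ^ 2) * ∑ c, ‖hcoef (hB.pull (D c)) n‖ ^ 2 := by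
          have h1 : ‖∑ c, (B c i : ℂ) * hcoef (hB.pull (D c)) n‖ ≤
              ∑ c, |B c i| * ‖hcoef (hB.pull (D c)) n‖ :=
            (norm_sum_le _ _).trans (le_of_eq (Finset.sum_congr rfl fun c _ => by
              rw [norm_mul, Complex.norm_real, Real.norm_eq_abs]))
          refine (pow_le_pow_left₀ (norm_nonneg _) h1 2).trans ?_
          have := Finset.sum_mul_sq_le_sq_mul_sq Finset.univ (fun c => |B c i|)
            fun c => ‖hcoef (hB.pull (D c)) n‖
          simpa only [sq_abs] using this
        -- Raising mode i increases the weight by 1 + λ_i ≥ 1, hence multiplies 1 + weight by at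
        -- most 2(1 + λ_i).
        have hw2 : (1 + (S.weight n + (1 + S.ev i))) ^ s ≤
            (2 * (1 + S.ev i)) ^ s * (1 + S.weight n) ^ s := by
          rw [← mul_pow]
          refine pow_le_pow_left₀ (by positivity) ?_ s
          nlinarith
        have hni : (0 : ℝ) < n i + 1 := by positivity
        calc (((n + Finsupp.single i 1 : ι →₀ ℕ) i : ℕ) : ℝ) * (1 + S.ev i) *
              ((1 + (S.weight n + (1 + S.ev i))) ^ s *
              (‖∑ c, (B c i : ℂ) * hcoef (hB.pull (D c)) n‖ ^ 2 / ((n i + 1) * mfac n)))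
            = (1 + S.ev i) * ((1 + (S.weight n + (1 + S.ev i))) ^ s *
              (‖∑ c, (B c i : ℂ) * hcoef (hB.pull (D c)) n‖ ^ 2 / mfac n)) := by
              simp
              field_simp
          _ ≤ (1 + S.ev i) * (((2 * (1 + S.ev i)) ^ s * (1 + S.weight n) ^ s) *
              (((∑ c, B c i ^ 2) * ∑ c, ‖hcoef (hB.pull (D c)) n‖ ^ 2) / mfac n)) := by
              gcongr
          _ = (∑ c, 2 ^ s * ((1 + S.ev i) ^ (s + 1) * B c i ^ 2)) *
              ∑ c, (1 + S.weight n) ^ s * (‖hcoef (hB.pull (D c)) n‖ ^ 2 / mfac n) := by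
              rw [← Finset.mul_sum, ← Finset.mul_sum, ← Finset.mul_sum, ← Finset.sum_div, mul_pow,
                pow_succ]
              ring
      · intro n hn
        by_contra h
        refine hn ?_
        have : n i = 0 := by
          by_contra h0
          exact h ⟨n - Finsupp.single i 1, tsub_add_cancel_of_le (by
            simpa [Nat.one_le_iff_ne_zero] using h0)⟩
        simp [this]
    refine (ENNReal.tsum_le_tsum e2).trans_lt ?_
    rw [ENNReal.tsum_mul_right]
    refine ENNReal.mul_lt_top ?_ (ENNReal.sum_lt_top.2 fun c _ => hE c)
    have hs : Summable fun i => ∑ c, 2 ^ s * ((1 + S.ev i) ^ (s + 1) * B c i ^ 2) :=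
      summable_sum fun c _ => (hBs (s + 1) c).mul_left _
    rw [← ENNReal.ofReal_tsum_of_nonneg (fun i => Finset.sum_nonneg fun c _ => by
      have := S.one_le_one_add_ev i; positivity) hs]
    exact ENNReal.ofReal_lt_top

theorem pull_mem_smoothFock (hB : IsRealFrame B)
    (hBs : ∀ (s : ℕ) c, Summable fun i => (1 + S.ev i) ^ s * B c i ^ 2)
    {f : GaussSpace (Fin r)} (hf : AnnihSmooth f) : hB.pull f ∈ S.smoothFock := by
  rw [mem_smoothFock]
  intro s
  have h := (S.fockEnergy_pull_lt_top hB hBs (2 * s) hf).ne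
  have h2 := ENNReal.summable_toReal h
  refine Summable.of_nonneg_of_le (fun n => ?_) (fun n => ?_) h2
  · have := mfac_pos n
    have := S.weight_nonneg n
    positivity
  · have := mfac_pos n
    have hw := S.weight_nonneg n
    rw [ENNReal.toReal_ofReal (by positivity)]
    gcongr
    linarith

end SobolevScale

end Weights

/-! ### Totality of the coherent vectors over ℝ^r -/

section CoherentDensity

variable {r : ℕ}

theorem eq_zero_of_hasSum_pow_mul {q : ℕ → ℂ} (h : ∀ t : ℂ, HasSum (fun k => t ^ k * q k) 0)
    (k : ℕ) : q k = 0 := by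
  have hp : HasFPowerSeriesAt (0 : ℂ → ℂ) (FormalMultilinearSeries.ofScalars ℂ q) 0 := by
    rw [hasFPowerSeriesAt_iff]
    refine Eventually.of_forall fun t => ?_
    simpa [FormalMultilinearSeries.coeff_ofScalars] using h t
  rw [← FormalMultilinearSeries.coeff_ofScalars (𝕜 := ℂ) (p := q), hp.eq_zero]
  rfl

theorem mpow_mul {κ R : Type*} [CommMonoid R] (t : R) (z : κ → R) (n : κ →₀ ℕ) :
    mpow (fun i => t * z i) n = t ^ n.degree * mpow z n := by
  simp only [mpow, Finsupp.prod, mul_pow, Finset.prod_mul_distrib, Finset.prod_pow_eq_pow_sum]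
  rfl

/-- The coherent vectors are total. -/
theorem eq_zero_of_inner_coherentVec {g : GaussSpace (Fin r)}
    (h : ∀ z : Fin r → ℂ, ⟪coherentVec z, g⟫_ℂ = 0) : g = 0 := by
  classical
  have hz : ∀ z : Fin r → ℂ, Summable fun i => ‖z i‖ ^ 2 := fun z => Summable.of_finite
  have hsum : ∀ z : Fin r → ℂ, HasSum (fun n => mpow z n * (hcoef g n / (mfac n : ℂ))) 0 := by
    intro z
    have h1 := hasSum_hcoef (coherentVec fun i => conj (z i)) g
    rw [h] at h1
    refine h1.congr_fun fun n => ?_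
    rw [hcoef_coherentVec _ (hz _)]
    simp [mpow, Finsupp.prod, mul_div_assoc]
  -- Replacing z by tz gives a power series in t that vanishes identically, so every homogeneous
  -- component vanishes.
  have hq : ∀ (z : Fin r → ℂ) (k : ℕ),
      ∑' n : (Finsupp.degree ⁻¹' {k} : Set (Fin r →₀ ℕ)),
        mpow z n * (hcoef g n / (mfac (n : Fin r →₀ ℕ) : ℂ)) = 0 := by
    intro z
    refine eq_zero_of_hasSum_pow_mul fun t => ?_
    have h1 := (hsum fun i => t * z i).tsum_fiberwise Finsupp.degree
    refine h1.congr_fun fun k => ?_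
    rw [← tsum_mul_left]
    refine tsum_congr fun n => ?_
    have : (n : Fin r →₀ ℕ).degree = k := n.2
    rw [mpow_mul, this, mul_assoc]
  refine hcoef_ext fun n => ?_
  have hfin : (Finsupp.degree ⁻¹' {n.degree} : Set (Fin r →₀ ℕ)).Finite :=
    (Finsupp.finite_of_degree_le n.degree).subset fun m hm => le_of_eq hm
  -- There are finitely many multi-indices of a given degree, so the component is a polynomial;
  -- vanishing everywhere, it has zero coefficients.
  set P : MvPolynomial (Fin r) ℂ := ∑ m ∈ hfin.toFinset,
    MvPolynomial.monomial m (hcoef g m / (mfac m : ℂ)) with hP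
  have hP0 : P = 0 := by
    refine MvPolynomial.funext fun z => ?_
    rw [map_zero, ← hq z n.degree, hP, map_sum]
    have : Fintype (Finsupp.degree ⁻¹' {n.degree} : Set (Fin r →₀ ℕ)) := hfin.fintype
    rw [tsum_fintype, Finset.sum_subtype hfin.toFinset
      (p := (· ∈ (Finsupp.degree ⁻¹' {n.degree} : Set (Fin r →₀ ℕ)))) (fun x => by simp)]
    refine Finset.sum_congr rfl fun m _ => ?_
    rw [MvPolynomial.eval_monomial, mul_comm]
    rfl
  have := congrArg (MvPolynomial.coeff n) hP0
  rw [hP, MvPolynomial.coeff_sum, Finset.sum_eq_single n] at this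
  · rw [MvPolynomial.coeff_monomial, if_pos rfl, MvPolynomial.coeff_zero, div_eq_zero_iff] at this
    rw [this.resolve_right (mfac_ne_zero n)]
    simp [hcoef]
  · intro m _ hm
    rw [MvPolynomial.coeff_monomial, if_neg hm]
  · intro hn
    simp at hn

end CoherentDensity

/-! ### The quantized projector and its range -/

section QuantizedProjector

variable {ι H : Type*} [NormedAddCommGroup H] [InnerProductSpace ℂ H]

namespace SobolevScale

variable (S : SobolevScale ι H)

theorem summable_norm_sq_inner (α : H) : Summable fun i => ‖⟪S.e i, α⟫_ℂ‖ ^ 2 := by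
  have h := (S.e.hasSum_inner_mul_inner α α).summable.norm
  refine h.congr fun i => ?_
  rw [norm_mul, norm_inner_symm, sq]

theorem coherent_eq (α : H) : S.coherent α = coherentVec fun i => ⟪S.e i, α⟫_ℂ := rfl

theorem hcoef_coherent (α : H) (n : ι →₀ ℕ) :
    hcoef (S.coherent α) n = mpow (fun i => ⟪S.e i, α⟫_ℂ) n :=
  hcoef_coherentVec _ (S.summable_norm_sq_inner α) n

theorem inner_coherent (α β : H) :
    ⟪S.coherent α, S.coherent β⟫_ℂ = Complex.exp ⟪α, β⟫_ℂ := by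
  rw [coherent_eq, coherent_eq, inner_coherentVec _ _ (S.summable_norm_sq_inner α)
    (S.summable_norm_sq_inner β), ← S.e.tsum_inner_mul_inner α β]
  simp only [inner_conj_symm]

/-- For β in K the number ⟪F_β, F_α⟫ = exp ⟪β, α⟫ depends on α only through its projection to K, so
the difference of the two coherent functionals is orthogonal to the span. -/
theorem quantizedProj_coherent (K : Submodule ℂ H) [K.HasOrthogonalProjection] (α : H) :
    S.quantizedProj K (S.coherent α) = S.coherent (K.starProjection α) := by
  refine Submodule.eq_starProjection_of_mem_orthogonal
    (Submodule.le_topologicalClosure _ (Submodule.subset_span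
      ⟨_, Submodule.starProjection_apply_mem K α, rfl⟩)) ?_
  rw [Submodule.orthogonal_closure, Submodule.mem_orthogonal]
  intro u hu
  induction hu using Submodule.span_induction with
  | mem u h =>
    obtain ⟨β, hβ, rfl⟩ := h
    rw [inner_sub_right, inner_coherent, inner_coherent,
      ← Submodule.inner_starProjection_left_eq_right,
      Submodule.starProjection_eq_self_iff.2 hβ, sub_self]
  | zero => simp
  | add x y _ _ hx hy => rw [inner_add_left, hx, hy, add_zero]
  | smul a x _ hx => rw [inner_smul_left, hx, mul_zero]

/-- Polarization: an additive isometry preserves real parts of inner products; replacing x by ix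
gives the imaginary part, with the sign due to antilinearity. -/
theorem inner_conjugation (x y : H) :
    ⟪S.conjugation x, S.conjugation y⟫_ℂ = conj ⟪x, y⟫_ℂ := by
  have hre : ∀ x y : H, (⟪S.conjugation x, S.conjugation y⟫_ℂ).re = (⟪x, y⟫_ℂ).re := by
    intro x y
    have h1 := norm_add_sq (𝕜 := ℂ) x y
    have h2 := norm_add_sq (𝕜 := ℂ) (S.conjugation x) (S.conjugation y)
    rw [← map_add, LinearIsometryEquiv.norm_map, LinearIsometryEquiv.norm_map,
      LinearIsometryEquiv.norm_map, h1] at h2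
    simp only [RCLike.re_to_complex] at h2
    linarith
  refine Complex.ext ?_ ?_
  · rw [hre, Complex.conj_re]
  · have h := hre (Complex.I • x) y
    rw [LinearIsometryEquiv.map_smulₛₗ, inner_smul_left, inner_smul_left] at h
    simp at h
    rw [Complex.conj_im]
    linarith

theorem inner_e_of_real {φ : H} (hφ : S.conjugation φ = φ) (i : ι) :
    ((⟪S.e i, φ⟫_ℂ).re : ℂ) = ⟪S.e i, φ⟫_ℂ := by
  have h := S.inner_conjugation (S.e i) φ
  rw [S.conjugation_e, hφ] at h
  exact (Complex.conj_eq_iff_re.1 h.symm)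

variable {r : ℕ}

/-- The real coefficients of `b` in the eigenbasis. -/
noncomputable def realCoeff (b : Fin r → H) (c : Fin r) (i : ι) : ℝ := (⟪S.e i, b c⟫_ℂ).re

variable {S} {K : Submodule ℂ H} {b : Fin r → H}

theorem IsRealBasis.coe_realCoeff (hb : S.IsRealBasis K b) (c : Fin r) (i : ι) :
    (S.realCoeff b c i : ℂ) = ⟪S.e i, b c⟫_ℂ := S.inner_e_of_real (hb.2.2 c) i

theorem IsRealBasis.mem (hb : S.IsRealBasis K b) (c : Fin r) : b c ∈ K := by
  rw [← hb.2.1]; exact Submodule.subset_span ⟨c, rfl⟩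

theorem summable_realCoeff (hK : ∀ φ ∈ K, φ ∈ S.smooth) (hb : S.IsRealBasis K b) (s : ℕ)
    (c : Fin r) : Summable fun i => (1 + S.ev i) ^ s * S.realCoeff b c i ^ 2 := by
  refine (hK _ (hb.mem c) s).congr fun i => ?_
  rw [← hb.coe_realCoeff, Complex.norm_real, Real.norm_eq_abs, sq_abs]

theorem IsRealBasis.isRealFrame (hK : ∀ φ ∈ K, φ ∈ S.smooth) (hb : S.IsRealBasis K b) :
    IsRealFrame (S.realCoeff b) where
  summable c := by
    obtain ⟨s, hs⟩ := S.summable_inv_pow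
    refine Summable.of_nonneg_of_le (fun _ => abs_nonneg _) (fun i => ?_)
      (hs.add (summable_realCoeff hK hb s c))
    have hp : 0 < (1 + S.ev i) ^ s := by
      have := S.one_le_one_add_ev i
      positivity
    rw [← sq_abs (S.realCoeff b c i)]
    generalize |S.realCoeff b c i| = x
    generalize (1 + S.ev i) ^ s = y at hp
    -- Completing the square gives 2x ≤ 1/y + yx² with y = (1 + λ_i)^s: the trace condition upgrades
    -- weighted square summability to absolute summability.
    have h1 : 0 ≤ y⁻¹ * (1 - y * x) ^ 2 := by positivity
    have h2 : y⁻¹ * (1 - y * x) ^ 2 = y⁻¹ + y * x ^ 2 - 2 * x := by field_simp; ring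
    have h3 : 0 ≤ y⁻¹ := by positivity
    have h4 : 0 ≤ y * x ^ 2 := by positivity
    linarith
  orthonormal c c' := by
    have h := S.e.hasSum_inner_mul_inner (b c) (b c')
    rw [(orthonormal_iff_ite.1 hb.1) c c'] at h
    refine Complex.hasSum_ofReal.1 ?_
    have e : (((if c = c' then 1 else 0 : ℝ) : ℝ) : ℂ) = if c = c' then 1 else 0 := by
      split_ifs <;> simp
    rw [e]
    refine h.congr_fun fun i => ?_
    rw [← inner_conj_symm (b c), ← hb.coe_realCoeff, ← hb.coe_realCoeff, Complex.conj_ofReal]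
    push_cast; rfl

/-- Coherent vectors over `ℝ^r` are pulled back to coherent functionals. -/
theorem IsRealBasis.pull_coherentVec [Countable ι] (hb : S.IsRealBasis K b)
    (hB : IsRealFrame (S.realCoeff b)) (z : Fin r → ℂ) :
    hB.pull (coherentVec z) = S.coherent (∑ c, z c • b c) := by
  have hz : Summable fun i => ‖z i‖ ^ 2 := Summable.of_finite
  refine hcoef_ext fun n => ?_
  rw [hcoef_coherent]
  -- Both sides have vacuum coefficient 1 and satisfy the same eigenvalue recursion under every
  -- annihilator, which determines all coefficients.
  induction n using multiIndex_induction with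
  | h0 =>
    have h1 : hcoef (hB.pull (coherentVec z)) 0 = hcoef (coherentVec z) 0 := by
      have : hermiteVec (0 : ι →₀ ℕ) = hB.pull (hermiteVec (0 : Fin r →₀ ℕ)) := by
        rw [← polyVec_hermitePoly, ← polyVec_hermitePoly, hermitePoly_zero, hermitePoly_zero,
          ← map_one MvPolynomial.C, ← map_one MvPolynomial.C, hB.pull_polyVec_C]
      rw [hcoef, this, LinearIsometry.inner_map_map, hcoef]
    rw [h1, hcoef_coherentVec z hz, mpow_zero, mpow_zero]
  | hs i n ih =>
    rw [hB.hcoef_pull_add_single (g' := fun c => z c • coherentVec z) (fun c m => by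
      rw [hcoef_smul, hcoef_coherentVec z hz, hcoef_coherentVec z hz, mpow_add, mpow_single,
        mul_comm])]
    simp only [map_smul, hcoef_smul, ih]
    rw [mpow_add, mpow_single, inner_sum, mul_comm, Finset.sum_mul]
    refine Finset.sum_congr rfl fun c _ => ?_
    rw [inner_smul_right, hb.coe_realCoeff]
    ring

theorem IsRealBasis.starProjection_eq [K.HasOrthogonalProjection] (hb : S.IsRealBasis K b) (α : H) :
    K.starProjection α = ∑ c, ⟪b c, α⟫_ℂ • b c := by
  refine Submodule.eq_starProjection_of_mem_orthogonal
    (Submodule.sum_mem _ fun c _ => Submodule.smul_mem _ _ (hb.mem c)) ?_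
  rw [← hb.2.1, Submodule.mem_orthogonal]
  intro u hu
  induction hu using Submodule.span_induction with
  | mem u h =>
    obtain ⟨c, rfl⟩ := h
    rw [inner_sub_right, hb.1.inner_right_fintype, sub_self]
  | zero => simp
  | add x y _ _ hx hy => rw [inner_add_left, hx, hy, add_zero]
  | smul a x _ hx => rw [inner_smul_left, hx, mul_zero]

theorem IsRealBasis.exists_coord (hb : S.IsRealBasis K b) {α : H} (hα : α ∈ K) :
    ∃ z : Fin r → ℂ, α = ∑ c, z c • b c := by
  rw [← hb.2.1] at hα
  obtain ⟨z, hz⟩ := (Submodule.mem_span_range_iff_exists_fun ℂ).1 hα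
  exact ⟨z, hz.symm⟩

/-- The range of the quantized projector is the space of functions of the coordinates. -/
theorem IsRealBasis.quantizedProj_eq_self_iff [Countable ι] (hb : S.IsRealBasis K b)
    (hB : IsRealFrame (S.realCoeff b)) (F : GaussSpace ι) :
    S.quantizedProj K F = F ↔ ∃ f, hB.pull f = F := by
  have himg : S.coherent '' (K : Set H) = hB.pull.toLinearMap '' (Set.range coherentVec) := by
    ext x
    constructor
    · rintro ⟨α, hα, rfl⟩
      obtain ⟨z, rfl⟩ := hb.exists_coord hα
      exact ⟨_, ⟨z, rfl⟩, hb.pull_coherentVec hB z⟩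
    · rintro ⟨_, ⟨z, rfl⟩, rfl⟩
      exact ⟨_, Submodule.sum_mem _ fun c _ => Submodule.smul_mem _ _ (hb.mem c),
        (hb.pull_coherentVec hB z).symm⟩
  rw [quantizedProj, Submodule.starProjection_eq_self_iff]
  constructor
  · intro hF
    -- The range of an isometry on a complete space is closed, so it contains the closed span of the
    -- coherent functionals that it contains.
    have hcl : IsClosed (hB.pull.toLinearMap.range : Set (GaussSpace ι)) := by
      have := hB.pull.isometry.isClosedEmbedding.isClosed_range
      simpa [LinearMap.coe_range] using this
    have := Submodule.topologicalClosure_minimal _ (t := hB.pull.toLinearMap.range) (by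
      rw [himg, Submodule.span_image]
      exact LinearMap.map_le_range) hcl hF
    exact this
  · rintro ⟨f, rfl⟩
    have htop : (Submodule.span ℂ (Set.range (coherentVec (κ := Fin r)))).topologicalClosure = ⊤ := by
      rw [Submodule.topologicalClosure_eq_top_iff, Submodule.eq_bot_iff]
      intro g hg
      rw [Submodule.mem_orthogonal] at hg
      exact eq_zero_of_inner_coherentVec fun z => hg _ (Submodule.subset_span ⟨z, rfl⟩)
    have hf : f ∈ (Submodule.span ℂ (Set.range (coherentVec (κ := Fin r)))).topologicalClosure := by
      rw [htop]; trivial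
    have := (Submodule.span ℂ (Set.range (coherentVec (κ := Fin r)))).topologicalClosure_map
      hB.pull.toContinuousLinearMap (Submodule.mem_map_of_mem hf)
    rw [himg, Submodule.span_image]
    exact this

end SobolevScale

end QuantizedProjector

/-! ### Polynomials in (z̄, z) as linear data -/

section Pairing

variable {r : ℕ}

/-- The left half of a multi-index. -/
noncomputable def leftIdx (m : Fin r ⊕ Fin r →₀ ℕ) : Fin r →₀ ℕ :=
  (Finsupp.sumFinsuppEquivProdFinsupp m).1

/-- The right half of a multi-index. -/
noncomputable def rightIdx (m : Fin r ⊕ Fin r →₀ ℕ) : Fin r →₀ ℕ :=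
  (Finsupp.sumFinsuppEquivProdFinsupp m).2

theorem leftIdx_apply (m : Fin r ⊕ Fin r →₀ ℕ) (j : Fin r) : leftIdx m j = m (Sum.inl j) :=
  Finsupp.fst_sumFinsuppEquivProdFinsupp m j

theorem rightIdx_apply (m : Fin r ⊕ Fin r →₀ ℕ) (j : Fin r) : rightIdx m j = m (Sum.inr j) :=
  Finsupp.snd_sumFinsuppEquivProdFinsupp m j

theorem leftIdx_sumElim (I J : Fin r →₀ ℕ) : leftIdx (Finsupp.sumElim I J) = I := by
  ext j; rw [leftIdx_apply, Finsupp.sumElim_inl]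

theorem rightIdx_sumElim (I J : Fin r →₀ ℕ) : rightIdx (Finsupp.sumElim I J) = J := by
  ext j; rw [rightIdx_apply, Finsupp.sumElim_inr]

/-- The linear functional on polynomials in `(z̄, z)` with the value `Φ I J` on `z̄^I z^J`. -/
noncomputable def pairing (Φ : (Fin r →₀ ℕ) → (Fin r →₀ ℕ) → ℂ) :
    MvPolynomial (Fin r ⊕ Fin r) ℂ →ₗ[ℂ] ℂ :=
  (MvPolynomial.basisMonomials (Fin r ⊕ Fin r) ℂ).constr ℂ fun m => Φ (leftIdx m) (rightIdx m)

theorem pairing_monomial (Φ : (Fin r →₀ ℕ) → (Fin r →₀ ℕ) → ℂ) (m : Fin r ⊕ Fin r →₀ ℕ) (a : ℂ) :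
    pairing Φ (MvPolynomial.monomial m a) = a * Φ (leftIdx m) (rightIdx m) := by
  have h := (MvPolynomial.basisMonomials (Fin r ⊕ Fin r) ℂ).constr_basis ℂ
    (fun m => Φ (leftIdx m) (rightIdx m)) m
  rw [MvPolynomial.coe_basisMonomials] at h
  have e : MvPolynomial.monomial m a = a • MvPolynomial.monomial m (1 : ℂ) := by
    rw [MvPolynomial.smul_monomial, smul_eq_mul, mul_one]
  rw [e, map_smul, smul_eq_mul]
  exact congrArg (a * ·) h

theorem pairing_eq_sum (Φ : (Fin r →₀ ℕ) → (Fin r →₀ ℕ) → ℂ)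
    (w : MvPolynomial (Fin r ⊕ Fin r) ℂ) :
    pairing Φ w = ∑ m ∈ w.support, w.coeff m * Φ (leftIdx m) (rightIdx m) := by
  conv_lhs => rw [← MvPolynomial.support_sum_monomial_coeff w]
  rw [map_sum]
  exact Finset.sum_congr rfl fun m _ => pairing_monomial _ _ _

/-- Evaluation is one instance of `pairing`; with ladder forms in place of monomials the same
functional yields matrix elements. -/
theorem eval_eq_pairing (u v : Fin r → ℂ) (w : MvPolynomial (Fin r ⊕ Fin r) ℂ) :
    MvPolynomial.eval (Sum.elim u v) w = pairing (fun I J => mpow u I * mpow v J) w := by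
  conv_lhs => rw [← MvPolynomial.support_sum_monomial_coeff w]
  rw [map_sum, pairing_eq_sum]
  refine Finset.sum_congr rfl fun m _ => ?_
  rw [MvPolynomial.eval_monomial, mpow, mpow, Finsupp.prod_fintype _ _ (by simp),
    Finsupp.prod_fintype _ _ (by simp), Finsupp.prod_fintype _ _ (by simp), Fintype.prod_sum_type]
  simp only [leftIdx_apply, rightIdx_apply, Sum.elim_inl, Sum.elim_inr]

/-- A polynomial in `(z̄, z)` is determined by its values at conjugate arguments. -/
theorem eq_of_eval_conj {p q : MvPolynomial (Fin r ⊕ Fin r) ℂ}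
    (h : ∀ z : Fin r → ℂ, MvPolynomial.eval (Sum.elim (fun j => conj (z j)) z) p =
      MvPolynomial.eval (Sum.elim (fun j => conj (z j)) z) q) : p = q := by
  -- The linear change of variables z̄ = x - iy, z = x + iy. Real x and y give conjugate arguments,
  -- and a polynomial is determined by its values at real points.
  set s : Fin r ⊕ Fin r → MvPolynomial (Fin r ⊕ Fin r) ℂ :=
    Sum.elim (fun j => .X (.inl j) - .C Complex.I * .X (.inr j))
      (fun j => .X (.inl j) + .C Complex.I * .X (.inr j)) with hs
  have hev : ∀ (x : Fin r ⊕ Fin r → ℂ) (p : MvPolynomial (Fin r ⊕ Fin r) ℂ),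
      MvPolynomial.eval x (MvPolynomial.bind₁ s p) =
      MvPolynomial.eval (Sum.elim (fun j => x (.inl j) - Complex.I * x (.inr j))
        (fun j => x (.inl j) + Complex.I * x (.inr j))) p := by
    intro x p
    rw [MvPolynomial.eval, MvPolynomial.eval₂Hom_bind₁]
    congr 2
    ext (j | j) <;> simp [hs]
  have key : MvPolynomial.bind₁ s p = MvPolynomial.bind₁ s q := by
    refine MvPolynomial.funext_set (fun _ => Set.range ((↑) : ℝ → ℂ))
      (fun _ => Set.infinite_range_of_injective Complex.ofReal_injective) fun x hx => ?_
    choose y hy using fun i => hx i (Set.mem_univ i)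
    rw [hev, hev]
    have e : (Sum.elim (fun j => x (.inl j) - Complex.I * x (.inr j))
        (fun j => x (.inl j) + Complex.I * x (.inr j)) : Fin r ⊕ Fin r → ℂ) =
        Sum.elim (fun j => conj (x (.inl j) + Complex.I * x (.inr j)))
          (fun j => x (.inl j) + Complex.I * x (.inr j)) := by
      congr 1
      ext j
      simp [← hy, sub_eq_add_neg]
    rw [e]
    exact h _
  refine MvPolynomial.funext fun x => ?_
  -- The inverse change of variables, x = (z̄ + z)/2 and y = (z - z̄)/(2i), now at arbitrary complex
  -- arguments.
  have h1 := congrArg (MvPolynomial.eval (Sum.elim (fun j => (x (.inl j) + x (.inr j)) / 2)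
    (fun j => (x (.inr j) - x (.inl j)) / (2 * Complex.I)))) key
  rw [hev, hev] at h1
  have e : (Sum.elim (fun j => (x (.inl j) + x (.inr j)) / 2 - Complex.I *
      ((x (.inr j) - x (.inl j)) / (2 * Complex.I)))
      (fun j => (x (.inl j) + x (.inr j)) / 2 + Complex.I *
      ((x (.inr j) - x (.inl j)) / (2 * Complex.I))) : Fin r ⊕ Fin r → ℂ) = x := by
    have hI := Complex.I_ne_zero
    ext (j | j)
    · simp only [Sum.elim_inl]; field_simp; ring
    · simp only [Sum.elim_inr]; field_simp; ring
  simpa only [Sum.elim_inl, Sum.elim_inr, e] using h1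

end Pairing

/-! ### The symbol in finitely many coordinates and its formal adjoint -/

section SymbolPolynomial

variable {ι H : Type*} [NormedAddCommGroup H] [InnerProductSpace ℂ H] {S : SobolevScale ι H}
  {r : ℕ}

namespace CutoffSymbol

/-- The coefficients of the symbol in the coordinates given by the rows of `B`. -/
noncomputable def frameCoeff (W : CutoffSymbol S) (B : Fin r → ι → ℝ) (kl : ℕ × ℕ)
    (c : Fin kl.1 → Fin r) (c' : Fin kl.2 → Fin r) : ℂ :=
  ∑' ij : (Fin kl.1 → ι) × (Fin kl.2 → ι), W.coeff ⟨kl, ij⟩ *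
    ((∏ a, (B (c a) (ij.1 a) : ℂ)) * ∏ a, (B (c' a) (ij.2 a) : ℂ))

/-- The symbol in the coordinates given by the rows of `B`. -/
noncomputable def symbolPoly (W : CutoffSymbol S) (B : Fin r → ι → ℝ) :
    MvPolynomial (Fin r ⊕ Fin r) ℂ :=
  ∑ kl ∈ Finset.range (W.order + 1) ×ˢ Finset.range (W.order + 1),
    ∑ c : Fin kl.1 → Fin r, ∑ c' : Fin kl.2 → Fin r,
      MvPolynomial.monomial (Finsupp.sumElim (fidx c) (fidx c'))
        (W.frameCoeff B kl c c')

theorem pairing_symbolPoly (W : CutoffSymbol S) (B : Fin r → ι → ℝ)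
    (Φ : (Fin r →₀ ℕ) → (Fin r →₀ ℕ) → ℂ) :
    pairing Φ (W.symbolPoly B) =
      ∑ kl ∈ Finset.range (W.order + 1) ×ˢ Finset.range (W.order + 1),
        ∑ c : Fin kl.1 → Fin r, ∑ c' : Fin kl.2 → Fin r,
          W.frameCoeff B kl c c' * Φ (fidx c) (fidx c') := by
  rw [symbolPoly, map_sum]
  refine Finset.sum_congr rfl fun kl _ => ?_
  rw [map_sum]
  refine Finset.sum_congr rfl fun c _ => ?_
  rw [map_sum]
  refine Finset.sum_congr rfl fun c' _ => ?_
  rw [pairing_monomial, leftIdx_sumElim, rightIdx_sumElim]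

/-- Contracting the kernels with B commutes with any linear evaluation Φ of the monomials. With Φ a
product of powers this computes values of the symbol, with Φ a ladder form it computes matrix
elements of the operator. Absolute summability of the kernels and |B_{ci}| ≤ 1 justify the
regrouping by sectors. -/
theorem hasSum_coeff_frame (W : CutoffSymbol S) {B : Fin r → ι → ℝ} (hB : ∀ c i, |B c i| ≤ 1)
    (Φ : (Fin r →₀ ℕ) → (Fin r →₀ ℕ) → ℂ) :
    HasSum (fun t : WickIndex ι => W.coeff t * ∑ c : Fin t.1.1 → Fin r, ∑ c' : Fin t.1.2 → Fin r,
      ((∏ a, (B (c a) (t.2.1 a) : ℂ)) * ∏ a, (B (c' a) (t.2.2 a) : ℂ)) * Φ (fidx c) (fidx c'))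
      (pairing Φ (W.symbolPoly B)) := by
  classical
  set R := Finset.range (W.order + 1) ×ˢ Finset.range (W.order + 1) with hR
  have hmem : ∀ t : WickIndex ι, t.1 ∉ R → W.coeff t = 0 := by
    intro t ht
    refine W.coeff_eq_zero t ?_
    simp only [hR, Finset.mem_product, Finset.mem_range, not_and_or, not_lt] at ht
    omega
  have hprod : ∀ (k : ℕ) (c : Fin k → Fin r) (i : Fin k → ι), ‖∏ a, (B (c a) (i a) : ℂ)‖ ≤ 1 := by
    intro k c i
    rw [norm_prod]
    exact Finset.prod_le_one (fun _ _ => norm_nonneg _) fun a _ => by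
      rw [Complex.norm_real]; exact hB _ _
  have hprod2 : ∀ (kl : ℕ × ℕ) (c : Fin kl.1 → Fin r) (c' : Fin kl.2 → Fin r)
      (ij : (Fin kl.1 → ι) × (Fin kl.2 → ι)),
      ‖(∏ a, (B (c a) (ij.1 a) : ℂ)) * ∏ a, (B (c' a) (ij.2 a) : ℂ)‖ ≤ 1 := by
    intro kl c c' ij
    rw [norm_mul]
    exact mul_le_one₀ (hprod _ _ _) (norm_nonneg _) (hprod _ _ _)
  set C : ℕ × ℕ → ℝ := fun kl => ∑ c : Fin kl.1 → Fin r, ∑ c' : Fin kl.2 → Fin r,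
    ‖Φ (fidx c) (fidx c')‖ with hC
  have hC0 : ∀ kl, 0 ≤ C kl := fun kl =>
    Finset.sum_nonneg fun _ _ => Finset.sum_nonneg fun _ _ => norm_nonneg _
  set v : WickIndex ι → ℂ := fun t => ∑ c : Fin t.1.1 → Fin r, ∑ c' : Fin t.1.2 → Fin r,
      ((∏ a, (B (c a) (t.2.1 a) : ℂ)) * ∏ a, (B (c' a) (t.2.2 a) : ℂ)) * Φ (fidx c) (fidx c')
    with hv
  have hvC : ∀ t, ‖v t‖ ≤ C t.1 := by
    intro t
    refine (norm_sum_le _ _).trans (Finset.sum_le_sum fun c _ => ?_)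
    refine (norm_sum_le _ _).trans (Finset.sum_le_sum fun c' _ => ?_)
    rw [norm_mul]
    exact mul_le_of_le_one_left (norm_nonneg _) (hprod2 _ _ _ _)
  have hsum : Summable fun t => W.coeff t * v t := by
    -- The bound on `v` depends on the sector; cutting `v` off outside the finitely many sectors of
    -- nonzero kernels gives a single constant.
    have h := W.summable_coeff_mul (v := fun t => if t.1 ∈ R then v t else 0)
      (C := ∑ kl ∈ R, C kl) fun t => by
        split_ifs with ht
        · exact (hvC t).trans (Finset.single_le_sum (fun kl _ => hC0 kl) ht)
        · simpa using Finset.sum_nonneg fun kl _ => hC0 kl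
    refine h.congr fun t => ?_
    by_cases ht : t.1 ∈ R
    · simp [ht]
    · simp [hmem t ht]
  have hcsum : ∀ (kl : ℕ × ℕ) (c : Fin kl.1 → Fin r) (c' : Fin kl.2 → Fin r),
      Summable fun ij : (Fin kl.1 → ι) × (Fin kl.2 → ι) => W.coeff ⟨kl, ij⟩ *
          ((∏ a, (B (c a) (ij.1 a) : ℂ)) * ∏ a, (B (c' a) (ij.2 a) : ℂ)) := by
    intro kl c c'
    have h : Summable fun ij => ‖W.coeff ⟨kl, ij⟩‖ :=
      ((summable_sigma_of_nonneg fun _ => norm_nonneg _).1 W.summable_coeff).1 kl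
    refine Summable.of_norm_bounded h fun ij => ?_
    rw [norm_mul]
    exact mul_le_of_le_one_right (norm_nonneg _) (hprod2 _ _ _ _)
  refine HasSum.sigma_of_hasSum (g := fun kl => ∑ c : Fin kl.1 → Fin r, ∑ c' : Fin kl.2 → Fin r,
    (W.frameCoeff B kl c c') * Φ (fidx c) (fidx c'))
    ?_ (fun kl => ?_) hsum
  · rw [pairing_symbolPoly]
    refine hasSum_sum_of_ne_finset_zero fun kl hkl => ?_
    have : ∀ ij, W.coeff ⟨kl, ij⟩ = 0 := fun ij => hmem ⟨kl, ij⟩ hkl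
    simp [frameCoeff, this]
  · have h : HasSum (fun ij : (Fin kl.1 → ι) × (Fin kl.2 → ι) => ∑ c : Fin kl.1 → Fin r,
        ∑ c' : Fin kl.2 → Fin r, W.coeff ⟨kl, ij⟩ *
          ((∏ a, (B (c a) (ij.1 a) : ℂ)) * ∏ a, (B (c' a) (ij.2 a) : ℂ)) * Φ (fidx c) (fidx c'))
        (∑ c : Fin kl.1 → Fin r, ∑ c' : Fin kl.2 → Fin r,
        (W.frameCoeff B kl c c') *
          Φ (fidx c) (fidx c')) :=
      hasSum_sum fun c _ => hasSum_sum fun c' _ => (hcsum kl c c').hasSum.mul_right _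
    refine h.congr_fun fun ij => ?_
    simp only [Finset.mul_sum, mul_assoc]

/-- The symbol evaluated on the span of the frame. -/
theorem eval_symbolPoly (W : CutoffSymbol S) {B : Fin r → ι → ℝ} (hB : ∀ c i, |B c i| ≤ 1)
    {α β : H} {z z' : Fin r → ℂ} (hα : ∀ i, ⟪S.e i, α⟫_ℂ = ∑ c, z c * B c i)
    (hβ : ∀ i, ⟪S.e i, β⟫_ℂ = ∑ c, z' c * B c i) :
    MvPolynomial.eval (Sum.elim (fun c => conj (z c)) z') (W.symbolPoly B) = W.eval α β := by
  classical
  rw [eval_eq_pairing, eval, ← (W.hasSum_coeff_frame hB _).tsum_eq]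
  refine tsum_congr fun t => ?_
  congr 1
  -- Each product of sums over c is expanded into a sum over index functions, matching the
  -- contracted kernels.
  simp only [hα, hβ, map_sum, map_mul, Complex.conj_ofReal, Finset.prod_univ_sum,
    Fintype.piFinset_univ, Finset.sum_mul_sum, Finset.prod_mul_distrib, mpow_fidx]
  refine Finset.sum_congr rfl fun c _ => Finset.sum_congr rfl fun c' _ => ?_
  ring

/-- The matrix elements of the cutoff operator between functions of the coordinates. -/
theorem inner_pull_operator [Countable ι] (W : CutoffSymbol S) {B : Fin r → ι → ℝ}
    (hB : IsRealFrame B) (hB1 : ∀ c i, |B c i| ≤ 1) {g f : GaussSpace (Fin r)}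
    (hg : AnnihSmooth g) (hf : AnnihSmooth f) (x : W.operator.domain)
    (hx : (x : GaussSpace ι) = hB.pull f) :
    ⟪hB.pull g, W.operator x⟫_ℂ = pairing (ladderForm g f) (W.symbolPoly B) :=
  (W.hasSum_inner_operator x (hB.pull g) _ fun t => by
    rw [hx]; exact hB.hasSum_ladderForm_pull hg hf t.2.1 t.2.2).unique
    (W.hasSum_coeff_frame hB1 _)

/-- The coherent matrix elements of the cutoff operator. -/
theorem inner_coherent_operator (W : CutoffSymbol S) (α β : H) (x : W.operator.domain)
    (hx : (x : GaussSpace ι) = S.coherent β) :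
    ⟪S.coherent α, W.operator x⟫_ℂ = W.eval α β * Complex.exp ⟪α, β⟫_ℂ := by
  have h := W.hasSum_inner_operator x (S.coherent α) (fun t =>
    (((∏ a, conj ⟪S.e (t.2.1 a), α⟫_ℂ) * ∏ c, ⟪S.e (t.2.2 c), β⟫_ℂ)) *
      Complex.exp ⟪α, β⟫_ℂ) fun t => by
    rw [← S.inner_coherent]
    refine ((hasSum_hcoef (S.coherent α) (S.coherent β)).mul_left
      ((∏ a, conj ⟪S.e (t.2.1 a), α⟫_ℂ) * ∏ c, ⟪S.e (t.2.2 c), β⟫_ℂ)).congr_fun fun n => ?_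
    simp only [hx, S.hcoef_coherent, mpow_add, mpow_fidx, map_mul, map_prod]
    ring
  rw [← h.tsum_eq, eval, ← tsum_mul_right]
  exact tsum_congr fun t => by ring

/-- The formally adjoint symbol. -/
noncomputable def adj (W : CutoffSymbol S) : CutoffSymbol S where
  order := W.order
  coeff t := conj (W.coeff ⟨t.1.swap, t.2.swap⟩)
  coeff_eq_zero t ht := by
    rw [W.coeff_eq_zero _ (by simpa [add_comm] using ht), map_zero]
  decay kl s := by
    obtain ⟨C, hC⟩ := W.decay kl.swap s
    refine ⟨C, fun i j => ?_⟩
    rw [RCLike.norm_conj, mul_comm (∏ a, (1 + S.ev (i a)))]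
    exact hC j i

/-- Exchange of the creator and the annihilator indices. -/
def swapIndex (ι : Type*) : WickIndex ι ≃ WickIndex ι where
  toFun t := ⟨t.1.swap, t.2.swap⟩
  invFun t := ⟨t.1.swap, t.2.swap⟩
  left_inv _ := rfl
  right_inv _ := rfl

theorem eval_adj (W : CutoffSymbol S) (α β : H) : W.adj.eval α β = conj (W.eval β α) := by
  rw [eval, eval, Complex.conj_tsum, ← (swapIndex ι).tsum_eq]
  refine tsum_congr fun t => ?_
  have e : W.adj.coeff (swapIndex ι t) = conj (W.coeff t) := rfl
  rw [e, map_mul, map_mul, map_prod, map_prod]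
  simp only [Complex.conj_conj]
  congr 1
  exact mul_comm _ _

/-- Both vectors lie in 𝒢^∞, so both sides are sums of ladder forms. Conjugation exchanges the two
vectors in a ladder form together with creator and annihilator indices, exactly as the adjoint
symbol does; reality of the symbol plays no role here. -/
theorem inner_operator_adj (W : CutoffSymbol S) (x : W.operator.domain) (y : W.adj.operator.domain) :
    ⟪W.operator x, (y : GaussSpace ι)⟫_ℂ = ⟪(x : GaussSpace ι), W.adj.operator y⟫_ℂ := by
  have hx := S.numberSmooth (W.mem_domain_operator.1 x.2)
  have hy := S.numberSmooth (W.adj.mem_domain_operator.1 y.2)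
  have hl : ∀ t : WickIndex ι, HasSum (fun n => conj (hcoef (y : GaussSpace ι) (n + fidx t.2.1)) *
      hcoef (x : GaussSpace ι) (n + fidx t.2.2) / (mfac n : ℂ))
      (ladderForm (y : GaussSpace ι) x (fidx t.2.1) (fidx t.2.2)) := by
    intro t
    obtain ⟨G, hG⟩ := hx.exists_ladder (fidx t.2.1) (fidx t.2.2)
    rw [← hG.inner_eq]
    exact hG.hasSum_inner _
  have hsymm : ∀ t : WickIndex ι, HasSum (fun n => conj (hcoef (x : GaussSpace ι) (n + fidx t.2.1)) *
      hcoef (y : GaussSpace ι) (n + fidx t.2.2) / (mfac n : ℂ))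
      (conj (ladderForm (y : GaussSpace ι) x (fidx t.2.2) (fidx t.2.1))) := by
    intro t
    have h := (Complex.hasSum_conj'.2 (hl (swapIndex ι t)))
    refine h.congr_fun fun n => ?_
    simp only [map_div₀, map_mul, Complex.conj_conj, Complex.conj_ofReal, swapIndex]
    rw [mul_comm]
    rfl
  have h1 := W.hasSum_inner_operator x y _ hl
  have h2 := W.adj.hasSum_inner_operator y x _ hsymm
  rw [← (swapIndex ι).hasSum_iff] at h2
  have h3 := Complex.hasSum_conj'.2 h1
  rw [inner_conj_symm] at h3
  refine h3.unique (h2.congr_fun fun t => ?_)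
  have e : W.adj.coeff (swapIndex ι t) = conj (W.coeff t) := rfl
  simp only [Function.comp_apply, e, map_mul]
  rfl

end CutoffSymbol

end SymbolPolynomial

/-! ### Density of the Gauss measure on ℝ^r -/

section GaussDensity

variable {r : ℕ}

/-- The density of the standard Gauss measure on `ℝ^r`. -/
noncomputable def gaussDensity (x : Fin r → ℝ) : ℝ :=
  (√(2 * Real.pi))⁻¹ ^ r * Real.exp (-(∑ j, x j ^ 2) / 2)

theorem gaussDensity_pos (x : Fin r → ℝ) : 0 < gaussDensity x := by
  have := Real.pi_pos
  unfold gaussDensity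
  positivity

theorem continuous_gaussDensity : Continuous (gaussDensity (r := r)) := by
  unfold gaussDensity
  fun_prop

theorem prod_gaussianPDFReal (x : Fin r → ℝ) :
    ∏ j, gaussianPDFReal 0 1 (x j) = gaussDensity x := by
  simp only [gaussianPDFReal, gaussDensity, Finset.prod_mul_distrib, NNReal.coe_one, mul_one,
    sub_zero, ← Real.exp_sum, Finset.prod_const, Finset.card_univ, Fintype.card_fin]
  rw [← Finset.sum_div, Finset.sum_neg_distrib]

theorem withDensity_inv_gaussianPDF :
    (gaussianReal 0 1).withDensity (fun t => (gaussianPDF 0 1 t)⁻¹) = volume := by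
  rw [gaussianReal_of_var_ne_zero 0 one_ne_zero]
  exact withDensity_inv_same (measurable_gaussianPDF 0 1)
    (Eventually.of_forall fun t => (gaussianPDF_pos 0 one_ne_zero t).ne')
    (Eventually.of_forall fun t => ENNReal.ofReal_ne_top)

/-- Lebesgue measure is characterized by the volumes of boxes, which can be computed from the
independence of the Gaussian coordinates; this is why it is expressed through the Gauss measure, and
the relation inverted afterwards. -/
theorem volume_eq_withDensity_gaussMeasure : (volume : Measure (Fin r → ℝ)) =
    (gaussMeasure (Fin r)).withDensity fun x => ENNReal.ofReal (gaussDensity x)⁻¹ := by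
  rw [volume_pi]
  refine Measure.pi_eq fun s hs => ?_
  have hmeas : Measurable fun t => (gaussianPDF 0 1 t)⁻¹ := (measurable_gaussianPDF 0 1).inv
  rw [withDensity_apply _ (MeasurableSet.univ_pi hs),
    ← lintegral_indicator (MeasurableSet.univ_pi hs)]
  have e : (Set.univ.pi s).indicator (fun x => ENNReal.ofReal (gaussDensity x)⁻¹) =
      fun x => ∏ j, (s j).indicator (fun t => (gaussianPDF 0 1 t)⁻¹) (x j) := by
    ext x
    by_cases hx : x ∈ Set.univ.pi s
    · rw [Set.indicator_of_mem hx, ← prod_gaussianPDFReal, ← Finset.prod_inv_distrib,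
        ENNReal.ofReal_prod_of_nonneg fun j _ => inv_nonneg.2 (gaussianPDFReal_nonneg _ _ _)]
      refine Finset.prod_congr rfl fun j _ => ?_
      rw [Set.indicator_of_mem (hx j (Set.mem_univ j)),
        ENNReal.ofReal_inv_of_pos (gaussianPDFReal_pos 0 1 _ one_ne_zero)]
      rfl
    · rw [Set.indicator_of_notMem hx]
      simp only [Set.mem_pi, Set.mem_univ, true_implies, not_forall] at hx
      obtain ⟨j, hj⟩ := hx
      exact (Finset.prod_eq_zero (Finset.mem_univ j) (Set.indicator_of_notMem hj _)).symm
  have hind : iIndepFun (fun j (x : Fin r → ℝ) =>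
      (s j).indicator (fun t => (gaussianPDF 0 1 t)⁻¹) (x j)) (gaussMeasure (Fin r)) :=
    iIndepFun_infinitePi fun j => hmeas.indicator (hs j)
  rw [e, lintegral_prod_eq_prod_lintegral_of_indepFun Finset.univ
    (fun j (x : Fin r → ℝ) => (s j).indicator (fun t => (gaussianPDF 0 1 t)⁻¹) (x j)) hind
    (fun j => (hmeas.indicator (hs j)).comp (measurable_pi_apply j))]
  refine Finset.prod_congr rfl fun j _ => ?_
  rw [(measurePreserving_coord j).lintegral_comp (hmeas.indicator (hs j)),
    lintegral_indicator (hs j), ← withDensity_apply _ (hs j), withDensity_inv_gaussianPDF]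

theorem gaussMeasure_eq_withDensity : gaussMeasure (Fin r) =
    volume.withDensity fun x => ENNReal.ofReal (gaussDensity x) := by
  rw [volume_eq_withDensity_gaussMeasure]
  have hpos : ∀ x : Fin r → ℝ, 0 < (gaussDensity x)⁻¹ := fun x => inv_pos.2 (gaussDensity_pos x)
  have h := withDensity_inv_same (μ := gaussMeasure (Fin r))
    (f := fun x => ENNReal.ofReal (gaussDensity x)⁻¹)
    (continuous_gaussDensity.measurable.inv.ennreal_ofReal)
    (Eventually.of_forall fun x => (ENNReal.ofReal_pos.2 (hpos x)).ne')
    (Eventually.of_forall fun x => ENNReal.ofReal_ne_top)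
  conv_lhs => rw [← h]
  congr 1
  ext x
  rw [← ENNReal.ofReal_inv_of_pos (hpos x), inv_inv]

theorem integral_gaussMeasure (F : (Fin r → ℝ) → ℂ) :
    ∫ x, F x ∂gaussMeasure (Fin r) = ∫ x, (gaussDensity x : ℂ) * F x := by
  rw [gaussMeasure_eq_withDensity, integral_withDensity_eq_integral_toReal_smul
    continuous_gaussDensity.measurable.ennreal_ofReal
    (Eventually.of_forall fun x => ENNReal.ofReal_lt_top)]
  simp only [ENNReal.toReal_ofReal (gaussDensity_pos _).le, Complex.real_smul]

theorem integrable_gaussMeasure_iff {F : (Fin r → ℝ) → ℝ} :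
    Integrable F (gaussMeasure (Fin r)) ↔ Integrable fun x => gaussDensity x * F x := by
  rw [gaussMeasure_eq_withDensity, integrable_withDensity_iff_integrable_smul'
    continuous_gaussDensity.measurable.ennreal_ofReal
    (Eventually.of_forall fun x => ENNReal.ofReal_lt_top)]
  simp only [ENNReal.toReal_ofReal (gaussDensity_pos _).le, smul_eq_mul]

end GaussDensity

/-! ### Differential operators on the functions exp(|x|²/4) g -/

section Classical

variable {r : ℕ}

/-- The functions `exp(|x|²/4) g(x)` with `g` in the Schwartz space. -/
def IsGaussSchwartz (f : (Fin r → ℝ) → ℂ) : Prop :=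
  ∃ g : SchwartzMap (Fin r → ℝ) ℂ, ∀ x, f x = Real.exp ((∑ j, x j ^ 2) / 4) * g x

theorem hasFDerivAt_expQuad (a : ℝ) (x : Fin r → ℝ) :
    HasFDerivAt (fun x : Fin r → ℝ => (Real.exp ((∑ j, x j ^ 2) * a) : ℂ))
      ((Complex.ofRealCLM.comp (Real.exp ((∑ j, x j ^ 2) * a) •
        (a • ∑ j, (2 * x j) • ContinuousLinearMap.proj (R := ℝ) (φ := fun _ : Fin r => ℝ) j)))) x := by
  have h1 : HasFDerivAt (fun x : Fin r → ℝ => ∑ j, x j ^ 2)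
      (∑ j, (2 * x j) • ContinuousLinearMap.proj (R := ℝ) (φ := fun _ : Fin r => ℝ) j) x := by
    refine HasFDerivAt.fun_sum fun j _ => ?_
    have := ((ContinuousLinearMap.proj (R := ℝ) (φ := fun _ : Fin r => ℝ) j).hasFDerivAt
      (x := x)).pow 2
    simpa using this
  exact Complex.ofRealCLM.hasFDerivAt.comp x (h1.mul_const a).exp

/-- Serves twice: with a = 1/4 for the weight in the function class, with a = -1/2 for the Gauss
density. -/
theorem partialD_expQuad_mul (a : ℝ) {f : (Fin r → ℝ) → ℂ} (hf : Differentiable ℝ f) (j : Fin r)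
    (x : Fin r → ℝ) :
    partialD j (fun x => (Real.exp ((∑ j, x j ^ 2) * a) : ℂ) * f x) x =
      (Real.exp ((∑ j, x j ^ 2) * a) : ℂ) * (partialD j f x + (2 * a * x j : ℝ) * f x) := by
  have h := ((hasFDerivAt_expQuad a x).mul (hf x).hasFDerivAt).fderiv
  rw [partialD]
  refine (congrArg (fun L : (Fin r → ℝ) →L[ℝ] ℂ => L (Pi.single j 1)) h).trans ?_
  simp [Pi.single_apply, partialD]
  ring

theorem differentiable_expQuad (a : ℝ) :
    Differentiable ℝ (fun x : Fin r → ℝ => (Real.exp ((∑ j, x j ^ 2) * a) : ℂ)) :=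
  fun x => (hasFDerivAt_expQuad a x).differentiableAt

theorem hasTemperateGrowth_coord (j : Fin r) :
    Function.HasTemperateGrowth fun x : Fin r → ℝ => (x j : ℂ) :=
  (Complex.ofRealCLM.comp
    (ContinuousLinearMap.proj (R := ℝ) (φ := fun _ : Fin r => ℝ) j)).hasTemperateGrowth

theorem hasTemperateGrowth_polyFun (Q : MvPolynomial (Fin r) ℂ) :
    Function.HasTemperateGrowth (polyFun Q) := by
  induction Q using MvPolynomial.induction_on with
  | C a =>
    have : polyFun (MvPolynomial.C a : MvPolynomial (Fin r) ℂ) = fun _ => a := by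
      ext ξ; simp [polyFun]
    rw [this]
    exact .const a
  | add f g hf hg =>
    have : polyFun (f + g) = polyFun f + polyFun g := by
      ext ξ; exact polyFun_add f g ξ
    rw [this]
    exact hf.add hg
  | mul_X f i hf =>
    have : polyFun (f * MvPolynomial.X i) = polyFun f * fun ξ => (ξ i : ℂ) := by
      ext ξ; rw [polyFun_mul, polyFun_X]; rfl
    rw [this]
    exact hf.mul (hasTemperateGrowth_coord i)

theorem differentiable_polyFun (Q : MvPolynomial (Fin r) ℂ) : Differentiable ℝ (polyFun Q) :=
  (hasTemperateGrowth_polyFun Q).1.differentiable (by simp)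

theorem partialD_polyFun (j : Fin r) (Q : MvPolynomial (Fin r) ℂ) (x : Fin r → ℝ) :
    partialD j (polyFun Q) x = polyFun (MvPolynomial.pderiv j Q) x := by
  induction Q using MvPolynomial.induction_on with
  | C a =>
    have : polyFun (MvPolynomial.C a : MvPolynomial (Fin r) ℂ) = fun _ => a := by
      ext ξ; simp [polyFun]
    rw [this]
    simp [partialD, polyFun]
  | add f g hf hg =>
    have : polyFun (f + g) = polyFun f + polyFun g := by
      ext ξ; exact polyFun_add f g ξ
    rw [this, map_add, polyFun_add, ← hf, ← hg, partialD,
      fderiv_add (differentiable_polyFun f x) (differentiable_polyFun g x)]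
    rfl
  | mul_X f i hf =>
    have e : polyFun (f * MvPolynomial.X i) = polyFun f * fun ξ => (ξ i : ℂ) := by
      ext ξ; rw [polyFun_mul, polyFun_X]; rfl
    have hd : HasFDerivAt (fun ξ : Fin r → ℝ => (ξ i : ℂ)) (Complex.ofRealCLM.comp
        (ContinuousLinearMap.proj (R := ℝ) (φ := fun _ : Fin r => ℝ) i)) x :=
      (Complex.ofRealCLM.comp
        (ContinuousLinearMap.proj (R := ℝ) (φ := fun _ : Fin r => ℝ) i)).hasFDerivAt
    rw [e, partialD, ((differentiable_polyFun f x).hasFDerivAt.mul hd).fderiv,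
      Derivation.leibniz, polyFun_add, smul_eq_mul, smul_eq_mul, polyFun_mul, polyFun_mul, ← hf,
      polyFun_X, MvPolynomial.pderiv_X]
    simp only [add_apply, smul_apply, ContinuousLinearMap.comp_apply,
      ContinuousLinearMap.proj_apply, Complex.ofRealCLM_apply, smul_eq_mul, partialD]
    by_cases h : j = i
    · subst h; simp [polyFun]
    · simp [polyFun, Ne.symm h]

namespace IsGaussSchwartz

variable {f : (Fin r → ℝ) → ℂ}

theorem exists_eq (hf : IsGaussSchwartz f) : ∃ g : SchwartzMap (Fin r → ℝ) ℂ,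
    f = fun x => (Real.exp ((∑ j, x j ^ 2) * (1 / 4)) : ℂ) * g x := by
  obtain ⟨g, hg⟩ := hf
  exact ⟨g, funext fun x => by rw [hg, div_eq_mul_one_div]⟩

theorem differentiable (hf : IsGaussSchwartz f) : Differentiable ℝ f := by
  obtain ⟨g, rfl⟩ := hf.exists_eq
  exact (differentiable_expQuad _).mul g.differentiable

theorem partialD (hf : IsGaussSchwartz f) (j : Fin r) : IsGaussSchwartz (partialD j f) := by
  obtain ⟨g, rfl⟩ := hf.exists_eq
  -- The derivative of exp(|x|²/4) g is exp(|x|²/4)(∂_j g + x_j g / 2), and the bracket is again a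
  -- Schwartz function.
  refine ⟨LineDeriv.lineDerivOp (Pi.single j (1 : ℝ) : Fin r → ℝ) g +
    (1 / 2 : ℂ) • SchwartzMap.smulLeftCLM ℂ (fun x : Fin r → ℝ => (x j : ℂ)) g, fun x => ?_⟩
  rw [partialD_expQuad_mul _ g.differentiable, ← div_eq_mul_one_div]
  simp only [add_apply, smul_apply,
    SchwartzMap.smulLeftCLM_apply_apply (hasTemperateGrowth_coord j),
    SchwartzMap.lineDerivOp_apply_eq_fderiv, smul_eq_mul]
  rw [_root_.partialD]
  push_cast
  ring

theorem add {h : (Fin r → ℝ) → ℂ} (hf : IsGaussSchwartz f) (hh : IsGaussSchwartz h) :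
    IsGaussSchwartz fun x => f x + h x := by
  obtain ⟨g, hg⟩ := hf
  obtain ⟨k, hk⟩ := hh
  exact ⟨g + k, fun x => by dsimp only; rw [hg, hk, add_apply, mul_add]⟩

theorem const_mul (hf : IsGaussSchwartz f) (a : ℂ) : IsGaussSchwartz fun x => a * f x := by
  obtain ⟨g, hg⟩ := hf
  exact ⟨a • g, fun x => by dsimp only; rw [hg, smul_apply, smul_eq_mul]; ring⟩

theorem zero : IsGaussSchwartz fun _ : Fin r → ℝ => 0 := ⟨0, fun x => by simp⟩

theorem sum {σ : Type*} (s : Finset σ) {F : σ → (Fin r → ℝ) → ℂ}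
    (hF : ∀ i ∈ s, IsGaussSchwartz (F i)) : IsGaussSchwartz fun x => ∑ i ∈ s, F i x := by
  classical
  induction s using Finset.induction_on with
  | empty => simpa using zero
  | insert a s ha ih =>
    simp only [Finset.sum_insert ha]
    exact (hF a (Finset.mem_insert_self _ _)).add
      (ih fun i hi => hF i (Finset.mem_insert_of_mem hi))

theorem coord_mul (hf : IsGaussSchwartz f) (j : Fin r) :
    IsGaussSchwartz fun x => (x j : ℂ) * f x := by
  obtain ⟨g, hg⟩ := hf
  refine ⟨SchwartzMap.smulLeftCLM ℂ (fun x : Fin r → ℝ => (x j : ℂ)) g, fun x => ?_⟩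
  dsimp only
  rw [hg, SchwartzMap.smulLeftCLM_apply_apply (hasTemperateGrowth_coord j), smul_eq_mul]
  ring

theorem partialDAdj (hf : IsGaussSchwartz f) (j : Fin r) : IsGaussSchwartz (partialDAdj j f) := by
  have h := (hf.coord_mul j).add ((hf.partialD j).const_mul (-1))
  have e : _root_.partialDAdj j f = fun x => (x j : ℂ) * f x + -1 * _root_.partialD j f x := by
    ext x; rw [_root_.partialDAdj]; ring
  rwa [e]

/-- The Gauss density cancels exp(|x|²/4)² exactly up to a constant, leaving the integral of |g|².
-/
theorem memLp (hf : IsGaussSchwartz f) : MemLp f 2 (gaussMeasure (Fin r)) := by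
  rw [memLp_two_iff_integrable_sq_norm hf.differentiable.continuous.aestronglyMeasurable,
    integrable_gaussMeasure_iff]
  obtain ⟨g, rfl⟩ := hf.exists_eq
  have hg := ((g.memLp 2 volume).integrable_norm_pow (by simp)).const_mul
    ((√(2 * Real.pi))⁻¹ ^ r)
  refine hg.congr (Eventually.of_forall fun x => ?_)
  simp only [norm_mul, Complex.norm_real, Real.norm_eq_abs, Real.abs_exp, gaussDensity, mul_pow,
    ← Real.exp_nat_mul]
  rw [mul_assoc, ← mul_assoc (Real.exp _), ← Real.exp_add]
  have : -(∑ j, x j ^ 2) / 2 + (2 : ℕ) * ((∑ j, x j ^ 2) * (1 / 4)) = 0 := by push_cast; ring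
  simp only [Nat.cast_ofNat] at this ⊢
  rw [this, Real.exp_zero, one_mul]

/-- The class of a function in the Gauss space. -/
noncomputable def toVec (hf : IsGaussSchwartz f) : GaussSpace (Fin r) := hf.memLp.toLp f

theorem coeFn_toVec (hf : IsGaussSchwartz f) : hf.toVec =ᵐ[gaussMeasure (Fin r)] f :=
  MemLp.coeFn_toLp _

theorem inner_toVec (hf : IsGaussSchwartz f) (Q : MvPolynomial (Fin r) ℂ) :
    ⟪polyVec Q, hf.toVec⟫_ℂ = ∫ x, (gaussDensity x : ℂ) *
      (polyFun (MvPolynomial.map (starRingEnd ℂ) Q) x * f x) := by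
  rw [inner_polyVec, ← integral_gaussMeasure]
  refine integral_congr_ae ?_
  filter_upwards [hf.coeFn_toVec] with x hx
  rw [hx, polyFun_star]

/-- The exponents -1/2 and 1/4 leave the bounded factor exp(-|x|²/4) times a polynomial times a
Schwartz function. -/
theorem integrable_density_mul (hf : IsGaussSchwartz f) (Q : MvPolynomial (Fin r) ℂ) :
    Integrable fun x => polyFun Q x * ((Real.exp ((∑ j, x j ^ 2) * (-(1 / 2))) : ℂ) * f x) := by
  obtain ⟨g, rfl⟩ := hf.exists_eq
  have h := (SchwartzMap.smulLeftCLM ℂ (polyFun Q) g).integrable (μ := volume)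
  have hb := h.bdd_mul (f := fun x : Fin r → ℝ => (Real.exp ((∑ j, x j ^ 2) * (-(1 / 4))) : ℂ))
    (c := 1) (differentiable_expQuad _).continuous.aestronglyMeasurable
    (Eventually.of_forall fun x => by
      rw [Complex.norm_real, Real.norm_eq_abs, Real.abs_exp, Real.exp_le_one_iff]
      have : 0 ≤ ∑ j, x j ^ 2 := Finset.sum_nonneg fun _ _ => sq_nonneg _
      linarith)
  refine hb.congr (Eventually.of_forall fun x => ?_)
  simp only [SchwartzMap.smulLeftCLM_apply_apply (hasTemperateGrowth_polyFun Q), smul_eq_mul]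
  rw [← mul_assoc (Complex.ofReal _) (Complex.ofReal _) (g x), ← Complex.ofReal_mul,
    ← Real.exp_add]
  have : (∑ j, x j ^ 2) * -(1 / 2) + (∑ j, x j ^ 2) * (1 / 4) = (∑ j, x j ^ 2) * -(1 / 4) := by
    ring
  rw [this]
  ring

theorem gaussDensity_eq (x : Fin r → ℝ) : (gaussDensity x : ℂ) =
    ((√(2 * Real.pi))⁻¹ ^ r : ℝ) * (Real.exp ((∑ j, x j ^ 2) * (-(1 / 2))) : ℂ) := by
  rw [gaussDensity, ← Complex.ofReal_mul]
  congr 3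
  ring

/-- Gaussian integration by parts. -/
theorem inner_partialD (hf : IsGaussSchwartz f) (j : Fin r) (Q : MvPolynomial (Fin r) ℂ) :
    ⟪polyVec Q, (hf.partialD j).toVec⟫_ℂ = ⟪polyVec (create j Q), hf.toVec⟫_ℂ := by
  set E : (Fin r → ℝ) → ℂ := fun x => (Real.exp ((∑ j, x j ^ 2) * (-(1 / 2))) : ℂ) with hE
  set R := MvPolynomial.map (starRingEnd ℂ) Q with hR
  have hG : ∀ x, _root_.partialD j (fun x => E x * f x) x =
      E x * (_root_.partialD j f x - x j * f x) := by
    intro x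
    rw [hE, partialD_expQuad_mul _ hf.differentiable]
    push_cast
    ring
  have i1 := hf.integrable_density_mul R
  have i2 := hf.integrable_density_mul (MvPolynomial.pderiv j R)
  have i3 := (hf.partialD j).integrable_density_mul R
  have i4 := hf.integrable_density_mul (MvPolynomial.X j * R)
  -- Integration by parts for Lebesgue measure, with the density attached to f; by `hG` its
  -- derivative turns ∂_j f into ∂_j f - x_j f.
  have key := integral_mul_fderiv_eq_neg_fderiv_mul_of_integrable (μ := volume)
    (f := polyFun R) (g := fun x => E x * f x) (v := Pi.single j 1)
    (i2.congr (Eventually.of_forall fun x => by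
      change _ = _root_.partialD j (polyFun R) x * _
      rw [partialD_polyFun]))
    ((i3.sub i4).congr (Eventually.of_forall fun x => by
      change _ = _ * _root_.partialD j (fun x => E x * f x) x
      simp only [Pi.sub_apply, polyFun_mul, polyFun_X]
      rw [hG]
      ring)) i1
    (fun x _ => differentiable_polyFun R x)
    (fun x _ => ((differentiable_expQuad _).mul hf.differentiable) x)
  have e1 : ∀ x, polyFun R x * fderiv ℝ (fun x => E x * f x) x (Pi.single j 1) =
      polyFun R x * (E x * _root_.partialD j f x) - polyFun (MvPolynomial.X j * R) x * (E x * f x) := by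
    intro x
    change _ * _root_.partialD j (fun x => E x * f x) x = _
    rw [hG, polyFun_mul, polyFun_X]
    ring
  have e2 : ∀ x, fderiv ℝ (polyFun R) x (Pi.single j 1) * (E x * f x) =
      polyFun (MvPolynomial.pderiv j R) x * (E x * f x) := fun x => by
    change _root_.partialD j (polyFun R) x * _ = _
    rw [partialD_polyFun]
  simp only [e1, e2] at key
  rw [integral_sub i3 i4] at key
  rw [inner_toVec, inner_toVec]
  have e3 : MvPolynomial.map (starRingEnd ℂ) (create j Q) =
      MvPolynomial.X j * R - MvPolynomial.pderiv j R := by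
    rw [create_apply, map_sub, map_mul, MvPolynomial.map_X, pderiv_map_star]
  have e4 : ∀ (P : MvPolynomial (Fin r) ℂ) (h : (Fin r → ℝ) → ℂ),
      ∫ x, (gaussDensity x : ℂ) * (polyFun P x * h x) =
      ((√(2 * Real.pi))⁻¹ ^ r : ℝ) * ∫ x, polyFun P x * (E x * h x) := by
    intro P h
    rw [← integral_const_mul]
    refine integral_congr_ae (Eventually.of_forall fun x => ?_)
    simp only [gaussDensity_eq, hE]
    ring
  rw [e4, e4, e3]
  congr 1
  have e5 : ∫ x, polyFun (MvPolynomial.X j * R - MvPolynomial.pderiv j R) x * (E x * f x) =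
      (∫ x, polyFun (MvPolynomial.X j * R) x * (E x * f x)) -
        ∫ x, polyFun (MvPolynomial.pderiv j R) x * (E x * f x) := by
    rw [← integral_sub i4 i2]
    refine integral_congr_ae (Eventually.of_forall fun x => ?_)
    simp only [polyFun, map_sub]
    ring
  rw [e5]
  linear_combination key

/-- Multiplication by x_j is symmetric and equals creator plus annihilator on the test polynomial;
subtracting ∂_j, which is the creator there, leaves the annihilator. -/
theorem inner_partialDAdj (hf : IsGaussSchwartz f) (j : Fin r) (Q : MvPolynomial (Fin r) ℂ) :
    ⟪polyVec Q, (hf.partialDAdj j).toVec⟫_ℂ = ⟪polyVec (annih j Q), hf.toVec⟫_ℂ := by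
  have e1 : (hf.partialDAdj j).toVec = (hf.coord_mul j).toVec - (hf.partialD j).toVec := by
    refine Lp.ext ?_
    filter_upwards [(hf.partialDAdj j).coeFn_toVec, (hf.coord_mul j).coeFn_toVec,
      (hf.partialD j).coeFn_toVec, Lp.coeFn_sub (hf.coord_mul j).toVec (hf.partialD j).toVec]
      with x h1 h2 h3 h4
    rw [h1, h4, Pi.sub_apply, h2, h3]
    rfl
  have e2 : ⟪polyVec Q, (hf.coord_mul j).toVec⟫_ℂ =
      ⟪polyVec (MvPolynomial.X j * Q), hf.toVec⟫_ℂ := by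
    rw [inner_toVec, inner_toVec]
    refine integral_congr_ae (Eventually.of_forall fun x => ?_)
    simp only [map_mul, MvPolynomial.map_X, polyFun_mul, polyFun_X]
    ring
  have e3 : MvPolynomial.X j * Q = create j Q + annih j Q := by
    rw [create_apply, annih_apply, sub_add_cancel]
  rw [e1, inner_sub_right, e2, hf.inner_partialD, e3, polyVec_add, inner_add_left, add_sub_cancel_left]

theorem hcoef_partialD (hf : IsGaussSchwartz f) (j : Fin r) (n : Fin r →₀ ℕ) :
    hcoef (hf.partialD j).toVec n = hcoef hf.toVec (n + Finsupp.single j 1) := by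
  rw [hcoef, hcoef, ← polyVec_hermitePoly, hf.inner_partialD, create_hermitePoly, polyVec_hermitePoly]

theorem hcoef_partialDAdj (hf : IsGaussSchwartz f) (j : Fin r) (n : Fin r →₀ ℕ) :
    hcoef (hf.partialDAdj j).toVec n = n j * hcoef hf.toVec (n - Finsupp.single j 1) := by
  rw [hcoef, hcoef, ← polyVec_hermitePoly, hf.inner_partialDAdj, annih_hermitePoly, polyVec_smul,
    inner_smul_left, polyVec_hermitePoly, Complex.conj_natCast]

end IsGaussSchwartz

end Classical

/-! ### Normally ordered operators as ladder operators -/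

section NormalOp

variable {r : ℕ}

/-- Takes the extra unit off n before the other factors, as required when a further x_j - ∂_j is
applied from the outside. -/
theorem dfac_add_single_left {κ : Type*} (n I : κ →₀ ℕ) (j : κ) :
    dfac n (I + Finsupp.single j 1) = n j * dfac (n - Finsupp.single j 1) I := by
  induction I using multiIndex_induction with
  | h0 => rw [dfac_add_single, dfac_zero, dfac_zero, tsub_zero]
  | hs i I ih =>
    rw [add_right_comm, dfac_add_single, ih, dfac_add_single, tsub_add_eq_tsub_tsub, tsub_right_comm]
    ring

theorem coeFn_sum_gaussSpace {κ σ : Type*} (s : Finset σ) (u : σ → GaussSpace κ) :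
    ⇑(∑ i ∈ s, u i) =ᵐ[gaussMeasure κ] fun x => ∑ i ∈ s, u i x := by
  classical
  induction s using Finset.induction_on with
  | empty =>
    simp only [Finset.sum_empty]
    exact Lp.coeFn_zero ℂ 2 (gaussMeasure κ)
  | insert a s ha ih =>
    simp only [Finset.sum_insert ha]
    filter_upwards [ih, Lp.coeFn_add (u a) (∑ i ∈ s, u i)] with x h1 h2
    rw [h2, Pi.add_apply, h1]

namespace IsGaussSchwartz

variable {f : (Fin r → ℝ) → ℂ}

theorem iterate_partialD (hf : IsGaussSchwartz f) (j : Fin r) (k : ℕ) :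
    ∃ h : IsGaussSchwartz ((_root_.partialD j)^[k] f),
      IsLadder 0 (Finsupp.single j k) hf.toVec h.toVec := by
  induction k with
  | zero => exact ⟨hf, isLadder_zero_left.2 fun n => by simp⟩
  | succ k ih =>
    obtain ⟨h, hl⟩ := ih
    rw [isLadder_zero_left] at hl
    simp only [Function.iterate_succ_apply']
    refine ⟨h.partialD j, isLadder_zero_left.2 fun n => ?_⟩
    rw [h.hcoef_partialD, hl, add_assoc, ← Finsupp.single_add, add_comm 1 k]

theorem foldr_partialD (hf : IsGaussSchwartz f) (J : Fin r → ℕ) (l : List (Fin r)) :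
    ∃ h : IsGaussSchwartz (l.foldr (fun j g => (_root_.partialD j)^[J j] g) f),
      IsLadder 0 (l.map fun j => Finsupp.single j (J j)).sum hf.toVec h.toVec := by
  induction l with
  | nil => exact ⟨hf, isLadder_zero_left.2 fun n => by simp⟩
  | cons j l ih =>
    obtain ⟨h, hl⟩ := ih
    obtain ⟨h', hl'⟩ := h.iterate_partialD j (J j)
    rw [isLadder_zero_left] at hl hl'
    refine ⟨h', isLadder_zero_left.2 fun n => ?_⟩
    rw [List.map_cons, List.sum_cons, ← add_assoc, ← hl, ← hl']
    rfl

theorem iterate_partialDAdj {I J : Fin r →₀ ℕ} {x : GaussSpace (Fin r)} (hf : IsGaussSchwartz f)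
    (hx : IsLadder I J x hf.toVec) (j : Fin r) (k : ℕ) :
    ∃ h : IsGaussSchwartz ((_root_.partialDAdj j)^[k] f),
      IsLadder (Finsupp.single j k + I) J x h.toVec := by
  induction k with
  | zero => exact ⟨hf, by simpa using hx⟩
  | succ k ih =>
    obtain ⟨h, hl⟩ := ih
    simp only [Function.iterate_succ_apply']
    refine ⟨h.partialDAdj j, fun n => ?_⟩
    have e : Finsupp.single j (k + 1) + I = Finsupp.single j k + I + Finsupp.single j 1 := by
      rw [Finsupp.single_add]; abel
    rw [h.hcoef_partialDAdj, hl, e, dfac_add_single_left, tsub_add_eq_tsub_tsub n (_ + I),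
      tsub_right_comm (a := n)]
    push_cast
    ring

theorem foldr_partialDAdj {I J : Fin r →₀ ℕ} {x : GaussSpace (Fin r)} (hf : IsGaussSchwartz f)
    (hx : IsLadder I J x hf.toVec) (K : Fin r → ℕ) (l : List (Fin r)) :
    ∃ h : IsGaussSchwartz (l.foldr (fun j g => (_root_.partialDAdj j)^[K j] g) f),
      IsLadder ((l.map fun j => Finsupp.single j (K j)).sum + I) J x h.toVec := by
  induction l with
  | nil => exact ⟨hf, by simpa using hx⟩
  | cons j l ih =>
    obtain ⟨h, hl⟩ := ih
    obtain ⟨h', hl'⟩ := h.iterate_partialDAdj hl j (K j)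
    rw [← add_assoc] at hl'
    exact ⟨h', by rw [List.map_cons, List.sum_cons]; exact hl'⟩

theorem sum_single_finRange (K : Fin r →₀ ℕ) :
    ((List.finRange r).map fun j => Finsupp.single j (K j)).sum = K := by
  rw [← Fin.sum_univ_def, Finsupp.univ_sum_single]

/-- Normally ordered monomials act as ladder operators. -/
theorem normalMonomial (hf : IsGaussSchwartz f) (m : Fin r ⊕ Fin r →₀ ℕ) :
    ∃ h : IsGaussSchwartz (normalMonomial m f),
      IsLadder (leftIdx m) (rightIdx m) hf.toVec h.toVec := by
  obtain ⟨h1, hl1⟩ := hf.foldr_partialD (rightIdx m) (List.finRange r)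
  obtain ⟨h2, hl2⟩ := h1.foldr_partialDAdj hl1 (leftIdx m) (List.finRange r)
  rw [sum_single_finRange, sum_single_finRange, add_zero] at hl2
  have e : _root_.normalMonomial m f = (List.finRange r).foldr
      (fun j g => (_root_.partialDAdj j)^[leftIdx m j] g) ((List.finRange r).foldr
        (fun j g => (_root_.partialD j)^[rightIdx m j] g) f) := by
    simp only [_root_.normalMonomial, leftIdx_apply, rightIdx_apply]
  simp only [e]
  exact ⟨h2, hl2⟩

theorem annihSmooth (hf : IsGaussSchwartz f) : AnnihSmooth hf.toVec := by
  intro J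
  obtain ⟨h, hl⟩ := hf.foldr_partialD J (List.finRange r)
  rw [sum_single_finRange] at hl
  exact ⟨_, hl⟩

theorem normalOp (hf : IsGaussSchwartz f) (w : MvPolynomial (Fin r ⊕ Fin r) ℂ) :
    IsGaussSchwartz (normalOp w f) :=
  sum _ fun m _ => (hf.normalMonomial m).choose.const_mul _

/-- The right side is the functional that `inner_pull_operator` finds for the cutoff operator; this
is how D and the compression of Ĥ are matched. -/
theorem inner_normalOp (hf : IsGaussSchwartz f) (w : MvPolynomial (Fin r ⊕ Fin r) ℂ)
    (y : GaussSpace (Fin r)) :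
    ⟪y, (hf.normalOp w).toVec⟫_ℂ = pairing (ladderForm y hf.toVec) w := by
  have e : (hf.normalOp w).toVec =
      ∑ m ∈ w.support, w.coeff m • (hf.normalMonomial m).choose.toVec := by
    refine Lp.ext ?_
    have h1 : ∀ᵐ x ∂gaussMeasure (Fin r), ∀ m ∈ w.support,
        (hf.normalMonomial m).choose.toVec x = _root_.normalMonomial m f x :=
      (ae_ball_iff w.support.countable_toSet).2 fun m _ => (hf.normalMonomial m).choose.coeFn_toVec
    have h2 : ∀ᵐ x ∂gaussMeasure (Fin r), ∀ m ∈ w.support,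
        (w.coeff m • (hf.normalMonomial m).choose.toVec : GaussSpace (Fin r)) x =
          w.coeff m * (hf.normalMonomial m).choose.toVec x :=
      (ae_ball_iff w.support.countable_toSet).2 fun m _ => Lp.coeFn_smul _ _
    filter_upwards [(hf.normalOp w).coeFn_toVec, h1, h2, coeFn_sum_gaussSpace w.support
      (fun m => w.coeff m • (hf.normalMonomial m).choose.toVec)] with x a1 a2 a3 a4
    rw [a1, a4, _root_.normalOp]
    refine Finset.sum_congr rfl fun m hm => ?_
    rw [a3 m hm, a2 m hm]
  rw [e, inner_sum, pairing_eq_sum]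
  refine Finset.sum_congr rfl fun m _ => ?_
  rw [inner_smul_right, (hf.normalMonomial m).choose_spec.inner_eq]

theorem of_hasCompactSupport {φ : (Fin r → ℝ) → ℂ} (hφ : ContDiff ℝ ∞ φ)
    (hc : HasCompactSupport φ) : IsGaussSchwartz φ := by
  have hE : ContDiff ℝ ∞ fun x : Fin r → ℝ => (Real.exp (-((∑ j, x j ^ 2) / 4)) : ℂ) := by
    have h : ContDiff ℝ ∞ fun x : Fin r → ℝ => -((∑ j, x j ^ 2) / 4) := by fun_prop
    exact Complex.ofRealCLM.contDiff.comp (Real.contDiff_exp.comp h)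
  refine ⟨HasCompactSupport.toSchwartzMap
    (f := fun x => (Real.exp (-((∑ j, x j ^ 2) / 4)) : ℂ) * φ x) hc.mul_left (hE.mul hφ),
    fun x => ?_⟩
  change φ x = _ * (_ * φ x)
  rw [← mul_assoc, ← Complex.ofReal_mul, ← Real.exp_add, add_neg_cancel, Real.exp_zero,
    Complex.ofReal_one, one_mul]

end IsGaussSchwartz

end NormalOp

/-! ### The compression P A P -/

section Compress

variable {E : Type*} [NormedAddCommGroup E] [InnerProductSpace ℂ E] {P : E →L[ℂ] E} {A : E →ₗ.[ℂ] E}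

theorem mem_compress_domain {x : E} : x ∈ (compress P A).domain ↔ P x ∈ A.domain := Iff.rfl

theorem compress_apply (x : (compress P A).domain) :
    compress P A x = P (A ⟨P x, x.2⟩) := rfl

theorem compress_apply_eq {x y : (compress P A).domain} (h : P (x : E) = P y) :
    compress P A x = compress P A y := by
  rw [compress_apply, compress_apply]
  congr 2
  exact Subtype.ext h

end Compress

/-! ### Friedrichs extensions of compressions -/

section AbstractFriedrichs

variable {E : Type*} [NormedAddCommGroup E] [InnerProductSpace ℂ E] [CompleteSpace E]

theorem mem_friedrichs {T : E →ₗ.[ℂ] E} (hT : IsLowerBounded T) (hd : Dense (T.domain : Set E))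
    {u w : E} (hu : u ∈ formDomain T hT) (hw : ∀ x : T.domain, ⟪w, (x : E)⟫_ℂ = ⟪u, T x⟫_ℂ) :
    ∃ v : (friedrichs T hT).domain, (v : E) = u ∧ friedrichs T hT v = w := by
  have hu' : u ∈ T.adjoint.domain := LinearPMap.mem_adjoint_domain_of_exists u ⟨w, hw⟩
  refine ⟨⟨u, hu, hu'⟩, rfl, ?_⟩
  exact LinearPMap.adjoint_apply_eq hd ⟨u, hu'⟩ hw

theorem inner_friedrichs {T : E →ₗ.[ℂ] E} (hT : IsLowerBounded T) (hd : Dense (T.domain : Set E))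
    (u : (friedrichs T hT).domain) (x : T.domain) :
    ⟪friedrichs T hT u, (x : E)⟫_ℂ = ⟪(u : E), T x⟫_ℂ :=
  LinearPMap.adjoint_isFormalAdjoint hd ⟨u, u.2.2⟩ x

/-- Vectors on which `T` is symmetric belong to the domain of the Friedrichs extension. -/
theorem friedrichs_of_symm {T : E →ₗ.[ℂ] E} (hT : IsLowerBounded T)
    (hd : Dense (T.domain : Set E)) (v : T.domain)
    (hv : ∀ x : T.domain, ⟪T v, (x : E)⟫_ℂ = ⟪(v : E), T x⟫_ℂ) :
    ∃ u : (friedrichs T hT).domain, (u : E) = v ∧ friedrichs T hT u = T v :=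
  mem_friedrichs hT hd ⟨fun _ => v, tendsto_const_nhds, by simp⟩ hv

/-- The Friedrichs extension of `P A P` is an operator in the range of `P`. -/
theorem friedrichs_compress {P : E →L[ℂ] E} {A : E →ₗ.[ℂ] E}
    (hT : IsLowerBounded (compress P A))
    (hd : Dense ((compress P A).domain : Set E)) (hPP : ∀ x, P (P x) = P x)
    (hPs : ∀ x y, ⟪P x, y⟫_ℂ = ⟪x, P y⟫_ℂ) (u : (friedrichs (compress P A) hT).domain) :
    ∃ v : (friedrichs (compress P A) hT).domain, (v : E) = P u ∧
      friedrichs (compress P A) hT v = friedrichs (compress P A) hT u ∧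
      P (friedrichs (compress P A) hT u) = friedrichs (compress P A) hT u := by
  have hPT : ∀ x : (compress P A).domain, P (compress P A x) = compress P A x := fun x => by
    rw [compress_apply, hPP]
  have hmem : ∀ x : (compress P A).domain, P (x : E) ∈ (compress P A).domain := fun x => by
    rw [mem_compress_domain, hPP]; exact x.2
  have hTP : ∀ x : (compress P A).domain, compress P A ⟨P (x : E), hmem x⟩ = compress P A x :=
    fun x => compress_apply_eq (hPP _)
  have hfix : P (friedrichs (compress P A) hT u) = friedrichs (compress P A) hT u := by
    -- The vectors y - P y lie in the kernel of P, hence in the domain of P A P, which vanishes on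
    -- them; the adjoint relation makes the value orthogonal to all of them.
    refine ext_inner_right ℂ fun y => ?_
    rw [hPs]
    have hy : y - P y ∈ (compress P A).domain := by
      rw [mem_compress_domain, map_sub, hPP, sub_self]; exact zero_mem _
    have h := inner_friedrichs hT hd u ⟨y - P y, hy⟩
    have h0 : compress P A ⟨y - P y, hy⟩ = 0 := by
      rw [← LinearPMap.map_zero (compress P A)]
      refine compress_apply_eq ?_
      simp [hPP]
    rw [h0, inner_zero_right, inner_sub_right, sub_eq_zero] at h
    exact h.symm
  obtain ⟨x, hx, hq⟩ := u.2.1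
  -- An approximating sequence of u is projected. It stays Cauchy for the form because ⟪Px, TPx⟫ =
  -- ⟪x, PTx⟫ = ⟪x, Tx⟫ for T = P A P.
  obtain ⟨v, hv1, hv2⟩ := mem_friedrichs hT hd (u := P u)
    (w := friedrichs (compress P A) hT u)
    ⟨fun n => ⟨P (x n : E), hmem _⟩, (P.continuous.tendsto _).comp hx, by
      refine hq.congr fun q => ?_
      have e : (⟨P (x q.1 : E), hmem _⟩ - ⟨P (x q.2 : E), hmem _⟩ : (compress P A).domain) =
          ⟨P ((x q.1 - x q.2 : (compress P A).domain) : E), hmem _⟩ :=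
        Subtype.ext (by simp)
      rw [e, hTP, hPs, hPT]⟩
    fun y => by rw [inner_friedrichs hT hd, hPs, hPT]
  exact ⟨v, hv1, hv2, hfix⟩

end AbstractFriedrichs

/-! ### Existence of real orthonormal bases -/

section RealBasis

variable {ι H : Type*} [NormedAddCommGroup H] [InnerProductSpace ℂ H]

namespace SobolevScale

/-- The real vectors of `K`. -/
noncomputable def realPart (S : SobolevScale ι H) (K : Submodule ℂ H) : Submodule ℝ H where
  carrier := {φ | φ ∈ K ∧ S.conjugation φ = φ}
  zero_mem' := ⟨zero_mem _, map_zero _⟩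
  add_mem' := fun ⟨h1, h2⟩ ⟨h3, h4⟩ => ⟨add_mem h1 h3, by rw [map_add, h2, h4]⟩
  smul_mem' := fun a φ ⟨h1, h2⟩ => by
    rw [← Complex.coe_smul]
    exact ⟨K.smul_mem _ h1, by rw [LinearIsometryEquiv.map_smulₛₗ, h2, Complex.conj_ofReal]⟩

/-- The real vectors form a real form of K: inner products between them are real, so a real
orthonormal basis of them is orthonormal over ℂ, and together with the scalar i they span K. -/
theorem exists_isRealBasis (S : SobolevScale ι H) (K : Submodule ℂ H) [FiniteDimensional ℂ K]
    (hK : ∀ φ ∈ K, S.conjugation φ ∈ K) : ∃ (r : ℕ) (b : Fin r → H), S.IsRealBasis K b := by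
  have : FiniteDimensional ℝ (K.restrictScalars ℝ) :=
    inferInstanceAs (FiniteDimensional ℝ K)
  have hle : S.realPart K ≤ K.restrictScalars ℝ := fun φ h => h.1
  have : FiniteDimensional ℝ (S.realPart K) := Submodule.finiteDimensional_of_le hle
  let : InnerProductSpace ℝ H := InnerProductSpace.complexToReal
  set b := stdOrthonormalBasis ℝ (S.realPart K)
  refine ⟨_, fun j => (b j : H), ?_, ?_, fun j => (b j).2.2⟩
  · rw [orthonormal_iff_ite]
    intro i j
    have h1 := orthonormal_iff_ite.1 b.orthonormal i j
    rw [Submodule.coe_inner, real_inner_eq_re_inner ℂ] at h1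
    have h2 := S.inner_conjugation (b i : H) (b j)
    rw [(b i).2.2, (b j).2.2] at h2
    rw [← Complex.conj_eq_iff_re.1 h2.symm]
    rw [RCLike.re_to_complex] at h1
    rw [h1]
    split_ifs <;> simp
  · have hsub : ∀ φ ∈ S.realPart K, φ ∈ Submodule.span ℂ (Set.range fun j => (b j : H)) := by
      intro φ hφ
      have h := b.sum_repr ⟨φ, hφ⟩
      have h' := congrArg (Subtype.val) h
      simp only [Submodule.coe_sum, Submodule.coe_smul] at h'
      rw [← h']
      refine Submodule.sum_mem _ fun j _ => ?_
      rw [← Complex.coe_smul]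
      exact Submodule.smul_mem _ _ (Submodule.subset_span ⟨j, rfl⟩)
    refine le_antisymm (Submodule.span_le.2 ?_) fun φ hφ => ?_
    · rintro _ ⟨j, rfl⟩
      exact (b j).2.1
    · have hc := S.conjugation_conjugation φ
      have h1 : φ + S.conjugation φ ∈ S.realPart K :=
        ⟨add_mem hφ (hK φ hφ), by rw [map_add, hc, add_comm]⟩
      have h2 : Complex.I • (φ - S.conjugation φ) ∈ S.realPart K :=
        ⟨K.smul_mem _ (sub_mem hφ (hK φ hφ)), by
          rw [LinearIsometryEquiv.map_smulₛₗ, map_sub, hc, Complex.conj_I, neg_smul, ← smul_neg,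
            neg_sub]⟩
      -- Real and imaginary parts; i(φ - φ̄) is fixed by the conjugation because i and the
      -- difference both change sign.
      have e : φ = (1 / 2 : ℂ) • (φ + S.conjugation φ) +
          (-(Complex.I / 2)) • (Complex.I • (φ - S.conjugation φ)) := by
        rw [smul_smul]
        have : -(Complex.I / 2) * Complex.I = 1 / 2 := by
          linear_combination (-1 / 2 : ℂ) * Complex.I_mul_I
        rw [this]
        module
      rw [e]
      exact add_mem (Submodule.smul_mem _ _ (hsub _ h1)) (Submodule.smul_mem _ _ (hsub _ h2))

end SobolevScale

end RealBasis

/-! ### The reduced operator in coordinates -/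

section Reduced

variable {ι H : Type*} [NormedAddCommGroup H] [InnerProductSpace ℂ H] {S : SobolevScale ι H}
  {K : Submodule ℂ H} {r : ℕ} {b : Fin r → H}

namespace SobolevScale

theorem quantizedProj_quantizedProj (S : SobolevScale ι H) (K : Submodule ℂ H) (x : GaussSpace ι) :
    S.quantizedProj K (S.quantizedProj K x) = S.quantizedProj K x :=
  Submodule.starProjection_eq_self_iff.2 (Submodule.starProjection_apply_mem _ _)

theorem inner_quantizedProj (S : SobolevScale ι H) (K : Submodule ℂ H) (x y : GaussSpace ι) :
    ⟪S.quantizedProj K x, y⟫_ℂ = ⟪x, S.quantizedProj K y⟫_ℂ :=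
  Submodule.inner_starProjection_left_eq_right _ _ _

theorem IsRealBasis.abs_realCoeff_le (hb : S.IsRealBasis K b) (c : Fin r) (i : ι) :
    |S.realCoeff b c i| ≤ 1 := by
  refine (Complex.abs_re_le_norm _).trans ((norm_inner_le_norm _ _).trans ?_)
  rw [S.e.orthonormal.1, hb.1.1, one_mul]

theorem IsRealBasis.inner_e_starProjection [K.HasOrthogonalProjection] (hb : S.IsRealBasis K b)
    (α : H) (i : ι) :
    ⟪S.e i, K.starProjection α⟫_ℂ = ∑ c, ⟪b c, α⟫_ℂ * S.realCoeff b c i := by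
  rw [hb.starProjection_eq, inner_sum]
  exact Finset.sum_congr rfl fun c _ => by rw [inner_smul_right, hb.coe_realCoeff]

theorem IsRealBasis.eval_symbolPoly [K.HasOrthogonalProjection] (hb : S.IsRealBasis K b)
    (W : CutoffSymbol S) (α β : H) :
    MvPolynomial.eval (Sum.elim (fun j => conj ⟪b j, α⟫_ℂ) fun j => ⟪b j, β⟫_ℂ)
      (W.symbolPoly (S.realCoeff b)) = W.eval (K.starProjection α) (K.starProjection β) :=
  W.eval_symbolPoly hb.abs_realCoeff_le (hb.inner_e_starProjection α) (hb.inner_e_starProjection β)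

/-- The symbol polynomial of a Hamiltonian functional is hermitian. -/
theorem IsRealBasis.symbolPoly_adj [K.HasOrthogonalProjection] (hb : S.IsRealBasis K b)
    (hK : ∀ φ ∈ K, φ ∈ S.smooth) {W : CutoffSymbol S} (hW : W.IsHamiltonian) :
    W.adj.symbolPoly (S.realCoeff b) = W.symbolPoly (S.realCoeff b) := by
  refine eq_of_eval_conj fun z => ?_
  set α := ∑ c, z c • b c with hα
  have hz : ∀ c, ⟪b c, α⟫_ℂ = z c := fun c => hb.1.inner_right_fintype z c
  have hαK : α ∈ K := Submodule.sum_mem _ fun c _ => K.smul_mem _ (hb.mem c)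
  have h1 := hb.eval_symbolPoly W α α
  have h2 := hb.eval_symbolPoly W.adj α α
  rw [Submodule.starProjection_eq_self_iff.2 hαK] at h1 h2
  simp only [hz] at h1 h2
  rw [h1, h2, W.eval_adj]
  -- On the diagonal the adjoint symbol takes the conjugate value, which is the same since the
  -- Hamiltonian is real on smooth vectors.
  exact Complex.conj_eq_iff_im.2 (hW α (hK α hαK))

variable [Countable ι]

/-- The compressed operator acts on functions of the coordinates by the normal symbol. -/
theorem IsRealBasis.quantizedProj_operator_eq (hb : S.IsRealBasis K b)
    (hB : IsRealFrame (S.realCoeff b)) (W : CutoffSymbol S) {f : GaussSpace (Fin r)}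
    (hf : AnnihSmooth f) (x : W.operator.domain) (hx : (x : GaussSpace ι) = hB.pull f)
    {G : GaussSpace (Fin r)}
    (hG : ∀ n, hcoef G n = pairing (ladderForm (hermiteVec n) f) (W.symbolPoly (S.realCoeff b))) :
    S.quantizedProj K (W.operator x) = hB.pull G := by
  obtain ⟨a, ha⟩ := (hb.quantizedProj_eq_self_iff hB _).1
    (S.quantizedProj_quantizedProj K (W.operator x))
  rw [← ha]
  congr 1
  refine hcoef_ext fun n => ?_
  have hn := (hb.quantizedProj_eq_self_iff hB _).2 ⟨hermiteVec n, rfl⟩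
  -- Both sides lie in the range of the isometry, so testing against pulled back Hermite polynomials
  -- suffices; P moves onto the test vector and fixes it.
  rw [hcoef, ← hB.pull.inner_map_map, ha, ← S.inner_quantizedProj, hn,
    W.inner_pull_operator hB hb.abs_realCoeff_le (annihSmooth_hermiteVec n) hf x hx, hG]

/-- The compression of a Hamiltonian operator is symmetric on functions of the coordinates. -/
theorem IsRealBasis.inner_compress [K.HasOrthogonalProjection] (hb : S.IsRealBasis K b)
    (hK : ∀ φ ∈ K, φ ∈ S.smooth) {W : CutoffSymbol S} (hW : W.IsHamiltonian)
    (hB : IsRealFrame (S.realCoeff b)) {f : GaussSpace (Fin r)} (hf : AnnihSmooth f)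
    (v x : (compress (S.quantizedProj K) W.operator).domain)
    (hv : S.quantizedProj K (v : GaussSpace ι) = hB.pull f) :
    ⟪compress (S.quantizedProj K) W.operator v, (x : GaussSpace ι)⟫_ℂ =
      ⟪(v : GaussSpace ι), compress (S.quantizedProj K) W.operator x⟫_ℂ := by
  have hsm : hB.pull f ∈ S.smoothFock :=
    S.pull_mem_smoothFock hB (fun s c => summable_realCoeff hK hb s c) hf
  set y : W.adj.operator.domain := ⟨hB.pull f, W.adj.mem_domain_operator.2 hsm⟩
  set v' : W.operator.domain := ⟨S.quantizedProj K (v : GaussSpace ι), v.2⟩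
  set x' : W.operator.domain := ⟨S.quantizedProj K (x : GaussSpace ι), x.2⟩
  -- On `hB.pull f` the operator and its formal adjoint have the same symbol polynomial, hence the
  -- same compression. Formal adjointness on 𝒢^∞ then gives symmetry against every `x` in the
  -- domain, with regularity demanded only of `f`.
  have hP : S.quantizedProj K (W.operator v') = S.quantizedProj K (W.adj.operator y) := by
    obtain ⟨G, hG⟩ := (hb.quantizedProj_eq_self_iff hB _).1
      (S.quantizedProj_quantizedProj K (W.adj.operator y))
    rw [← hG]
    refine hb.quantizedProj_operator_eq hB W hf v' hv fun n => ?_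
    have hn := (hb.quantizedProj_eq_self_iff hB _).2 ⟨hermiteVec n, rfl⟩
    rw [hcoef, ← hB.pull.inner_map_map, hG, ← S.inner_quantizedProj, hn,
      W.adj.inner_pull_operator hB hb.abs_realCoeff_le (annihSmooth_hermiteVec n) hf y rfl,
      hb.symbolPoly_adj hK hW]
  have e1 : compress (S.quantizedProj K) W.operator v = S.quantizedProj K (W.adj.operator y) := hP
  have e2 : compress (S.quantizedProj K) W.operator x = S.quantizedProj K (W.operator x') := rfl
  rw [e1, e2, S.inner_quantizedProj, ← S.inner_quantizedProj K (v : GaussSpace ι), hv,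
    ← inner_conj_symm, ← inner_conj_symm (hB.pull f)]
  exact congrArg _ (W.inner_operator_adj x' y).symm

/-- The domain contains the kernel of P and the Hermite polynomials in the coordinates. A vector
orthogonal to the first is fixed by P, hence is a function of the coordinates; the second then
forces it to vanish. -/
theorem IsRealBasis.dense_compress_domain (hb : S.IsRealBasis K b)
    (hK : ∀ φ ∈ K, φ ∈ S.smooth) (W : CutoffSymbol S) (hB : IsRealFrame (S.realCoeff b)) :
    Dense ((compress (S.quantizedProj K) W.operator).domain : Set (GaussSpace ι)) := by
  rw [Submodule.dense_iff_topologicalClosure_eq_top, Submodule.topologicalClosure_eq_top_iff,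
    Submodule.eq_bot_iff]
  intro x hx
  rw [Submodule.mem_orthogonal] at hx
  have hPx : S.quantizedProj K x = x := by
    refine ext_inner_left ℂ fun y => ?_
    have h := hx (y - S.quantizedProj K y) (by
      rw [mem_compress_domain, map_sub, quantizedProj_quantizedProj, sub_self]
      exact zero_mem _)
    rw [inner_sub_left, sub_eq_zero] at h
    rw [← S.inner_quantizedProj, h]
  obtain ⟨f, rfl⟩ := (hb.quantizedProj_eq_self_iff hB x).1 hPx
  have hf : f = 0 := by
    refine hcoef_ext fun n => ?_
    have h := hx (hB.pull (hermiteVec n)) (by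
      rw [mem_compress_domain, (hb.quantizedProj_eq_self_iff hB _).2 ⟨_, rfl⟩,
        W.mem_domain_operator]
      exact S.pull_mem_smoothFock hB (fun s c => summable_realCoeff hK hb s c)
        (annihSmooth_hermiteVec n))
    rw [hB.pull.inner_map_map] at h
    rw [hcoef, h, hcoef, inner_zero_right]
  rw [hf, map_zero]

/-- Vectors whose projection is a regular function of the coordinates belong to the domain of
the reduced operator. -/
theorem IsRealBasis.exists_friedrichs [K.HasOrthogonalProjection] (hb : S.IsRealBasis K b)
    (hK : ∀ φ ∈ K, φ ∈ S.smooth) {W : CutoffSymbol S} (hW : W.IsHamiltonian)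
    (hB : IsRealFrame (S.realCoeff b))
    (hT : IsLowerBounded (compress (S.quantizedProj K) W.operator))
    {f : GaussSpace (Fin r)} (hf : AnnihSmooth f) {v : GaussSpace ι}
    (hv : S.quantizedProj K v = hB.pull f) :
    ∃ (x : W.operator.domain) (u : (friedrichs _ hT).domain), (x : GaussSpace ι) = hB.pull f ∧
      (u : GaussSpace ι) = v ∧ friedrichs _ hT u = S.quantizedProj K (W.operator x) := by
  have hx : S.quantizedProj K v ∈ W.operator.domain := by
    rw [hv, W.mem_domain_operator]
    exact S.pull_mem_smoothFock hB (fun s c => summable_realCoeff hK hb s c) hf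
  obtain ⟨u, hu1, hu2⟩ := friedrichs_of_symm hT (hb.dense_compress_domain hK W hB) ⟨v, hx⟩
    fun y => hb.inner_compress hK hW hB hf ⟨v, hx⟩ y hv
  exact ⟨⟨_, hx⟩, u, hv, hu1, hu2⟩

theorem IsRealBasis.quantizedProj_eq_self_iff_comp (hb : S.IsRealBasis K b)
    (hB : IsRealFrame (S.realCoeff b)) (F : GaussSpace ι) : S.quantizedProj K F = F ↔
      ∃ f : (Fin r → ℝ) → ℂ, Measurable f ∧ F =ᵐ[gaussMeasure ι] fun ξ => f (S.coords b ξ) := by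
  rw [hb.quantizedProj_eq_self_iff hB]
  constructor
  · rintro ⟨f, rfl⟩
    have hm := Lp.aestronglyMeasurable f
    exact ⟨hm.mk f, hm.stronglyMeasurable_mk.measurable, hB.coeFn_pull_of_ae hm.ae_eq_mk⟩
  · rintro ⟨f, hf, hF⟩
    have hmp := hB.measurePreserving
    have hmem : MemLp f 2 (gaussMeasure (Fin r)) := by
      rw [← hmp.map_eq, memLp_map_measure_iff hf.aestronglyMeasurable hmp.measurable.aemeasurable]
      exact (memLp_congr_ae hF).1 (Lp.memLp F)
    refine ⟨hmem.toLp f, Lp.ext ?_⟩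
    exact (hB.coeFn_pull_of_ae hmem.coeFn_toLp).trans hF.symm

/-- For the functions exp(|x|²/4) g, the compression and D have the same Hermite coefficients. For a
general vector of the domain, a test function composed with π lies in the domain of the compression,
and the defining relation of the adjoint transfers D to it. -/
theorem IsRealBasis.actsAsNormalOp [K.HasOrthogonalProjection] (hb : S.IsRealBasis K b)
    (hK : ∀ φ ∈ K, φ ∈ S.smooth) {W : CutoffSymbol S} (hW : W.IsHamiltonian)
    (hB : IsRealFrame (S.realCoeff b))
    (hT : IsLowerBounded (compress (S.quantizedProj K) W.operator)) :
    ActsAsNormalOp (friedrichs _ hT) (S.coords b) (W.symbolPoly (S.realCoeff b)) := by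
  have key : ∀ {f : (Fin r → ℝ) → ℂ} (hf : IsGaussSchwartz f) (x : W.operator.domain),
      (x : GaussSpace ι) = hB.pull hf.toVec →
      S.quantizedProj K (W.operator x) =
        hB.pull (hf.normalOp (W.symbolPoly (S.realCoeff b))).toVec := fun hf x hx =>
    hb.quantizedProj_operator_eq hB W hf.annihSmooth x hx fun n => hf.inner_normalOp _ _
  have hfix : ∀ f, S.quantizedProj K (hB.pull f) = hB.pull f := fun f =>
    (hb.quantizedProj_eq_self_iff hB _).2 ⟨f, rfl⟩
  refine ⟨fun g f hgf => ?_, fun u φ hφ hc => ?_⟩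
  · have hf : IsGaussSchwartz f := ⟨g, hgf⟩
    obtain ⟨x, F, hx, hF, hTF⟩ := hb.exists_friedrichs hK hW hB hT hf.annihSmooth (hfix hf.toVec)
    refine ⟨F, ?_, ?_⟩
    · rw [hF]
      exact hB.coeFn_pull_of_ae hf.coeFn_toVec
    · rw [hTF, key hf x hx]
      exact hB.coeFn_pull_of_ae (hf.normalOp _).coeFn_toVec
  · have hf : IsGaussSchwartz φ := .of_hasCompactSupport hφ hc
    have hint : ∀ {h : (Fin r → ℝ) → ℂ} (hh : IsGaussSchwartz h) (y : GaussSpace ι),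
        ∫ ξ, conj (h (S.coords b ξ)) * y ξ ∂gaussMeasure ι = ⟪hB.pull hh.toVec, y⟫_ℂ := by
      intro h hh y
      rw [L2.inner_def]
      refine integral_congr_ae ?_
      filter_upwards [hB.coeFn_pull_of_ae hh.coeFn_toVec] with ξ hξ
      rw [hξ, RCLike.inner_apply, mul_comm]
      rfl
    have hsm : S.quantizedProj K (hB.pull hf.toVec) ∈ W.operator.domain := by
      rw [hfix, W.mem_domain_operator]
      exact S.pull_mem_smoothFock hB (fun s c => summable_realCoeff hK hb s c) hf.annihSmooth
    rw [hint (hf.normalOp _), hint hf, ← key hf ⟨_, hsm⟩ (hfix _), ← inner_conj_symm,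
      ← inner_conj_symm (hB.pull hf.toVec)]
    exact congrArg _ (inner_friedrichs hT (hb.dense_compress_domain hK W hB) u
      ⟨hB.pull hf.toVec, hsm⟩).symm

/-- The coherent matrix elements of the reduced operator. -/
theorem IsRealBasis.exists_inner_coherent [K.HasOrthogonalProjection] (hb : S.IsRealBasis K b)
    (hK : ∀ φ ∈ K, φ ∈ S.smooth) {W : CutoffSymbol S} (hW : W.IsHamiltonian)
    (hB : IsRealFrame (S.realCoeff b))
    (hT : IsLowerBounded (compress (S.quantizedProj K) W.operator)) (α β : H) :
    ∃ v : (friedrichs _ hT).domain, (v : GaussSpace ι) = S.coherent β ∧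
      ⟪S.coherent α, friedrichs _ hT v⟫_ℂ = W.eval (K.starProjection α) (K.starProjection β) *
        Complex.exp ⟪K.starProjection α, K.starProjection β⟫_ℂ := by
  have hβ := hb.pull_coherentVec hB fun c => ⟪b c, β⟫_ℂ
  rw [← hb.starProjection_eq] at hβ
  obtain ⟨x, v, hx, hv, hTv⟩ := hb.exists_friedrichs hK hW hB hT
    (annihSmooth_coherentVec (fun c => ⟪b c, β⟫_ℂ) Summable.of_finite)
    (v := S.coherent β) (by rw [hβ, S.quantizedProj_coherent])
  refine ⟨v, hv, ?_⟩
  rw [hTv, ← S.inner_quantizedProj, S.quantizedProj_coherent]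
  exact W.inner_coherent_operator _ _ x (hx.trans hβ)

end SobolevScale

end Reduced

theorem proposition3p1 {ι H : Type*} [NormedAddCommGroup H] [InnerProductSpace ℂ H]
    [CompleteSpace H] (S : SobolevScale ι H)
    (W : CutoffSymbol S) (hW : W.IsHamiltonian)
    (p : ProjectorFlag S) (n : ℕ)
    (hb : IsLowerBounded (W.compressed p n)) :
    -- `P_n` is the second quantization of `p_n`
    (∀ α : H, S.quantizedProj (p.space n) (S.coherent α) = S.coherent (p.proj n α)) ∧
    -- the reduced operator is an operator in the range of `P_n`
    (∀ u : (W.reduced p n hb).domain,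
      ∃ v : (W.reduced p n hb).domain,
        (v : GaussSpace ι) = S.quantizedProj (p.space n) u ∧
        W.reduced p n hb v = W.reduced p n hb u ∧
        S.quantizedProj (p.space n) (W.reduced p n hb u) = W.reduced p n hb u) ∧
    -- coherent matrix elements
    (∀ α β : H, ∃ v : (W.reduced p n hb).domain,
      (v : GaussSpace ι) = S.coherent β ∧
      ⟪S.coherent α, W.reduced p n hb v⟫_ℂ =
        W.eval (p.proj n α) (p.proj n β) * Complex.exp ⟪p.proj n α, p.proj n β⟫_ℂ) ∧
    -- in real orthonormal coordinates of the range of `p_n`, it is the polynomial partial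
    -- differential operator with normal symbol `H(p_n α*, p_n α)`
    (∃ (r : ℕ) (b : Fin r → H), S.IsRealBasis (p.space n) b) ∧
    ∀ (r : ℕ) (b : Fin r → H), S.IsRealBasis (p.space n) b →
      (∀ F : GaussSpace ι, S.quantizedProj (p.space n) F = F ↔
        ∃ f : (Fin r → ℝ) → ℂ, Measurable f ∧ F =ᵐ[gaussMeasure ι] fun ξ => f (S.coords b ξ)) ∧
      ∃ w : MvPolynomial (Fin r ⊕ Fin r) ℂ,
        (∀ α β : H, MvPolynomial.eval
          (Sum.elim (fun j => conj ⟪b j, α⟫_ℂ) (fun j => ⟪b j, β⟫_ℂ)) w =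
            W.eval (p.proj n α) (p.proj n β)) ∧
        ActsAsNormalOp (W.reduced p n hb) (S.coords b) w := by
  have hι := S.countable_index
  have := p.finite n
  have hK := p.smooth n
  -- The reduction to the range of P_n and the coherent matrix elements are basis-free statements,
  -- so one auxiliary real basis is enough to prove them.
  obtain ⟨r₀, b₀, hb₀⟩ := S.exists_isRealBasis (p.space n) (p.real n)
  have hB₀ := hb₀.isRealFrame hK
  refine ⟨S.quantizedProj_coherent (p.space n), fun u => ?_, fun α β => ?_, ⟨r₀, b₀, hb₀⟩,
    fun r b hb' => ?_⟩
  · exact friedrichs_compress hb (hb₀.dense_compress_domain hK W hB₀)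
      (S.quantizedProj_quantizedProj _) (S.inner_quantizedProj _) u
  · exact hb₀.exists_inner_coherent hK hW hB₀ hb α β
  · have hB := hb'.isRealFrame hK
    exact ⟨hb'.quantizedProj_eq_self_iff_comp hB, _, hb'.eval_symbolPoly W,
      hb'.actsAsNormalOp hK hW hB hb⟩
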